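/- Fix $\gamma>3$. For measurable $h$ on $\mathbb{R}^+=(0,\infty)$ let $\|h\|_\gamma=\operatorname{ess\,sup}_{\epsilon>0}(1+\epsilon)^\gamma|h(\epsilon)|$, and let $L^\infty(\mathbb{R}^+;(1+\epsilon)^\gamma)$ be the space of $h$ with $\|h\|_\gamma<\infty$. Consider the isotropic Nordheim equation $$\partial_t f_1=\frac{8\pi^2}{\sqrt2}\int_0^\infty\!\!\int_0^\infty\big[f_3f_4(1+f_1+f_2)-f_1f_2(1+f_3+f_4)\big]\,W\,d\epsilon_3\,d\epsilon_4,\qquad W=\frac{\min\{\sqrt{\epsilon_1},\sqrt{\epsilon_2},\sqrt{\epsilon_3},\sqrt{\epsilon_4}\}}{\sqrt{\epsilon_1}},\tag{N}$$ where $f_j=f(t,\epsilon_j)$, $\epsilon_2=\epsilon_3+\epsilon_4-\epsilon_1$, and $W=0$ if $\epsilon_2<0$. For $0<T'\le\infty$, a mild solution on $[0,T')$ with initial datum $f_0$ is a measurable $f$ with $\sup_{t\in K}\|f(t,\cdot)\|_\gamma<\infty$ for all compact $K\subset[0,T')$ such that, for a.e. $t\in[0,T')$ and a.e. $\epsilon_1>0$,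 $$f(t,\epsilon_1)=f_0(\epsilon_1)\Psi(t,\epsilon_1)+\frac{8\pi^2}{\sqrt2}\int_0^t\frac{\Psi(t,\epsilon_1)}{\Psi(s,\epsilon_1)}\int_0^\infty\!\!\int_0^\infty f_3f_4(1+f_1+f_2)\,W\,d\epsilon_3\,d\epsilon_4\,ds,\tag{M}$$ where $\Psi(t,\epsilon_1)=\exp\big(-\int_0^t a(s,\epsilon_1)\,ds\big)$ and $a(t,\epsilon_1)=\frac{8\pi^2}{\sqrt2}\int_0^\infty\!\int_0^\infty f_2(1+f_3+f_4)\,W\,d\epsilon_3\,d\epsilon_4$. **Theorem.** Let $\gamma>3$ and $B\ge0$. There is $T>0$, depending only on $\gamma$ and $B$, such that for every $f_0\in L^\infty(\mathbb{R}^+;(1+\epsilon)^\gamma)$ with $f_0\ge0$ a.e. and $\|f_0\|_\gamma\le B$ there are $T_{\max}\in[T,\infty]$ and a function $f$ with the following properties. 1. $f$ is a mild solution on $[0,T_{\max})$ with initial datum $f_0$; moreover, for every $t\in[0,T_{\max})$, $f(t,\cdot)\ge0$ a.e. and (M) holds for a.e. $\epsilon_1$. 2. If $g$ is a mild solution on some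 interval $[0,T')$, $0<T'\le\infty$, with initial datum $f_0$, then $T'\le T_{\max}$ and $g=f$ a.e. on $[0,T')\times\mathbb{R}^+$. In particular $f$ is the unique mild solution on $[0,T)$, and $[0,T_{\max})$ is its maximal interval of existence. 3. For all $t\in(0,T)$ and $w\in\{\frac12,\frac32\}$, $\;4\pi\sqrt2\int_0^\infty f_0(\epsilon)\,\epsilon^w\,d\epsilon=4\pi\sqrt2\int_0^\infty f(t,\epsilon)\,\epsilon^w\,d\epsilon$. 4. $f\in W^{1,\infty}((0,T);L^\infty(\mathbb{R}^+))$, and for every $t\in(0,T_{\max})$ and a.e. $\epsilon_1>0$ the function $f(\cdot,\epsilon_1)$ is differentiable at $t$ and (N) holds at $(t,\epsilon_1)$. 5. If $T_{\max}<\infty$, then $\limsup_{t\to T_{\max}^-}\|f(t,\cdot)\|_{L^\infty(\mathbb{R}^+)}=\infty$. -/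

import Mathlib

open MeasureTheory Set Filter
open scoped ENNReal NNReal Topology

noncomputable section

namespace Nordheim

/-- Lebesgue measure on the half-line of energies `ε > 0`. -/
abbrev halfLine : Measure ℝ := volume.restrict (Ioi (0 : ℝ))

/-- The norm of `L^∞(ℝ⁺; (1+ε)^γ)`: the essential supremum over `ε > 0` of `(1+ε)^γ |h ε|`. -/
def wNorm (γ : ℝ) (h : ℝ → ℝ) : ℝ≥0∞ :=
  eLpNorm (fun ε => (1 + ε) ^ γ * h ε) ∞ halfLine

/-- Membership of `h` in `L^∞(ℝ⁺; (1+ε)^γ)`. -/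
def MemW (γ : ℝ) (h : ℝ → ℝ) : Prop :=
  AEStronglyMeasurable h halfLine ∧ wNorm γ h < ∞

/-- The kernel `W = min {√ε₁, √ε₂, √ε₃, √ε₄} / √ε₁`. As `Real.sqrt` vanishes on negative numbers,
`W = 0` when `ε₂ < 0`, so that only configurations of nonnegative energies contribute below. -/
def W (ε₁ ε₂ ε₃ ε₄ : ℝ) : ℝ :=
  min (min (√ε₁) (√ε₂)) (min (√ε₃) (√ε₄)) / √ε₁

/-- The constant `8π²/√2`. -/
def c₀ : ℝ := 8 * Real.pi ^ 2 / √2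

/-- `q(f) = q₃(f) + q₂(f)` as a function of the four values `f₁, f₂, f₃, f₄`. -/
def q (f₁ f₂ f₃ f₄ : ℝ) : ℝ :=
  (f₃ * f₄ * (f₁ + f₂) - f₁ * f₂ * (f₃ + f₄)) + (f₃ * f₄ - f₁ * f₂)

/-- Right-hand side of the Nordheim equation, at the profile `h` and the energy `ε₁`;
here `ε₂ = ε₃ + ε₄ - ε₁`. -/
def collision (h : ℝ → ℝ) (ε₁ : ℝ) : ℝ :=
  c₀ * ∫ ε₃ in Ioi (0 : ℝ), ∫ ε₄ in Ioi (0 : ℝ),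
    q (h ε₁) (h (ε₃ + ε₄ - ε₁)) (h ε₃) (h ε₄) * W ε₁ (ε₃ + ε₄ - ε₁) ε₃ ε₄

/-- `∫∫ f₃ f₄ (1 + f₁ + f₂) W dε₃ dε₄`. -/
def gain (h : ℝ → ℝ) (ε₁ : ℝ) : ℝ :=
  ∫ ε₃ in Ioi (0 : ℝ), ∫ ε₄ in Ioi (0 : ℝ),
    h ε₃ * h ε₄ * (1 + h ε₁ + h (ε₃ + ε₄ - ε₁)) * W ε₁ (ε₃ + ε₄ - ε₁) ε₃ ε₄

/-- `a = (8π²/√2) ∫∫ f₂ (1 + f₃ + f₄) W dε₃ dε₄`. -/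
def lossRate (h : ℝ → ℝ) (ε₁ : ℝ) : ℝ :=
  c₀ * ∫ ε₃ in Ioi (0 : ℝ), ∫ ε₄ in Ioi (0 : ℝ),
    h (ε₃ + ε₄ - ε₁) * (1 + h ε₃ + h ε₄) * W ε₁ (ε₃ + ε₄ - ε₁) ε₃ ε₄

/-- `Ψ(t, ε₁) = exp (-∫_{T₁}^t a(s, ε₁) ds)`. -/
def Psi (T₁ : ℝ) (f : ℝ → ℝ → ℝ) (t ε₁ : ℝ) : ℝ :=
  Real.exp (-∫ s in T₁..t, lossRate (f s) ε₁)

/-- Right-hand side of the mild (Duhamel) formulation with initial datum `f₀` at time `T₁`. -/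
def mildRHS (T₁ : ℝ) (f₀ : ℝ → ℝ) (f : ℝ → ℝ → ℝ) (t ε₁ : ℝ) : ℝ :=
  f₀ ε₁ * Psi T₁ f t ε₁ +
    c₀ * ∫ s in T₁..t, Psi T₁ f t ε₁ / Psi T₁ f s ε₁ * gain (f s) ε₁

/-- The time interval `[T₁, T₂)`, where `T₂` may be `+∞`. -/
def timeIco (T₁ : ℝ) (T₂ : EReal) : Set ℝ := {t | T₁ ≤ t ∧ (t : EReal) < T₂}

/-- Membership of `f` (time first, energy second) in
`L^∞_loc([T₁, T₂); L^∞(ℝ⁺; (1+ε)^γ))`. -/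
structure MemLocW (γ T₁ : ℝ) (T₂ : EReal) (f : ℝ → ℝ → ℝ) : Prop where
  aestronglyMeasurable : AEStronglyMeasurable (Function.uncurry f)
    ((volume : Measure (ℝ × ℝ)).restrict (timeIco T₁ T₂ ×ˢ Ioi (0 : ℝ)))
  memW : ∀ t ∈ timeIco T₁ T₂, MemW γ (f t)
  bounded : ∀ K : Set ℝ, IsCompact K → K ⊆ timeIco T₁ T₂ → ⨆ t ∈ K, wNorm γ (f t) < ∞

/-- Mild solutions on `[T₁, T₂)` with initial datum `f₀` at time `T₁`. -/
structure IsMildSolution (γ T₁ : ℝ) (T₂ : EReal) (f₀ : ℝ → ℝ) (f : ℝ → ℝ → ℝ) : Prop where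
  nonneg_left : 0 ≤ T₁
  lt : (T₁ : EReal) < T₂
  memLocW : MemLocW γ T₁ T₂ f
  eq_mildRHS : ∀ᵐ t ∂(volume.restrict (timeIco T₁ T₂)), ∀ᵐ ε ∂halfLine,
    f t ε = mildRHS T₁ f₀ f t ε

/-- The Sobolev space `W^{1,∞}((0,T); E)`: `u` and its weak derivative `v` are strongly measurable
and essentially bounded. -/
def MemW1Infty {E : Type*} [NormedAddCommGroup E] [NormedSpace ℝ E] (T : ℝ) (u : ℝ → E) : Prop :=
  MemLp u ∞ (volume.restrict (Ioo 0 T)) ∧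
  ∃ v : ℝ → E, MemLp v ∞ (volume.restrict (Ioo 0 T)) ∧
    ∀ φ : ℝ → ℝ, ContDiff ℝ (⊤ : ℕ∞) φ → HasCompactSupport φ → tsupport φ ⊆ Ioo 0 T →
      ∫ t in Ioo 0 T, deriv φ t • u t = -∫ t in Ioo 0 T, φ t • v t

/-- Membership of `f` in `W^{1,∞}((0,T); L^∞(ℝ⁺))`. -/
def MemW1InftyLinfty (T : ℝ) (f : ℝ → ℝ → ℝ) : Prop :=
  ∃ u : ℝ → Lp ℝ ∞ halfLine,
    (∀ t ∈ Ioo 0 T, ⇑(u t) =ᵐ[halfLine] f t) ∧ MemW1Infty T u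

end Nordheim

end

/-!
The Nordheim equation is solved as a family of linear equations `f' = -a f + c₀ b`, one for each
energy `ε`, whose loss rate `a` and gain `b` are integrals of `f`. The loss rate grows like `√ε` at
high energies, so the equation is not Lipschitz in any weighted `L^∞` space. What saves the argument
is a comparison of leading terms. If `0 ≤ f ≤ K (1+ε)^(-γ)` and `m = ∫ f √ε`, then
`a ≥ c₀ (√ε m - C)` (`le_lossRate`), while `b ≤ K (1+ε)^(-γ) (2/(γ-1) √ε m + C)` (`gain_le`): one of
the two incoming particles carries at least half of the energy, the kernel contributes
`√(ε₃ ∧ ε₄) / √ε`, and integrating the tail of the weight gives `1/(γ-1)`. Since `2/(γ-1) < 1` for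
`γ > 3`, the loss absorbs the growing part of the gain. The same comparison holds for differences of
solutions in a weight of exponent `β` slightly smaller than `γ`, still with `2/(β-1) < 1`
(`exists_gain_sub_le`, `exists_lossRate_sub_le`); lowering the exponent makes the difference of the
loss rates, of size `√ε`, negligible as long as the mass is bounded below. Data without mass are
stationary.

* Existence: `IterSet` is stable under the mild map, and its elements have mass bounded below;
  Picard iteration converges by `exists_contract`, in a norm with weight `e^{-Λt} (1+ε)^β` (see
  `exists_isSol_of_exp_le`).
* Uniqueness: `exists_contract` requires a sign of one of the two solutions only, so the nonnegative
  solution is unique among all, possibly signed, ones (`IsSol.unique_of_forall`). An arbitrary mild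
  solution is only measurable in time, but Duhamel's formula provides a representative that is
  continuous in time and decays at every energy (`exists_reg_of_isMildSolution`).
* Conservation laws: by the symmetries of the kernel the collision operator is orthogonal to
  `√ε (A + B ε)` (`integral_collision_eq_zero`); the integrals converge because `γ > 3`.
* Blow-up: if the `L^∞` norm stays bounded, the conserved mass and energy bound the moment
  `∫ f (1+ε)^(3/2)` (`IsSol.mom_le_of_ae_le`), and comparing loss and gain once more propagates the
  weighted bound (`IsSol.le_of_mom_le`). As the time of local existence depends on this bound only,
  the solution can be extended (`exists_isMaximal`).
* Regularity: the collision operator loses half a power of decay. The remaining exponent `γ - 1/2`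
  exceeds `5/2`, which is enough for `t ↦ f t` to be differentiable into `L^∞` with a Lipschitz
  derivative (`IsSol.memW1InftyLinfty`).
-/

noncomputable section

namespace Nordheim

/-! ### Weights, moments and the kernel -/

/-- The weight `(1+ε)^(-β)` on `ε > 0`, extended by `0` to nonpositive energies. -/
def wt (β ε : ℝ) : ℝ := if 0 < ε then (1 + ε) ^ (-β) else 0

lemma wt_of_pos {β ε : ℝ} (h : 0 < ε) : wt β ε = (1 + ε) ^ (-β) := if_pos h

lemma wt_of_nonpos {β ε : ℝ} (h : ε ≤ 0) : wt β ε = 0 := if_neg (not_lt.2 h)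

lemma wt_pos {β ε : ℝ} (h : 0 < ε) : 0 < wt β ε := by
  rw [wt_of_pos h]; positivity

lemma wt_nonneg (β ε : ℝ) : 0 ≤ wt β ε := by
  rcases lt_or_ge 0 ε with h | h
  · exact (wt_pos h).le
  · rw [wt_of_nonpos h]

lemma wt_le_one {β : ℝ} (hβ : 0 ≤ β) (ε : ℝ) : wt β ε ≤ 1 := by
  rcases lt_or_ge 0 ε with h | h
  · rw [wt_of_pos h]
    exact Real.rpow_le_one_of_one_le_of_nonpos (by linarith) (by linarith)
  · rw [wt_of_nonpos h]; norm_num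

lemma wt_anti {β γ : ℝ} (h : β ≤ γ) (ε : ℝ) : wt γ ε ≤ wt β ε := by
  rcases lt_or_ge 0 ε with h' | h'
  · rw [wt_of_pos h', wt_of_pos h']
    exact Real.rpow_le_rpow_of_exponent_le (by linarith) (by linarith)
  · rw [wt_of_nonpos h', wt_of_nonpos h']

lemma measurable_wt (β : ℝ) : Measurable (wt β) :=
  Measurable.ite measurableSet_Ioi (by fun_prop) measurable_const

lemma wt_mul_rpow {β σ ε : ℝ} (h : 0 < ε) : wt β ε * (1 + ε) ^ σ = wt (β - σ) ε := by
  rw [wt_of_pos h, wt_of_pos h, ← Real.rpow_add (by linarith)]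
  congr 1; ring

lemma integrable_wt {β : ℝ} (hβ : 1 < β) : Integrable (wt β) := by
  have h1 : IntegrableOn (fun x : ℝ => (x + 1) ^ (-β)) (Ioi 0) :=
    integrableOn_add_rpow_Ioi_of_lt (by linarith) (by norm_num)
  have h2 : wt β = (Ioi (0 : ℝ)).indicator (fun x : ℝ => (x + 1) ^ (-β)) := by
    ext x
    by_cases hx : 0 < x
    · rw [wt_of_pos hx, indicator_of_mem (mem_Ioi.2 hx), add_comm]
    · rw [wt_of_nonpos (not_lt.1 hx), indicator_of_notMem (by simpa using hx)]
  rw [h2]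
  exact h1.integrable_indicator measurableSet_Ioi

/-- The moment weight `(1+ε)^(3/2)`. -/
def mw (ε : ℝ) : ℝ := (1 + ε) * √(1 + ε)

lemma mw_eq_rpow {ε : ℝ} (h : 0 < ε) : mw ε = (1 + ε) ^ (3 / 2 : ℝ) := by
  have h1 : 0 < 1 + ε := by linarith
  rw [mw, Real.sqrt_eq_rpow]
  nth_rewrite 1 [← Real.rpow_one (1 + ε)]
  rw [← Real.rpow_add h1]; norm_num

lemma one_le_sqrt_one_add {ε : ℝ} (h : 0 ≤ ε) : 1 ≤ √(1 + ε) := by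
  rw [Real.one_le_sqrt]; linarith

lemma one_add_le_mw {ε : ℝ} (h : 0 ≤ ε) : 1 + ε ≤ mw ε := by
  have := one_le_sqrt_one_add h
  rw [mw]; nlinarith

lemma one_le_mw {ε : ℝ} (h : 0 ≤ ε) : 1 ≤ mw ε := by linarith [one_add_le_mw h]

lemma sqrt_le_mw {ε : ℝ} (h : 0 ≤ ε) : √ε ≤ mw ε := by
  have h1 := one_le_sqrt_one_add h
  have h2 : √ε ≤ √(1 + ε) := Real.sqrt_le_sqrt (by linarith)
  rw [mw]; nlinarith

lemma mul_sqrt_le_mw {ε : ℝ} (h : 0 ≤ ε) : ε * √ε ≤ mw ε := by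
  have h2 : √ε ≤ √(1 + ε) := Real.sqrt_le_sqrt (by linarith)
  rw [mw]; exact mul_le_mul (by linarith) h2 (Real.sqrt_nonneg _) (by linarith)

@[fun_prop]
lemma measurable_mw : Measurable mw := by unfold mw; fun_prop

/-- The profile `h` is measurable and dominated by `K (1+ε)^(-β)`; in particular it vanishes at
nonpositive energies. -/
structure Dec (β K : ℝ) (h : ℝ → ℝ) : Prop where
  meas : Measurable h
  bound : ∀ ε, |h ε| ≤ K * wt β ε

/-- The moment `∫ |h| (1+ε)^(3/2) dε`. -/
def mom (h : ℝ → ℝ) : ℝ := ∫ u, |h u| * mw u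

/-- The mass `∫ h √ε dε` (up to a numerical factor). -/
def mass (h : ℝ → ℝ) : ℝ := ∫ u, h u * √u

namespace Dec

variable {β γ K : ℝ} {h k : ℝ → ℝ}

lemma zero (hd : Dec β K h) {ε : ℝ} (hε : ε ≤ 0) : h ε = 0 := by
  have := hd.bound ε
  rw [wt_of_nonpos hε, mul_zero] at this
  exact abs_eq_zero.1 (le_antisymm this (abs_nonneg _))

lemma nonneg (hd : Dec β K h) : 0 ≤ K := by
  have h1 := hd.bound 1
  have h2 : 0 < wt β 1 := wt_pos one_pos
  by_contra! hK
  nlinarith [abs_nonneg (h 1)]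

lemma mono (hd : Dec β K h) {K' : ℝ} (hK : K ≤ K') : Dec β K' h :=
  ⟨hd.meas, fun ε => (hd.bound ε).trans (mul_le_mul_of_nonneg_right hK (wt_nonneg _ _))⟩

lemma anti (hd : Dec γ K h) (hβ : β ≤ γ) : Dec β K h :=
  ⟨hd.meas, fun ε => (hd.bound ε).trans (mul_le_mul_of_nonneg_left (wt_anti hβ ε) hd.nonneg)⟩

lemma abs (hd : Dec β K h) : Dec β K (fun ε => |h ε|) :=
  ⟨hd.meas.abs, fun ε => by rw [abs_abs]; exact hd.bound ε⟩

lemma le (hd : Dec β K h) (hβ : 0 ≤ β) (ε : ℝ) : |h ε| ≤ K :=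
  (hd.bound ε).trans (mul_le_of_le_one_right hd.nonneg (wt_le_one hβ ε))

lemma sub {K' : ℝ} (hd : Dec β K h) (hk : Dec β K' k) : Dec β (K + K') (fun ε => h ε - k ε) :=
  ⟨hd.meas.sub hk.meas, fun ε => (abs_sub _ _).trans
    (by rw [add_mul]; exact add_le_add (hd.bound ε) (hk.bound ε))⟩

end Dec

lemma dec_wt (β : ℝ) : Dec β 1 (wt β) :=
  ⟨measurable_wt β, fun ε => by rw [abs_of_nonneg (wt_nonneg _ _), one_mul]⟩

/-- Integrability against a weight growing at most like the moment weight. -/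
lemma Dec.integrable_mul {β K : ℝ} {h : ℝ → ℝ} (hβ : 5 / 2 < β) (hd : Dec β K h) {φ : ℝ → ℝ}
    (hφ : Measurable φ) (hb : ∀ u, 0 < u → |φ u| ≤ mw u) : Integrable (fun u => h u * φ u) := by
  have h1 : Integrable (fun u => K * wt (β - 3 / 2) u) :=
    (integrable_wt (by linarith)).const_mul K
  refine h1.mono' (hd.meas.mul hφ).aestronglyMeasurable (ae_of_all _ fun u => ?_)
  rw [Real.norm_eq_abs, abs_mul]
  rcases lt_or_ge 0 u with hu | hu
  · calc |h u| * |φ u| ≤ (K * wt β u) * mw u :=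
          mul_le_mul (hd.bound u) (hb u hu) (abs_nonneg _)
            (mul_nonneg hd.nonneg (wt_nonneg _ _))
      _ = K * wt (β - 3 / 2) u := by rw [mw_eq_rpow hu, mul_assoc, wt_mul_rpow hu]
  · rw [hd.zero hu, abs_zero, zero_mul]
    exact mul_nonneg hd.nonneg (wt_nonneg _ _)

section moments

variable {β K : ℝ} {h k : ℝ → ℝ}

lemma abs_mw_le {u : ℝ} (hu : 0 < u) : |mw u| ≤ mw u :=
  (abs_of_nonneg (by linarith [one_le_mw hu.le])).le

lemma Dec.integrable_mom (hβ : 5 / 2 < β) (hd : Dec β K h) :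
    Integrable (fun u => |h u| * mw u) :=
  hd.abs.integrable_mul hβ measurable_mw fun _ => abs_mw_le

lemma Dec.integrable (hβ : 5 / 2 < β) (hd : Dec β K h) : Integrable h := by
  have := hd.integrable_mul hβ (φ := fun _ => 1) measurable_const
    (fun u hu => by simpa using one_le_mw hu.le)
  simpa using this

lemma Dec.integrable_sqrt (hβ : 5 / 2 < β) (hd : Dec β K h) :
    Integrable (fun u => h u * √u) :=
  hd.integrable_mul hβ (by fun_prop)
    (fun u hu => by rw [abs_of_nonneg (Real.sqrt_nonneg _)]; exact sqrt_le_mw hu.le)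

/-- An integral against a weight below the moment weight is below the moment. -/
lemma Dec.integral_le_mom (hβ : 5 / 2 < β) (hd : Dec β K h) {φ : ℝ → ℝ}
    (hφ : Measurable φ) (hb : ∀ u, 0 < u → |φ u| ≤ mw u) : ∫ u, |h u| * φ u ≤ mom h := by
  refine integral_mono (hd.abs.integrable_mul hβ hφ hb) (hd.integrable_mom hβ) fun u => ?_
  rcases lt_or_ge 0 u with hu | hu
  · exact mul_le_mul_of_nonneg_left ((le_abs_self _).trans (hb u hu)) (abs_nonneg _)
  · simp [hd.zero hu]

lemma Dec.mom_nonneg (hd : Dec β K h) : 0 ≤ mom h := by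
  refine integral_nonneg fun u => ?_
  rcases lt_or_ge 0 u with hu | hu
  · exact mul_nonneg (abs_nonneg _) (by linarith [one_le_mw hu.le])
  · simp [hd.zero hu]

lemma Dec.integral_abs_le_mom (hβ : 5 / 2 < β) (hd : Dec β K h) : ∫ u, |h u| ≤ mom h := by
  have := hd.integral_le_mom hβ (φ := fun _ => 1) measurable_const
    (fun u hu => by simpa using one_le_mw hu.le)
  simpa using this

lemma Dec.mass_abs_le_mom (hβ : 5 / 2 < β) (hd : Dec β K h) : mass (fun u => |h u|) ≤ mom h :=
  hd.integral_le_mom hβ (by fun_prop)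
    (fun u hu => by rw [abs_of_nonneg (Real.sqrt_nonneg _)]; exact sqrt_le_mw hu.le)

lemma Dec.mom_le (hβ : 5 / 2 < β) (hd : Dec β K h) : mom h ≤ K * mom (wt β) := by
  rw [mom, mom, ← integral_const_mul]
  refine integral_mono (hd.integrable_mom hβ) (((dec_wt β).integrable_mom hβ).const_mul K)
    fun u => ?_
  rcases lt_or_ge 0 u with hu | hu
  · have h1 : 0 ≤ mw u := by linarith [one_le_mw hu.le]
    calc |h u| * mw u ≤ (K * wt β u) * mw u := mul_le_mul_of_nonneg_right (hd.bound u) h1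
      _ = K * (|wt β u| * mw u) := by rw [abs_of_nonneg (wt_nonneg _ _)]; ring
  · simp [hd.zero hu, wt_of_nonpos hu]

lemma mom_abs (h : ℝ → ℝ) : mom (fun u => |h u|) = mom h := by simp [mom]

lemma mom_wt_nonneg (β : ℝ) : 0 ≤ mom (wt β) := (dec_wt β).mom_nonneg

lemma mass_nonneg (h0 : ∀ u, 0 ≤ h u) : 0 ≤ mass h :=
  integral_nonneg fun u => mul_nonneg (h0 u) (Real.sqrt_nonneg u)

end moments

/-- The kernel `W` at `ε₂ = ε₃ + ε₄ - ε₁`, as a function of `p = (ε₃, ε₄)`. -/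
def V (e : ℝ) (p : ℝ × ℝ) : ℝ := W e (p.1 + p.2 - e) p.1 p.2

lemma V_nonneg (e : ℝ) (p : ℝ × ℝ) : 0 ≤ V e p := by
  unfold V W; positivity

lemma V_le_one (e : ℝ) (p : ℝ × ℝ) : V e p ≤ 1 :=
  div_le_one_of_le₀ ((min_le_left _ _).trans (min_le_left _ _)) (Real.sqrt_nonneg _)

lemma V_le_two (e : ℝ) (p : ℝ × ℝ) : V e p ≤ √(p.1 + p.2 - e) / √e :=
  div_le_div_of_nonneg_right ((min_le_left _ _).trans (min_le_right _ _)) (Real.sqrt_nonneg _)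

lemma V_le_snd (e : ℝ) (p : ℝ × ℝ) : V e p ≤ √p.2 / √e :=
  div_le_div_of_nonneg_right ((min_le_right _ _).trans (min_le_right _ _)) (Real.sqrt_nonneg _)

lemma V_swap (e : ℝ) (p : ℝ × ℝ) : V e p.swap = V e p := by
  simp only [V, W, Prod.fst_swap, Prod.snd_swap]
  rw [min_comm (√p.2), add_comm p.2]

lemma V_of_fst {e : ℝ} {p : ℝ × ℝ} (h : p.1 ≤ 0) : V e p = 0 := by
  simp [V, W, Real.sqrt_eq_zero_of_nonpos h]

lemma V_of_snd {e : ℝ} {p : ℝ × ℝ} (h : p.2 ≤ 0) : V e p = 0 := by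
  simp [V, W, Real.sqrt_eq_zero_of_nonpos h]

lemma V_of_two {e : ℝ} {p : ℝ × ℝ} (h : p.1 + p.2 ≤ e) : V e p = 0 := by
  have h' : √(p.1 + p.2 - e) = 0 := Real.sqrt_eq_zero_of_nonpos (by linarith)
  simp [V, W, h']

lemma V_of_nonpos {e : ℝ} {p : ℝ × ℝ} (h : e ≤ 0) : V e p = 0 := by
  simp [V, W, Real.sqrt_eq_zero_of_nonpos h]

lemma pos_of_V_ne_zero {e : ℝ} {p : ℝ × ℝ} (h : V e p ≠ 0) :
    0 < e ∧ 0 < p.1 ∧ 0 < p.2 ∧ e < p.1 + p.2 := by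
  refine ⟨?_, ?_, ?_, ?_⟩ <;> by_contra! h'
  exacts [h (V_of_nonpos h'), h (V_of_fst h'), h (V_of_snd h'), h (V_of_two h')]

@[fun_prop]
lemma measurable_V_uncurry : Measurable (Function.uncurry V) := by
  unfold V W Function.uncurry; fun_prop

@[fun_prop]
lemma measurable_V (e : ℝ) : Measurable (V e) := by
  unfold V W; fun_prop

lemma abs_mul_V_le (e : ℝ) (p : ℝ × ℝ) (a : ℝ) : |a * V e p| ≤ |a| := by
  rw [abs_mul, abs_of_nonneg (V_nonneg e p)]
  exact mul_le_of_le_one_right (abs_nonneg a) (V_le_one e p)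

/-- Multiplication by the kernel, which takes values in `[0,1]`, preserves integrability. -/
lemma integrable_mul_V {F : ℝ × ℝ → ℝ} (hF : Integrable F) (e : ℝ) :
    Integrable (fun p => F p * V e p) :=
  hF.abs.mono' (hF.aestronglyMeasurable.mul (measurable_V e).aestronglyMeasurable)
    (ae_of_all _ fun p => abs_mul_V_le e p _)

lemma abs_integral_mul_V_le {F : ℝ × ℝ → ℝ} (hF : Integrable F) (e : ℝ) :
    |∫ p, F p * V e p| ≤ ∫ p, |F p| :=
  (abs_integral_le_integral_abs).trans
    (integral_mono (integrable_mul_V hF e).abs hF.abs fun p => abs_mul_V_le e p _)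

/-- The change of variables `(ε₃, ε₄) ↦ (ε₃, ε₂)` preserves the measure. -/
lemma measurePreserving_shear (e : ℝ) :
    MeasurePreserving (fun p : ℝ × ℝ => (p.1, p.1 + p.2 - e)) := by
  have h1 := measurePreserving_prod_add (volume : Measure ℝ) (volume : Measure ℝ)
  have h2 : MeasurePreserving (Prod.map id (fun y : ℝ => y - e))
      ((volume : Measure ℝ).prod (volume : Measure ℝ)) (volume.prod volume) :=
    (MeasurePreserving.id _).prod (measurePreserving_sub_right volume e)
  exact h2.comp h1

lemma integrable_fst_snd {h k : ℝ → ℝ} (hh : Integrable h) (hk : Integrable k) :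
    Integrable (fun p : ℝ × ℝ => h p.1 * k p.2) := hh.mul_prod hk

lemma integrable_fst_two {h l : ℝ → ℝ} (hh : Integrable h) (hl : Integrable l) (e : ℝ) :
    Integrable (fun p : ℝ × ℝ => h p.1 * l (p.1 + p.2 - e)) :=
  (measurePreserving_shear e).integrable_comp_of_integrable (hh.mul_prod hl)

lemma integrable_snd_two {h l : ℝ → ℝ} (hh : Integrable h) (hl : Integrable l) (e : ℝ) :
    Integrable (fun p : ℝ × ℝ => h p.2 * l (p.1 + p.2 - e)) := by
  have := (integrable_fst_two hh hl e).swap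
  refine this.congr (ae_of_all _ fun p => ?_)
  simp [add_comm]

lemma integral_fst_snd (h k : ℝ → ℝ) :
    ∫ p : ℝ × ℝ, |h p.1 * k p.2| = (∫ u, |h u|) * ∫ u, |k u| := by
  simp_rw [abs_mul]
  exact integral_prod_mul (μ := (volume : Measure ℝ)) (ν := (volume : Measure ℝ))
    (fun u => |h u|) (fun u => |k u|)

lemma integral_fst_two {h l : ℝ → ℝ} (hh : Measurable h) (hl : Measurable l) (e : ℝ) :
    ∫ p : ℝ × ℝ, |h p.1 * l (p.1 + p.2 - e)| = (∫ u, |h u|) * ∫ u, |l u| := by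
  have hF : Measurable (fun q : ℝ × ℝ => |h q.1 * l q.2|) := by fun_prop
  have hm := integral_map (μ := (volume : Measure (ℝ × ℝ)))
    (measurePreserving_shear e).measurable.aemeasurable hF.aestronglyMeasurable
  rw [(measurePreserving_shear e).map_eq] at hm
  rw [← integral_fst_snd h l, hm]

lemma integral_snd_two {h l : ℝ → ℝ} (hh : Measurable h) (hl : Measurable l) (e : ℝ) :
    ∫ p : ℝ × ℝ, |h p.2 * l (p.1 + p.2 - e)| = (∫ u, |h u|) * ∫ u, |l u| := by
  rw [← integral_fst_two hh hl e]
  have := integral_prod_swap (μ := (volume : Measure ℝ)) (ν := (volume : Measure ℝ))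
    (fun p : ℝ × ℝ => |h p.1 * l (p.1 + p.2 - e)|)
  refine Eq.trans (integral_congr_ae (ae_of_all _ fun p => ?_)) this
  simp [add_comm]

/-! ### The linear part of the loss rate -/

/-- The integral of the kernel over all collisions with prescribed `ε₁ = e` and `ε₂ = u`. -/
def kerInt (e u : ℝ) : ℝ := ∫ x, V e (x, u + e - x)

lemma kerInt_nonneg (e u : ℝ) : 0 ≤ kerInt e u := integral_nonneg fun _ => V_nonneg _ _

lemma V_line_le (e u x : ℝ) :
    V e (x, u + e - x) ≤ (Ioo 0 (u + e)).indicator (fun _ => min 1 (√u / √e)) x := by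
  by_cases hx : x ∈ Ioo 0 (u + e)
  · rw [indicator_of_mem hx]
    refine le_min (V_le_one _ _) ?_
    have := V_le_two e (x, u + e - x)
    rwa [show (x, u + e - x).1 + (x, u + e - x).2 - e = u by simp] at this
  · rw [indicator_of_notMem hx]
    refine le_of_eq ?_
    by_contra h
    obtain ⟨-, h1, h2, -⟩ := pos_of_V_ne_zero h
    exact hx ⟨h1, by simpa using h2⟩

lemma integrable_V_line (e u : ℝ) : Integrable (fun x => V e (x, u + e - x)) := by
  have h1 : Integrable ((Ioo 0 (u + e)).indicator (fun _ : ℝ => min 1 (√u / √e))) :=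
    (integrable_indicator_iff measurableSet_Ioo).2
      (integrableOn_const (by simp))
  refine h1.mono' (Measurable.aestronglyMeasurable (by fun_prop)) (ae_of_all _ fun x => ?_)
  rw [Real.norm_eq_abs, abs_of_nonneg (V_nonneg _ _)]
  exact V_line_le e u x

/-- The region of integration is `0 < ε₃ < u + e`, on which the kernel is at most `1` and at most
`√u / √e`. -/
lemma kerInt_le {e u : ℝ} (he : 0 < e) (hu : 0 < u) : kerInt e u ≤ 2 * √(1 + e) * (1 + u) := by
  have h1 : Integrable ((Ioo 0 (u + e)).indicator (fun _ : ℝ => min 1 (√u / √e))) :=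
    (integrable_indicator_iff measurableSet_Ioo).2
      (integrableOn_const (by simp))
  have h2 : kerInt e u ≤ (u + e) * min 1 (√u / √e) := by
    refine (integral_mono (integrable_V_line e u) h1 (V_line_le e u)).trans (le_of_eq ?_)
    rw [integral_indicator measurableSet_Ioo, setIntegral_const]
    simp [Measure.real, ENNReal.toReal_ofReal (show 0 ≤ u + e by linarith)]
  have hm1 : min 1 (√u / √e) ≤ 1 := min_le_left _ _
  have hm2 : e * min 1 (√u / √e) ≤ √e * √u := by
    calc e * min 1 (√u / √e) ≤ e * (√u / √e) :=
          mul_le_mul_of_nonneg_left (min_le_right _ _) he.le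
      _ = √e * √u := by
          have : √e ≠ 0 := (Real.sqrt_pos.2 he).ne'
          field_simp
          rw [Real.sq_sqrt he.le]
  have h3 : √e ≤ √(1 + e) := Real.sqrt_le_sqrt (by linarith)
  have h4 : √u ≤ 1 + u := by
    nlinarith [Real.sq_sqrt hu.le, Real.sqrt_nonneg u, sq_nonneg (√u - 1)]
  have h5 := one_le_sqrt_one_add he.le
  have h6 : √e * √u ≤ √(1 + e) * (1 + u) :=
    mul_le_mul h3 h4 (Real.sqrt_nonneg _) (Real.sqrt_nonneg _)
  nlinarith

/-- For `u < ε₃ < e` the smallest of the four energies is `u`. -/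
lemma le_kerInt {e u : ℝ} (he : 0 < e) (hu : 0 < u) : √u / √e * (e - u) ≤ kerInt e u := by
  rcases le_or_gt e u with h | h
  · exact (mul_nonpos_of_nonneg_of_nonpos (by positivity) (by linarith)).trans
      (kerInt_nonneg e u)
  have h1 : Integrable ((Ioo u e).indicator (fun _ : ℝ => √u / √e)) :=
    (integrable_indicator_iff measurableSet_Ioo).2 (integrableOn_const (by simp))
  have h2 : √u / √e * (e - u) = ∫ x, (Ioo u e).indicator (fun _ : ℝ => √u / √e) x := by
    rw [integral_indicator measurableSet_Ioo, setIntegral_const]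
    simp [Measure.real, ENNReal.toReal_ofReal (show 0 ≤ e - u by linarith), mul_comm]
  rw [h2]
  refine integral_mono h1 (integrable_V_line e u) fun x => ?_
  by_cases hx : x ∈ Ioo u e
  · rw [indicator_of_mem hx]
    refine div_le_div_of_nonneg_right ?_ (Real.sqrt_nonneg _)
    have e1 : x + (u + e - x) - e = u := by ring
    simp only [e1]
    refine le_min (le_min ?_ le_rfl) (le_min ?_ ?_) <;> apply Real.sqrt_le_sqrt
    · exact h.le
    · exact hx.1.le
    · linarith [hx.2]
  · rw [indicator_of_notMem hx]; exact V_nonneg _ _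

lemma measurable_kerInt (e : ℝ) : Measurable (kerInt e) := by
  have : StronglyMeasurable (fun q : ℝ × ℝ => V e (q.2, q.1 + e - q.2)) :=
    Measurable.stronglyMeasurable (by fun_prop)
  exact this.integral_prod_right'.measurable

section two

variable {β K : ℝ} {l : ℝ → ℝ}

lemma integrable_mul_kerInt (hβ : 5 / 2 < β) (hl : Dec β K l) {e : ℝ} (he : 0 < e) :
    Integrable (fun u => l u * kerInt e u) := by
  refine ((hl.integrable_mom hβ).const_mul (2 * √(1 + e))).mono'
    (hl.meas.mul (measurable_kerInt e)).aestronglyMeasurable (ae_of_all _ fun u => ?_)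
  rw [Real.norm_eq_abs, abs_mul, abs_of_nonneg (kerInt_nonneg e u)]
  rcases lt_or_ge 0 u with hu | hu
  · have h1 := kerInt_le he hu
    have h2 := one_add_le_mw hu.le
    have h3 : 2 * √(1 + e) * (1 + u) ≤ 2 * √(1 + e) * mw u := by gcongr
    nlinarith [abs_nonneg (l u)]
  · simp [hl.zero hu]

lemma integrable_line (hβ : 5 / 2 < β) (hl : Dec β K l) {e : ℝ} (he : 0 < e) :
    Integrable (fun q : ℝ × ℝ => l q.2 * V e (q.1, q.2 + e - q.1)) := by
  have hm := hl.meas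
  have hmeas : Measurable (fun q : ℝ × ℝ => l q.2 * V e (q.1, q.2 + e - q.1)) := by fun_prop
  refine (integrable_prod_iff' hmeas.aestronglyMeasurable).2 ⟨ae_of_all _ fun u => ?_, ?_⟩
  · exact (integrable_V_line e u).const_mul (l u)
  · refine (integrable_mul_kerInt hβ hl he).abs.congr (ae_of_all _ fun u => ?_)
    simp only [Real.norm_eq_abs, abs_mul, abs_of_nonneg (V_nonneg _ _)]
    rw [integral_const_mul, abs_of_nonneg (kerInt_nonneg e u)]
    rfl

lemma integrable_two (hβ : 5 / 2 < β) (hl : Dec β K l) {e : ℝ} (he : 0 < e) :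
    Integrable (fun p : ℝ × ℝ => l (p.1 + p.2 - e) * V e p) := by
  refine ((measurePreserving_shear e).integrable_comp_of_integrable
    (integrable_line hβ hl he)).congr (ae_of_all _ fun p => ?_)
  simp

/-- Integrating out `ε₃` at fixed `ε₂`. -/
lemma integral_two (hβ : 5 / 2 < β) (hl : Dec β K l) {e : ℝ} (he : 0 < e) :
    ∫ p : ℝ × ℝ, l (p.1 + p.2 - e) * V e p = ∫ u, l u * kerInt e u := by
  have hm := hl.meas
  have hF : Measurable (fun q : ℝ × ℝ => l q.2 * V e (q.1, q.2 + e - q.1)) := by fun_prop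
  have h1 := integral_map (μ := (volume : Measure (ℝ × ℝ)))
    (measurePreserving_shear e).measurable.aemeasurable hF.aestronglyMeasurable
  rw [(measurePreserving_shear e).map_eq] at h1
  have h2 := integral_prod_symm _ (integrable_line hβ hl he)
  calc ∫ p : ℝ × ℝ, l (p.1 + p.2 - e) * V e p
      = ∫ p : ℝ × ℝ, l (p.1 + p.2 - e) * V e (p.1, p.1 + p.2 - e + e - p.1) := by simp
    _ = ∫ q : ℝ × ℝ, l q.2 * V e (q.1, q.2 + e - q.1) := h1.symm
    _ = ∫ u, ∫ x, l u * V e (x, u + e - x) := h2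
    _ = ∫ u, l u * kerInt e u := by simp_rw [integral_const_mul]; rfl

lemma abs_integral_two_le (hβ : 5 / 2 < β) (hl : Dec β K l) {e : ℝ} (he : 0 < e) :
    |∫ p : ℝ × ℝ, l (p.1 + p.2 - e) * V e p| ≤ 2 * √(1 + e) * mom l := by
  rw [integral_two hβ hl he, mom, ← integral_const_mul]
  refine abs_integral_le_integral_abs.trans (integral_mono (integrable_mul_kerInt hβ hl he).abs
    ((hl.integrable_mom hβ).const_mul _) fun u => ?_)
  simp only [abs_mul, abs_of_nonneg (kerInt_nonneg e u)]
  rcases lt_or_ge 0 u with hu | hu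
  · have h1 := kerInt_le he hu
    have h2 := one_add_le_mw hu.le
    have h3 : 2 * √(1 + e) * (1 + u) ≤ 2 * √(1 + e) * mw u := by gcongr
    nlinarith [abs_nonneg (l u)]
  · simp [hl.zero hu]

/-- The loss rate grows at least like `√ε₁` times the mass. -/
lemma le_integral_two (hβ : 5 / 2 < β) (hl : Dec β K l) (h0 : ∀ u, 0 ≤ l u) {e : ℝ}
    (he : 0 < e) : √e * mass l - mom l ≤ ∫ p : ℝ × ℝ, l (p.1 + p.2 - e) * V e p := by
  have hmass : mass l ≤ mom l := by
    have := hl.mass_abs_le_mom hβ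
    simpa only [abs_of_nonneg (h0 _)] using this
  rcases le_or_gt 1 e with h1 | h1
  · rw [integral_two hβ hl he, mass, mom, ← integral_const_mul,
      ← integral_sub ((hl.integrable_sqrt hβ).const_mul _) (hl.integrable_mom hβ)]
    refine integral_mono (((hl.integrable_sqrt hβ).const_mul _).sub (hl.integrable_mom hβ))
      (integrable_mul_kerInt hβ hl he) fun u => ?_
    simp only
    rcases lt_or_ge 0 u with hu | hu
    · have h2 := le_kerInt he hu
      have h3 := mul_sqrt_le_mw hu.le
      have h4 : √u / √e * (e - u) = √e * √u - u * √u / √e := by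
        have : √e ≠ 0 := (Real.sqrt_pos.2 he).ne'
        field_simp
        rw [Real.sq_sqrt he.le]
      have h5 : u * √u / √e ≤ u * √u := div_le_self (by positivity) (by simpa using h1)
      rw [abs_of_nonneg (h0 u)]
      nlinarith [h0 u]
    · simp [hl.zero hu]
  · have h2 : √e ≤ 1 := by simpa using h1.le
    have h3 := mass_nonneg h0
    have h4 : 0 ≤ ∫ p : ℝ × ℝ, l (p.1 + p.2 - e) * V e p :=
      integral_nonneg fun p => mul_nonneg (h0 _) (V_nonneg _ _)
    nlinarith

end two

/-! ### Quadratic and cubic gain terms -/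

lemma integral_Ici_one_add_rpow {β c : ℝ} (hβ : 1 < β) (hc : 0 ≤ c) :
    ∫ x in Ici c, (1 + x) ^ (-β) = (1 + c) ^ (1 - β) / (β - 1) := by
  rw [integral_Ici_eq_integral_Ioi]
  have h1 : ∫ x in Ioi c, (1 + x) ^ (-β) = ∫ x in Ioi (1 + c), x ^ (-β) := by
    have := (measurePreserving_add_left volume (1 : ℝ)).setIntegral_preimage_emb
      (measurableEmbedding_addLeft 1) (fun x : ℝ => x ^ (-β)) (Ioi (1 + c))
    simpa using this
  rw [h1, integral_Ioi_rpow_of_lt (by linarith) (by linarith)]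
  rw [show -β + 1 = 1 - β by ring, show (1 - β) = -(β - 1) by ring, neg_div_neg_eq]

/-- With `y = u/(1+e)`, this is `(1 - y)^{-(β-1)} ≤ (1 + 2y)^{β-1} ≤ 1 + 2^β y` on `[0, 1/2]`, by
convexity, continued by monotonicity; the leading coefficient `1` is what matters. -/
lemma one_add_max_rpow_le {β e u : ℝ} (hβ : 2 ≤ β) (he : 0 < e) (hu : 0 < u) :
    (1 + max (e - u) u) ^ (1 - β) ≤ (1 + e) ^ (1 - β) * (1 + 2 ^ β * (u / (1 + e))) := by
  set y := u / (1 + e) with hy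
  have hx : 0 < 1 + e := by linarith
  have hy0 : 0 < y := by positivity
  have huy : u = (1 + e) * y := by rw [hy]; field_simp
  have hb : 1 - β ≤ 0 := by linarith
  have h2 : (2 : ℝ) ^ β = 2 * 2 ^ (β - 1) := by
    rw [Real.rpow_sub_one (by norm_num)]; ring
  have h2' : (1 / 2 : ℝ) ^ (1 - β) = 2 ^ (β - 1) := by
    rw [one_div, Real.inv_rpow (by norm_num), ← Real.rpow_neg (by norm_num)]; congr 1; ring
  have hhalf : (1 + max (e - u) u) ^ (1 - β) ≤ (1 + e) ^ (1 - β) * 2 ^ (β - 1) := by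
    rw [← h2', ← Real.mul_rpow hx.le (by norm_num)]
    refine Real.rpow_le_rpow_of_nonpos (by positivity) ?_ hb
    rcases le_total e (2 * u) with h | h
    · linarith [le_max_right (e - u) u]
    · linarith [le_max_left (e - u) u]
  have hpos : 0 < (1 + e) ^ (1 - β) := Real.rpow_pos_of_pos hx _
  have h2pos : 0 < (2 : ℝ) ^ (β - 1) := by positivity
  rcases le_total y (1 / 2) with h | h
  · have h3 : (1 + max (e - u) u) ^ (1 - β) ≤ (1 + e) ^ (1 - β) * (1 - y) ^ (1 - β) := by
      rw [← Real.mul_rpow hx.le (by linarith)]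
      refine Real.rpow_le_rpow_of_nonpos (mul_pos hx (by linarith)) ?_ hb
      have : (1 + e) * (1 - y) = 1 + (e - u) := by rw [mul_sub, ← huy]; ring
      rw [this]
      linarith [le_max_left (e - u) u]
    refine h3.trans (mul_le_mul_of_nonneg_left ?_ hpos.le)
    have h4 : (1 - y) ^ (1 - β) ≤ (1 + 2 * y) ^ (β - 1) := by
      rw [show 1 - β = -(β - 1) by ring, Real.rpow_neg (by linarith),
        ← Real.inv_rpow (by linarith)]
      refine Real.rpow_le_rpow (inv_nonneg.2 (by linarith)) ?_ (by linarith)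
      rw [inv_le_iff_one_le_mul₀ (by linarith)]
      nlinarith
    have := (convexOn_rpow (p := β - 1) (by linarith)).2
      (show (1 : ℝ) ∈ Ici 0 by simp) (show (2 : ℝ) ∈ Ici 0 by simp)
      (show 0 ≤ 1 - 2 * y by linarith) (show 0 ≤ 2 * y by linarith) (by ring)
    simp only [smul_eq_mul, mul_one, Real.one_rpow] at this
    rw [show 1 - 2 * y + 2 * y * 2 = 1 + 2 * y by ring] at this
    rw [h2]
    nlinarith
  · refine hhalf.trans (mul_le_mul_of_nonneg_left ?_ hpos.le)
    rw [h2]; nlinarith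

lemma one_le_two_rpow_mul {β e : ℝ} (hβ : 0 ≤ β) (he : 0 < e) (h1 : e ≤ 1) :
    1 ≤ 2 ^ β * (1 + e) ^ (-β) := by
  rw [Real.rpow_neg (by linarith), ← div_eq_mul_inv, one_le_div (by positivity)]
  exact Real.rpow_le_rpow (by linarith) (by linarith) hβ

/-- The constant in the lower order terms of the quadratic gain estimates. -/
def gainConst (β : ℝ) : ℝ := 2 ^ β * (1 + mom (wt β)) + 1

lemma gainConst_pos (β : ℝ) : 0 < gainConst β := by
  have := mom_wt_nonneg β
  unfold gainConst; positivity

section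

variable {β γ H K L : ℝ} {h k l : ℝ → ℝ}

/-- The contribution of the collisions in which the particle distributed by `h` carries at least half
of the energy. -/
lemma integral_gain_half_le (hβ : 5 / 2 < β) (hγ : 5 / 2 < γ) (hh : Dec β H h)
    (hk : Dec γ K k) (h0 : ∀ u, 0 ≤ h u) (k0 : ∀ u, 0 ≤ k u) {e : ℝ} (he : 0 < e) :
    ∫ p : ℝ × ℝ, {p : ℝ × ℝ | p.2 ≤ p.1}.indicator (fun p => h p.1 * k p.2 * V e p) p ≤
      H * (1 + e) ^ (-β) * (√e * mass k / (β - 1) + gainConst β * mom k) := by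
  have hx : 0 < 1 + e := by linarith
  have hxp : 0 < (1 + e) ^ (-β) := Real.rpow_pos_of_pos hx _
  have hH := hh.nonneg
  have hS : MeasurableSet {p : ℝ × ℝ | p.2 ≤ p.1} := measurableSet_le measurable_snd measurable_fst
  have hint : Integrable (fun p : ℝ × ℝ => h p.1 * k p.2 * V e p) :=
    integrable_mul_V (integrable_fst_snd (hh.integrable hβ) (hk.integrable hγ)) e
  have hmass : 0 ≤ mass k := mass_nonneg k0
  have hmom : 0 ≤ mom k := hk.mom_nonneg
  have hkint : ∫ u, k u ≤ mom k := by
    have := hk.integral_abs_le_mom hγ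
    simpa only [abs_of_nonneg (k0 _)] using this
  have hmm : mass k ≤ mom k := by
    have := hk.mass_abs_le_mom hγ
    simpa only [abs_of_nonneg (k0 _)] using this
  have hq : 0 ≤ √e * mass k / (β - 1) := by
    have : 0 < β - 1 := by linarith
    positivity
  rcases le_or_gt e 1 with h1 | h1
  · -- low energies: the crude bound `V ≤ 1` suffices
    have b1 : ∫ p : ℝ × ℝ, {p : ℝ × ℝ | p.2 ≤ p.1}.indicator (fun p => h p.1 * k p.2 * V e p) p ≤
        (∫ u, |h u|) * ∫ u, |k u| := by
      rw [← integral_fst_snd]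
      refine integral_mono (hint.indicator hS)
        (integrable_fst_snd (hh.integrable hβ) (hk.integrable hγ)).abs fun p => ?_
      refine (indicator_le_self' (fun _ _ => ?_) p).trans
        ((le_abs_self _).trans (abs_mul_V_le _ _ _))
      exact mul_nonneg (mul_nonneg (h0 _) (k0 _)) (V_nonneg _ _)
    have b2 : ∫ u, |h u| ≤ H * mom (wt β) :=
      (hh.integral_abs_le_mom hβ).trans (hh.mom_le hβ)
    have b3 : ∫ u, |k u| ≤ mom k := hk.integral_abs_le_mom hγ
    have b4 := one_le_two_rpow_mul (β := β) (by linarith) he h1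
    have hw := mom_wt_nonneg β
    have b5 : mom (wt β) ≤ (1 + e) ^ (-β) * gainConst β := by
      unfold gainConst
      nlinarith
    calc _ ≤ (∫ u, |h u|) * ∫ u, |k u| := b1
      _ ≤ (H * mom (wt β)) * mom k :=
          mul_le_mul b2 b3 (integral_nonneg fun _ => abs_nonneg _) (by positivity)
      _ ≤ (H * ((1 + e) ^ (-β) * gainConst β)) * mom k := by gcongr
      _ = H * (1 + e) ^ (-β) * (0 + gainConst β * mom k) := by ring
      _ ≤ _ := by gcongr
  · -- high energies: integrate the tail of `h` over `ε₃ ≥ max (e - ε₄) ε₄`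
    have hse : 1 ≤ √e := by simpa using h1.le
    let D : ℝ × ℝ → ℝ := fun p => k p.2 * √p.2 / √e * H *
      {p : ℝ × ℝ | max (e - p.2) p.2 ≤ p.1}.indicator (fun p => (1 + p.1) ^ (-β)) p
    have hS' : MeasurableSet {p : ℝ × ℝ | max (e - p.2) p.2 ≤ p.1} :=
      measurableSet_le (by fun_prop) measurable_fst
    have hkm := hk.meas
    have hD0 : ∀ p, 0 ≤ D p ∧ D p ≤ H / √e * (wt β p.1 * (k p.2 * √p.2)) := by
      intro p
      rcases lt_or_ge 0 p.2 with hp | hp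
      · have hkk : 0 ≤ k p.2 * √p.2 / √e * H :=
          mul_nonneg (div_nonneg (mul_nonneg (k0 _) (Real.sqrt_nonneg _)) (Real.sqrt_nonneg _)) hH
        by_cases hm : p ∈ {p : ℝ × ℝ | max (e - p.2) p.2 ≤ p.1}
        · have hp1 : 0 < p.1 := hp.trans_le ((le_max_right _ _).trans hm)
          simp only [D, indicator_of_mem hm]
          rw [← wt_of_pos hp1]
          refine ⟨mul_nonneg hkk (wt_nonneg _ _), le_of_eq (by ring)⟩
        · simp only [D, indicator_of_notMem hm, mul_zero]
          exact ⟨le_rfl, mul_nonneg (by positivity)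
            (mul_nonneg (wt_nonneg _ _) (mul_nonneg (k0 _) (Real.sqrt_nonneg _)))⟩
      · simp [D, hk.zero hp]
    have hDint : Integrable D := by
      refine Integrable.mono' (((integrable_wt (β := β) (by linarith)).mul_prod
        (hk.integrable_sqrt hγ)).const_mul (H / √e)) ?_ (ae_of_all _ fun p => ?_)
      · refine Measurable.aestronglyMeasurable ?_
        refine Measurable.mul (by fun_prop) (Measurable.indicator (by fun_prop) hS')
      · rw [Real.norm_eq_abs, abs_of_nonneg (hD0 p).1]
        exact (hD0 p).2
    have b1 : ∫ p : ℝ × ℝ, {p : ℝ × ℝ | p.2 ≤ p.1}.indicator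
        (fun p => h p.1 * k p.2 * V e p) p ≤ ∫ p, D p := by
      refine integral_mono (hint.indicator hS) hDint fun p => ?_
      by_cases hp : p ∈ {p : ℝ × ℝ | p.2 ≤ p.1}
      · rw [indicator_of_mem hp]
        rcases eq_or_ne (V e p) 0 with hV | hV
        · rw [hV, mul_zero]; exact (hD0 p).1
        obtain ⟨-, p1, p2, p3⟩ := pos_of_V_ne_zero hV
        have hm' : max (e - p.2) p.2 ≤ p.1 := max_le (by linarith) hp
        have hm : p ∈ {p : ℝ × ℝ | max (e - p.2) p.2 ≤ p.1} := hm'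
        simp only [D, indicator_of_mem hm]
        have c1 : h p.1 ≤ H * (1 + p.1) ^ (-β) := by
          rw [← wt_of_pos p1]; exact (le_abs_self _).trans (hh.bound _)
        calc h p.1 * k p.2 * V e p ≤ (H * (1 + p.1) ^ (-β)) * k p.2 * (√p.2 / √e) := by
              refine mul_le_mul (mul_le_mul_of_nonneg_right c1 (k0 _)) (V_le_snd e p)
                (V_nonneg _ _) (mul_nonneg ?_ (k0 _))
              exact (h0 _).trans c1
          _ = _ := by ring
      · rw [indicator_of_notMem hp]; exact (hD0 p).1
    have b2 : ∫ p, D p = ∫ u, k u * √u / √e * H * ((1 + max (e - u) u) ^ (1 - β) / (β - 1)) := by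
      rw [show ∫ p, D p = ∫ u, ∫ x, D (x, u) from integral_prod_symm D hDint]
      refine integral_congr_ae (ae_of_all _ fun u => ?_)
      simp only [D]
      rw [integral_const_mul]
      rcases lt_or_ge 0 u with hu | hu
      · congr 1
        rw [← integral_Ici_one_add_rpow (c := max (e - u) u) (by linarith)
          (hu.le.trans (le_max_right _ _)), ← integral_indicator measurableSet_Ici]
        rfl
      · simp [hk.zero hu]
    set x := 1 + e with hxdef
    have b3 : ∫ u, k u * √u / √e * H * ((1 + max (e - u) u) ^ (1 - β) / (β - 1)) ≤
        ∫ u, H * x ^ (-β) / (β - 1) * ((x / √e) * (k u * √u) + 2 ^ β * (|k u| * mw u)) := by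
      have hint1 : Integrable (fun u =>
          k u * √u / √e * H * ((1 + max (e - u) u) ^ (1 - β) / (β - 1))) := by
        have := hDint.integral_prod_right
        refine this.congr (ae_of_all _ fun u => ?_)
        simp only [D]
        rw [integral_const_mul]
        rcases lt_or_ge 0 u with hu | hu
        · congr 1
          rw [← integral_Ici_one_add_rpow (c := max (e - u) u) (by linarith)
            (hu.le.trans (le_max_right _ _)), ← integral_indicator measurableSet_Ici]
          rfl
        · simp [hk.zero hu]
      refine integral_mono hint1 ((((hk.integrable_sqrt hγ).const_mul _).add
        ((hk.integrable_mom hγ).const_mul _)).const_mul _) fun u => ?_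
      simp only
      rcases lt_or_ge 0 u with hu | hu
      · have c1 := one_add_max_rpow_le (β := β) (by linarith) he hu
        have hb : 0 < β - 1 := by linarith
        rw [← hxdef] at c1
        have c2 : x ^ (1 - β) = x ^ (-β) * x := by
          rw [show 1 - β = -β + 1 by ring, Real.rpow_add_one hx.ne']
        have c3 : u * √u / √e ≤ mw u :=
          (div_le_self (by positivity) hse).trans (mul_sqrt_le_mw hu.le)
        have c4 : 0 ≤ k u * √u / √e * H := by have := k0 u; positivity
        rw [abs_of_nonneg (k0 u)]
        calc k u * √u / √e * H * ((1 + max (e - u) u) ^ (1 - β) / (β - 1))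
            ≤ k u * √u / √e * H * ((x ^ (1 - β) * (1 + 2 ^ β * (u / x))) / (β - 1)) := by gcongr
          _ = H * x ^ (-β) / (β - 1) * ((x / √e) * (k u * √u) +
                2 ^ β * (k u * (u * √u / √e))) := by
              rw [c2]; field_simp
          _ ≤ _ := by
              have := k0 u
              gcongr
      · simp [hk.zero hu]
    rw [integral_const_mul, integral_add ((hk.integrable_sqrt hγ).const_mul _)
      ((hk.integrable_mom hγ).const_mul _), integral_const_mul, integral_const_mul] at b3
    refine (b1.trans (b2.le.trans b3)).trans ?_
    change H * x ^ (-β) / (β - 1) * (x / √e * mass k + 2 ^ β * mom k) ≤ _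
    have hb : 1 < β - 1 := by linarith
    have c5 : x / √e ≤ √e + 1 := by
      rw [div_le_iff₀ (by linarith), hxdef]
      nlinarith [Real.mul_self_sqrt he.le]
    have c6 : (x / √e * mass k + 2 ^ β * mom k) / (β - 1) ≤
        √e * mass k / (β - 1) + gainConst β * mom k := by
      have d1 : x / √e * mass k + 2 ^ β * mom k ≤ √e * mass k + (1 + 2 ^ β) * mom k := by
        nlinarith
      have d2 : (1 + 2 ^ β) * mom k / (β - 1) ≤ (1 + 2 ^ β) * mom k :=
        div_le_self (by positivity) hb.le
      have d3 : (1 + 2 ^ β) * mom k ≤ gainConst β * mom k := by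
        refine mul_le_mul_of_nonneg_right ?_ hmom
        have := mom_wt_nonneg β
        have h2 : (0:ℝ) < 2 ^ β := by positivity
        unfold gainConst; nlinarith
      calc _ ≤ (√e * mass k + (1 + 2 ^ β) * mom k) / (β - 1) := by gcongr
        _ = √e * mass k / (β - 1) + (1 + 2 ^ β) * mom k / (β - 1) := add_div _ _ _
        _ ≤ _ := by linarith
    calc _ = H * x ^ (-β) * ((x / √e * mass k + 2 ^ β * mom k) / (β - 1)) := by ring
      _ ≤ _ := by gcongr

/-- The quadratic gain term, with the sharp coefficient of `√ε₁`: one of the two incoming particles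
carries at least half of the energy, and integrating its tail produces the factor `1 / (β - 1)`. -/
lemma integral_gain_le (hβ : 5 / 2 < β) (hγ : 5 / 2 < γ) (hh : Dec β H h)
    (hk : Dec γ K k) (h0 : ∀ u, 0 ≤ h u) (k0 : ∀ u, 0 ≤ k u) {e : ℝ} (he : 0 < e) :
    ∫ p : ℝ × ℝ, h p.1 * k p.2 * V e p ≤
      H * (1 + e) ^ (-β) * (√e * mass k / (β - 1) + gainConst β * mom k) +
      K * (1 + e) ^ (-γ) * (√e * mass h / (γ - 1) + gainConst γ * mom h) := by
  have a1 := integral_gain_half_le hβ hγ hh hk h0 k0 he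
  have a2 := integral_gain_half_le hγ hβ hk hh k0 h0 he
  have hint : Integrable (fun p : ℝ × ℝ => h p.1 * k p.2 * V e p) :=
    integrable_mul_V (integrable_fst_snd (hh.integrable hβ) (hk.integrable hγ)) e
  have hS : MeasurableSet {p : ℝ × ℝ | p.2 ≤ p.1} := measurableSet_le measurable_snd measurable_fst
  have hS2 : MeasurableSet {p : ℝ × ℝ | p.1 ≤ p.2} := measurableSet_le measurable_fst measurable_snd
  have e1 : ∫ p : ℝ × ℝ, {p : ℝ × ℝ | p.2 ≤ p.1}.indicator (fun p => k p.1 * h p.2 * V e p) p =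
      ∫ p : ℝ × ℝ, {p : ℝ × ℝ | p.1 ≤ p.2}.indicator (fun p => h p.1 * k p.2 * V e p) p := by
    refine (integral_prod_swap (μ := (volume : Measure ℝ)) (ν := (volume : Measure ℝ))
      (fun p : ℝ × ℝ => {p : ℝ × ℝ | p.2 ≤ p.1}.indicator
        (fun p => k p.1 * h p.2 * V e p) p)).symm.trans ?_
    refine integral_congr_ae (ae_of_all _ fun p => ?_)
    simp only [indicator, mem_ofPred_eq, Prod.fst_swap, Prod.snd_swap, V_swap]
    rw [mul_comm (k p.2)]
  rw [e1] at a2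
  refine le_trans ?_ (add_le_add a1 a2)
  rw [← integral_add (hint.indicator hS) (hint.indicator hS2)]
  refine integral_mono hint ((hint.indicator hS).add (hint.indicator hS2)) fun p => ?_
  have hp0 : 0 ≤ h p.1 * k p.2 * V e p := mul_nonneg (mul_nonneg (h0 _) (k0 _)) (V_nonneg _ _)
  simp only [indicator, mem_ofPred_eq]
  rcases le_total p.1 p.2 with hp | hp
  · rw [if_pos hp]; split_ifs <;> linarith
  · rw [if_pos hp]; split_ifs <;> linarith

lemma wt_half_le {e u : ℝ} (hβ : 0 ≤ β) (he : 0 < e) (hu : e / 2 ≤ u) :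
    wt β u ≤ 2 ^ β * (1 + e) ^ (-β) := by
  rw [wt_of_pos (by linarith), Real.rpow_neg (by linarith), Real.rpow_neg (by linarith),
    ← div_eq_mul_inv, inv_le_comm₀ (by have : 0 < u := by linarith
                                       positivity) (by positivity), inv_div,
    ← Real.div_rpow (by linarith) (by norm_num)]
  exact Real.rpow_le_rpow (by positivity) (by linarith) hβ

lemma integrable_triple (hβ : 5 / 2 < β) (hh : Dec β H h) (hk : Dec β K k) (hl : Dec β L l)
    (e : ℝ) : Integrable (fun p : ℝ × ℝ => h p.1 * k p.2 * l (p.1 + p.2 - e)) := by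
  have h1 := hh.meas
  have h2 := hk.meas
  have h3 := hl.meas
  refine ((integrable_fst_two (hh.integrable hβ) (hl.integrable hβ) e).abs.const_mul K).mono'
    (Measurable.aestronglyMeasurable (by fun_prop)) (ae_of_all _ fun p => ?_)
  rw [Real.norm_eq_abs, abs_mul, abs_mul, abs_mul]
  have := hk.le (by linarith) p.2
  have := mul_nonneg (abs_nonneg (h p.1)) (abs_nonneg (l (p.1 + p.2 - e)))
  nlinarith

/-- The cubic gain term decays as fast as the profiles themselves. -/
lemma integral_triple_le (hβ : 5 / 2 < β) (hh : Dec β H h) (hk : Dec β K k) (hl : Dec β L l)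
    {e : ℝ} (he : 0 < e) :
    |∫ p : ℝ × ℝ, h p.1 * k p.2 * l (p.1 + p.2 - e) * V e p| ≤
      2 ^ β * (1 + e) ^ (-β) * (H * mom k + K * mom h) * mom l := by
  set c := 2 ^ β * (1 + e) ^ (-β) with hc
  have hc0 : 0 ≤ c := by positivity
  have hH := hh.nonneg
  have hK := hk.nonneg
  have i1 := (integrable_snd_two (hk.integrable hβ) (hl.integrable hβ) e).abs.const_mul (H * c)
  have i2 := (integrable_fst_two (hh.integrable hβ) (hl.integrable hβ) e).abs.const_mul (K * c)
  have hint := integrable_mul_V (integrable_triple hβ hh hk hl e) e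
  have hl0 : 0 ≤ mom l := hl.mom_nonneg
  have m1 := hh.integral_abs_le_mom hβ
  have m2 := hk.integral_abs_le_mom hβ
  have m3 := hl.integral_abs_le_mom hβ
  have n2 : 0 ≤ ∫ u, |k u| := integral_nonneg fun _ => abs_nonneg _
  have n1 : 0 ≤ ∫ u, |h u| := integral_nonneg fun _ => abs_nonneg _
  have n3 : 0 ≤ ∫ u, |l u| := integral_nonneg fun _ => abs_nonneg _
  refine abs_integral_le_integral_abs.trans ((integral_mono hint.abs (i1.add i2)
    fun p => ?_).trans ?_)
  · simp only [Pi.add_apply]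
    rcases eq_or_ne (V e p) 0 with hV | hV
    · rw [hV, mul_zero, abs_zero]; positivity
    obtain ⟨-, p1, p2, p3⟩ := pos_of_V_ne_zero hV
    refine (abs_mul_V_le _ _ _).trans ?_
    rw [abs_mul, abs_mul, abs_mul, abs_mul]
    have hkl := mul_nonneg (abs_nonneg (k p.2)) (abs_nonneg (l (p.1 + p.2 - e)))
    have hhl := mul_nonneg (abs_nonneg (h p.1)) (abs_nonneg (l (p.1 + p.2 - e)))
    rcases le_total p.1 p.2 with h' | h'
    · have : |k p.2| ≤ K * c := (hk.bound _).trans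
        (mul_le_mul_of_nonneg_left (wt_half_le (by linarith) he (by linarith)) hK)
      nlinarith [mul_nonneg (mul_nonneg hH hc0) hkl]
    · have : |h p.1| ≤ H * c := (hh.bound _).trans
        (mul_le_mul_of_nonneg_left (wt_half_le (by linarith) he (by linarith)) hH)
      nlinarith [mul_nonneg (mul_nonneg hK hc0) hhl]
  · simp only [Pi.add_apply]
    rw [integral_add i1 i2, integral_const_mul, integral_const_mul,
      integral_snd_two hk.meas hl.meas, integral_fst_two hh.meas hl.meas]
    have q1 : (∫ u, |k u|) * ∫ u, |l u| ≤ mom k * mom l := mul_le_mul m2 m3 n3 (n2.trans m2)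
    have q2 : (∫ u, |h u|) * ∫ u, |l u| ≤ mom h * mom l := mul_le_mul m1 m3 n3 (n1.trans m1)
    calc _ ≤ H * c * (mom k * mom l) + K * c * (mom h * mom l) := by gcongr
      _ = _ := by ring

end

/-! ### The collision operator on decaying profiles -/

/-- The integral `∫∫ f₃ f₄ W`. -/
def gainTwo (h : ℝ → ℝ) (e : ℝ) : ℝ := ∫ p : ℝ × ℝ, h p.1 * h p.2 * V e p

/-- The integral `∫∫ f₃ f₄ f₂ W`. -/
def gainThree (h : ℝ → ℝ) (e : ℝ) : ℝ := ∫ p : ℝ × ℝ, h p.1 * h p.2 * h (p.1 + p.2 - e) * V e p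

/-- The integral `∫∫ f₂ W`. -/
def lossOne (h : ℝ → ℝ) (e : ℝ) : ℝ := ∫ p : ℝ × ℝ, h (p.1 + p.2 - e) * V e p

/-- The integral `∫∫ f₂ f₃ W`. -/
def lossTwo (h : ℝ → ℝ) (e : ℝ) : ℝ := ∫ p : ℝ × ℝ, h p.1 * h (p.1 + p.2 - e) * V e p

lemma c₀_pos : 0 < c₀ := by unfold c₀; positivity

/-- The iterated integrals over positive energies are integrals over the plane, because the kernel
vanishes elsewhere. -/
lemma iterated_eq_integral {F : ℝ × ℝ → ℝ} {e : ℝ} (hF : Integrable (fun p => F p * V e p)) :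
    ∫ x in Ioi (0 : ℝ), ∫ y in Ioi (0 : ℝ), F (x, y) * W e (x + y - e) x y =
      ∫ p, F p * V e p := by
  rw [show ∫ p, F p * V e p = ∫ x, ∫ y, F (x, y) * V e (x, y) from integral_prod _ hF,
    setIntegral_eq_integral_of_forall_compl_eq_zero]
  · refine integral_congr_ae (ae_of_all _ fun x => ?_)
    refine setIntegral_eq_integral_of_forall_compl_eq_zero fun y hy => ?_
    change F (x, y) * V e (x, y) = 0
    rw [V_of_snd (by simpa using hy), mul_zero]
  · intro x hx
    have hV : ∀ y, W e (x + y - e) x y = 0 := fun y =>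
      V_of_fst (e := e) (p := (x, y)) (by simpa using hx)
    simp [hV]

section ops

variable {β γ K R : ℝ} {h : ℝ → ℝ}

lemma integrable_two' (hβ : 5 / 2 < β) (hl : Dec β K h) (e : ℝ) :
    Integrable (fun p : ℝ × ℝ => h (p.1 + p.2 - e) * V e p) := by
  rcases lt_or_ge 0 e with he | he
  · exact integrable_two hβ hl he
  · simp [V_of_nonpos he]

lemma integrable_gainTwo (hβ : 5 / 2 < β) (hl : Dec β K h) (e : ℝ) :
    Integrable (fun p : ℝ × ℝ => h p.1 * h p.2 * V e p) :=
  integrable_mul_V (integrable_fst_snd (hl.integrable hβ) (hl.integrable hβ)) e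

lemma integrable_gainThree (hβ : 5 / 2 < β) (hl : Dec β K h) (e : ℝ) :
    Integrable (fun p : ℝ × ℝ => h p.1 * h p.2 * h (p.1 + p.2 - e) * V e p) :=
  integrable_mul_V (integrable_triple hβ hl hl hl e) e

lemma integrable_lossTwo (hβ : 5 / 2 < β) (hl : Dec β K h) (e : ℝ) :
    Integrable (fun p : ℝ × ℝ => h p.1 * h (p.1 + p.2 - e) * V e p) :=
  integrable_mul_V (integrable_fst_two (hl.integrable hβ) (hl.integrable hβ) e) e

lemma integrable_lossTwo' (hβ : 5 / 2 < β) (hl : Dec β K h) (e : ℝ) :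
    Integrable (fun p : ℝ × ℝ => h p.2 * h (p.1 + p.2 - e) * V e p) :=
  integrable_mul_V (integrable_snd_two (hl.integrable hβ) (hl.integrable hβ) e) e

lemma integral_snd_two_eq (e : ℝ) (h : ℝ → ℝ) :
    ∫ p : ℝ × ℝ, h p.2 * h (p.1 + p.2 - e) * V e p = lossTwo h e := by
  refine Eq.trans (integral_congr_ae (ae_of_all _ fun p => ?_))
    (integral_prod_swap (μ := (volume : Measure ℝ)) (ν := (volume : Measure ℝ))
    (fun p : ℝ × ℝ => h p.1 * h (p.1 + p.2 - e) * V e p))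
  simp [V_swap, add_comm]

lemma integrable_gain (hβ : 5 / 2 < β) (hl : Dec β K h) (e : ℝ) : Integrable (fun p : ℝ × ℝ =>
    h p.1 * h p.2 * (1 + h e + h (p.1 + p.2 - e)) * V e p) := by
  refine (((integrable_gainTwo hβ hl e).const_mul (1 + h e)).add
    (integrable_gainThree hβ hl e)).congr (ae_of_all _ fun p => ?_)
  simp only [Pi.add_apply]
  ring

lemma integrable_lossRate (hβ : 5 / 2 < β) (hl : Dec β K h) (e : ℝ) :
    Integrable (fun p : ℝ × ℝ => h (p.1 + p.2 - e) * (1 + h p.1 + h p.2) * V e p) := by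
  refine (((integrable_two' hβ hl e).add (integrable_lossTwo hβ hl e)).add
    (integrable_lossTwo' hβ hl e)).congr (ae_of_all _ fun p => ?_)
  simp only [Pi.add_apply]
  ring

lemma gain_eq_integral (hβ : 5 / 2 < β) (hl : Dec β K h) (e : ℝ) :
    gain h e = ∫ p : ℝ × ℝ, h p.1 * h p.2 * (1 + h e + h (p.1 + p.2 - e)) * V e p :=
  iterated_eq_integral (F := fun p => h p.1 * h p.2 * (1 + h e + h (p.1 + p.2 - e)))
    (integrable_gain hβ hl e)

lemma lossRate_eq_integral (hβ : 5 / 2 < β) (hl : Dec β K h) (e : ℝ) :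
    lossRate h e = c₀ * ∫ p : ℝ × ℝ, h (p.1 + p.2 - e) * (1 + h p.1 + h p.2) * V e p :=
  congrArg (c₀ * ·) (iterated_eq_integral (F := fun p => h (p.1 + p.2 - e) * (1 + h p.1 + h p.2))
    (integrable_lossRate hβ hl e))

lemma gain_eq (hβ : 5 / 2 < β) (hl : Dec β K h) (e : ℝ) :
    gain h e = (1 + h e) * gainTwo h e + gainThree h e := by
  rw [gain_eq_integral hβ hl, gainTwo, gainThree, ← integral_const_mul,
    ← integral_add ((integrable_gainTwo hβ hl e).const_mul _) (integrable_gainThree hβ hl e)]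
  congr 1; ext p; ring

lemma lossRate_eq (hβ : 5 / 2 < β) (hl : Dec β K h) (e : ℝ) :
    lossRate h e = c₀ * (lossOne h e + 2 * lossTwo h e) := by
  have i12 : Integrable (fun p : ℝ × ℝ => h (p.1 + p.2 - e) * V e p +
      h p.1 * h (p.1 + p.2 - e) * V e p) :=
    (integrable_two' hβ hl e).add (integrable_lossTwo hβ hl e)
  rw [two_mul, ← add_assoc]
  nth_rewrite 2 [← integral_snd_two_eq]
  rw [lossRate_eq_integral hβ hl, lossOne, lossTwo,
    ← integral_add (integrable_two' hβ hl e) (integrable_lossTwo hβ hl e),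
    ← integral_add i12 (integrable_lossTwo' hβ hl e)]
  congr 2; ext p; ring

lemma q_mul_V (h : ℝ → ℝ) (e : ℝ) (p : ℝ × ℝ) :
    q (h e) (h (p.1 + p.2 - e)) (h p.1) (h p.2) * V e p =
      h p.1 * h p.2 * (1 + h e + h (p.1 + p.2 - e)) * V e p -
        h e * (h (p.1 + p.2 - e) * (1 + h p.1 + h p.2) * V e p) := by
  unfold q; ring

lemma integrable_q (hβ : 5 / 2 < β) (hl : Dec β K h) (e : ℝ) :
    Integrable (fun p : ℝ × ℝ => q (h e) (h (p.1 + p.2 - e)) (h p.1) (h p.2) * V e p) := by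
  simp_rw [q_mul_V]
  exact (integrable_gain hβ hl e).sub ((integrable_lossRate hβ hl e).const_mul _)

lemma collision_eq_integral (hβ : 5 / 2 < β) (hl : Dec β K h) (e : ℝ) :
    collision h e = c₀ * ∫ p : ℝ × ℝ,
      q (h e) (h (p.1 + p.2 - e)) (h p.1) (h p.2) * V e p :=
  congrArg (c₀ * ·) (iterated_eq_integral (F := fun p : ℝ × ℝ =>
    q (h e) (h (p.1 + p.2 - e)) (h p.1) (h p.2)) (integrable_q hβ hl e))

/-- The collision operator is gain minus loss. -/
lemma collision_eq (hβ : 5 / 2 < β) (hl : Dec β K h) (e : ℝ) :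
    collision h e = c₀ * gain h e - lossRate h e * h e := by
  rw [collision_eq_integral hβ hl]
  simp_rw [q_mul_V]
  rw [integral_sub (integrable_gain hβ hl e) ((integrable_lossRate hβ hl e).const_mul _),
    integral_const_mul, gain_eq_integral hβ hl, lossRate_eq_integral hβ hl]
  ring

lemma abs_gainTwo_le (hβ : 5 / 2 < β) (hl : Dec β K h) (e : ℝ) :
    |gainTwo h e| ≤ mom h * mom h := by
  have m := hl.integral_abs_le_mom hβ
  have n : 0 ≤ ∫ u, |h u| := integral_nonneg fun _ => abs_nonneg _
  refine (abs_integral_mul_V_le (integrable_fst_snd (hl.integrable hβ) (hl.integrable hβ))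
    e).trans ?_
  rw [integral_fst_snd]
  exact mul_le_mul m m n (n.trans m)

lemma abs_lossTwo_le (hβ : 5 / 2 < β) (hl : Dec β K h) (e : ℝ) :
    |lossTwo h e| ≤ mom h * mom h := by
  have m := hl.integral_abs_le_mom hβ
  have n : 0 ≤ ∫ u, |h u| := integral_nonneg fun _ => abs_nonneg _
  refine (abs_integral_mul_V_le (integrable_fst_two (hl.integrable hβ) (hl.integrable hβ)
    e) e).trans ?_
  rw [integral_fst_two hl.meas hl.meas]
  exact mul_le_mul m m n (n.trans m)

lemma gainTwo_nonneg (h0 : ∀ u, 0 ≤ h u) (e : ℝ) : 0 ≤ gainTwo h e :=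
  integral_nonneg fun _ => mul_nonneg (mul_nonneg (h0 _) (h0 _)) (V_nonneg _ _)

lemma gainThree_nonneg (h0 : ∀ u, 0 ≤ h u) (e : ℝ) : 0 ≤ gainThree h e :=
  integral_nonneg fun _ => mul_nonneg (mul_nonneg (mul_nonneg (h0 _) (h0 _)) (h0 _)) (V_nonneg _ _)

lemma lossTwo_nonneg (h0 : ∀ u, 0 ≤ h u) (e : ℝ) : 0 ≤ lossTwo h e :=
  integral_nonneg fun _ => mul_nonneg (mul_nonneg (h0 _) (h0 _)) (V_nonneg _ _)

lemma lossOne_nonneg (h0 : ∀ u, 0 ≤ h u) (e : ℝ) : 0 ≤ lossOne h e :=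
  integral_nonneg fun _ => mul_nonneg (h0 _) (V_nonneg _ _)

lemma gain_nonneg (hβ : 5 / 2 < β) (hl : Dec β K h) (h0 : ∀ u, 0 ≤ h u) (e : ℝ) :
    0 ≤ gain h e := by
  rw [gain_eq hβ hl]
  have := gainTwo_nonneg h0 e
  have := gainThree_nonneg h0 e
  have := h0 e
  positivity

lemma lossRate_nonneg (hβ : 5 / 2 < β) (hl : Dec β K h) (h0 : ∀ u, 0 ≤ h u) (e : ℝ) :
    0 ≤ lossRate h e := by
  rw [lossRate_eq hβ hl]
  have := lossTwo_nonneg h0 e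
  have := lossOne_nonneg h0 e
  have := c₀_pos
  positivity

/-- The loss rate dominates `√ε₁` times the mass, up to a constant. -/
lemma le_lossRate (hβ : 5 / 2 < β) (hl : Dec β K h) (h0 : ∀ u, 0 ≤ h u) {e : ℝ} (he : 0 < e) :
    c₀ * (√e * mass h - mom h) ≤ lossRate h e := by
  rw [lossRate_eq hβ hl]
  refine mul_le_mul_of_nonneg_left ?_ c₀_pos.le
  have := lossTwo_nonneg h0 e
  have : √e * mass h - mom h ≤ lossOne h e := le_integral_two hβ hl h0 he
  linarith

lemma abs_lossRate_le (hβ : 5 / 2 < β) (hl : Dec β K h) {e : ℝ} (he : 0 < e) :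
    |lossRate h e| ≤ c₀ * (2 * (mom h + mom h * mom h)) * √(1 + e) := by
  have h1 : |lossOne h e| ≤ 2 * √(1 + e) * mom h := abs_integral_two_le hβ hl he
  have h2 := abs_lossTwo_le hβ hl e
  have h3 := one_le_sqrt_one_add he.le
  have h4 := hl.mom_nonneg
  rw [lossRate_eq hβ hl, abs_mul, abs_of_pos c₀_pos, mul_assoc]
  refine mul_le_mul_of_nonneg_left ?_ c₀_pos.le
  calc |lossOne h e + 2 * lossTwo h e| ≤ |lossOne h e| + |2 * lossTwo h e| := abs_add_le _ _
    _ = |lossOne h e| + 2 * |lossTwo h e| := by rw [abs_mul, abs_two]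
    _ ≤ 2 * √(1 + e) * mom h + 2 * (mom h * mom h * √(1 + e)) := by
        have : mom h * mom h ≤ mom h * mom h * √(1 + e) :=
          le_mul_of_one_le_right (by positivity) h3
        linarith
    _ = _ := by ring

/-- The constant of the a priori bound on the gain term. -/
def boundConst (γ A : ℝ) : ℝ := 2 * gainConst γ * A + (2 * 2 ^ γ + 1) * (A * A)

lemma boundConst_nonneg {A : ℝ} (hA : 0 ≤ A) : 0 ≤ boundConst γ A := by
  have := gainConst_pos γ
  unfold boundConst; positivity

/-- The a priori bound on the gain term. Its leading part is `2/(γ-1) < 1` times the leading part of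
the loss term. -/
lemma gain_le (hγ : 5 / 2 < γ) (hl : Dec γ K h) (h0 : ∀ u, 0 ≤ h u) {A : ℝ} (hA : mom h ≤ A)
    {e : ℝ} (he : 0 < e) :
    gain h e ≤ K * (1 + e) ^ (-γ) * (2 / (γ - 1) * (√e * mass h) + boundConst γ A) := by
  have hK := hl.nonneg
  have hm := hl.mom_nonneg
  have g1 : gainTwo h e ≤ _ := integral_gain_le hγ hγ hl hl h0 h0 he
  have g2 := (le_abs_self _).trans (abs_gainTwo_le hγ hl e)
  have g3 := (le_abs_self _).trans (integral_triple_le hγ hl hl hl he)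
  change gainThree h e ≤ _ at g3
  have g4 : h e ≤ K * (1 + e) ^ (-γ) := by
    have := (le_abs_self _).trans (hl.bound e)
    rwa [wt_of_pos he] at this
  have g5 := gainTwo_nonneg h0 e
  have hG := gainConst_pos γ
  set x := (1 + e) ^ (-γ) with hx
  have hx0 : 0 ≤ x := by positivity
  rw [gain_eq hγ hl]
  have g6 : h e * gainTwo h e ≤ K * x * (mom h * mom h) :=
    mul_le_mul g4 g2 g5 (by positivity)
  have hA0 : 0 ≤ A := hm.trans hA
  have g7 : K * x * (2 / (γ - 1) * (√e * mass h) + boundConst γ (mom h)) ≤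
      K * x * (2 / (γ - 1) * (√e * mass h) + boundConst γ A) := by
    unfold boundConst; gcongr
  refine le_trans ?_ g7
  calc (1 + h e) * gainTwo h e + gainThree h e
      = gainTwo h e + h e * gainTwo h e + gainThree h e := by ring
    _ ≤ _ := add_le_add (add_le_add g1 g6) g3
    _ = _ := by unfold boundConst; ring

lemma gain_abs_le (hγ : 5 / 2 < γ) (hl : Dec γ K h) (e : ℝ) :
    |gain h e| ≤ gain (fun u => |h u|) e := by
  rw [gain_eq hγ hl, gain_eq hγ hl.abs]
  have h1 : |gainTwo h e| ≤ gainTwo (fun u => |h u|) e := by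
    refine abs_integral_le_integral_abs.trans (le_of_eq ?_)
    simp only [abs_mul, abs_of_nonneg (V_nonneg _ _)]
    rfl
  have h2 : |gainThree h e| ≤ gainThree (fun u => |h u|) e := by
    refine abs_integral_le_integral_abs.trans (le_of_eq ?_)
    simp only [abs_mul, abs_of_nonneg (V_nonneg _ _)]
    rfl
  have h3 : |1 + h e| ≤ 1 + |h e| := (abs_add_le _ _).trans (by simp)
  calc _ ≤ |(1 + h e) * gainTwo h e| + |gainThree h e| := abs_add_le _ _
    _ ≤ _ := by
      rw [abs_mul]
      exact add_le_add (mul_le_mul h3 h1 (abs_nonneg _) (by positivity)) h2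

/-- The gain term loses half a power of decay. -/
lemma abs_gain_le (hγ : 3 < γ) (hl : Dec γ K h) {A : ℝ} (hA : mom h ≤ A) {e : ℝ}
    (he : 0 < e) :
    |gain h e| ≤ K * (A + boundConst γ A) * (√(1 + e) * (1 + e) ^ (-γ)) := by
  have hm := hl.mom_nonneg
  refine (gain_abs_le (by linarith) hl e).trans ((gain_le (by linarith) hl.abs
    (fun _ => abs_nonneg _) ((mom_abs h).le.trans hA) he).trans ?_)
  have h1 := hl.mass_abs_le_mom (by linarith)
  have h1' := mass_nonneg (h := fun u => |h u|) fun _ => abs_nonneg _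
  have h2 : √e ≤ √(1 + e) := Real.sqrt_le_sqrt (by linarith)
  have h3 := one_le_sqrt_one_add he.le
  have h4 := boundConst_nonneg (γ := γ) (hm.trans hA)
  have h5 : 2 / (γ - 1) ≤ 1 := by rw [div_le_one (by linarith)]; linarith
  have hK := hl.nonneg
  have h6 : √e * mass (fun u => |h u|) ≤ √(1 + e) * A := by
    gcongr; linarith
  have h7 : 2 / (γ - 1) * (√e * mass (fun u => |h u|)) ≤ √(1 + e) * A :=
    (mul_le_of_le_one_left (by positivity) h5).trans h6
  have h8 : boundConst γ A ≤ √(1 + e) * boundConst γ A := le_mul_of_one_le_left h4 h3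
  calc _ ≤ K * (1 + e) ^ (-γ) * (√(1 + e) * A + √(1 + e) * boundConst γ A) := by gcongr
    _ = _ := by ring

end ops

/-! ### Difference estimates -/

section diff

variable {β γ R D : ℝ} {f g : ℝ → ℝ}

lemma lossOne_sub (hγ : 5 / 2 < γ) (hf : Dec γ R f) (hg : Dec γ R g)
    (e : ℝ) : lossOne f e - lossOne g e = lossOne (fun u => f u - g u) e := by
  rw [lossOne, lossOne, lossOne, ← integral_sub (integrable_two' hγ hf e)
    (integrable_two' hγ hg e)]
  congr 1; ext p; ring

lemma abs_lossTwo_sub_le (hγ : 5 / 2 < γ) (hf : Dec γ R f) (hg : Dec γ R g)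
    (e : ℝ) : |lossTwo f e - lossTwo g e| ≤
      mom (fun u => f u - g u) * mom f + mom g * mom (fun u => f u - g u) := by
  have hd := hf.sub hg
  have id := hd.integrable hγ
  have if' := hf.integrable hγ
  have ig := hg.integrable hγ
  have j1 := integrable_mul_V (integrable_fst_two id if' e) e
  have j2 := integrable_mul_V (integrable_fst_two ig id e) e
  have e1 : lossTwo f e - lossTwo g e =
      (∫ p : ℝ × ℝ, (f p.1 - g p.1) * f (p.1 + p.2 - e) * V e p) +
      ∫ p : ℝ × ℝ, g p.1 * (f (p.1 + p.2 - e) - g (p.1 + p.2 - e)) * V e p := by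
    rw [lossTwo, lossTwo, ← integral_sub (integrable_lossTwo hγ hf e) (integrable_lossTwo hγ hg e),
      ← integral_add j1 j2]
    congr 1; ext p; ring
  have b1 := abs_integral_mul_V_le (integrable_fst_two id if' e) e
  have b2 := abs_integral_mul_V_le (integrable_fst_two ig id e) e
  rw [integral_fst_two hd.meas hf.meas] at b1
  rw [integral_fst_two hg.meas hd.meas] at b2
  have md := hd.integral_abs_le_mom hγ
  have mf := hf.integral_abs_le_mom hγ
  have mg := hg.integral_abs_le_mom hγ
  have nd : 0 ≤ ∫ u, |f u - g u| := integral_nonneg fun _ => abs_nonneg _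
  have nf : 0 ≤ ∫ u, |f u| := integral_nonneg fun _ => abs_nonneg _
  have ng : 0 ≤ ∫ u, |g u| := integral_nonneg fun _ => abs_nonneg _
  rw [e1]
  exact (abs_add_le _ _).trans (add_le_add
    (b1.trans (mul_le_mul md mf nf (nd.trans md))) (b2.trans (mul_le_mul mg md nd (ng.trans mg))))

lemma gainTwo_sub_le (hγ : 5 / 2 < γ) (hf : Dec γ R f) (hg : Dec γ R g)
    (e : ℝ) : |gainTwo f e - gainTwo g e| ≤
      ∫ p : ℝ × ℝ, (|f p.1 - g p.1| * |f p.2| * V e p + |g p.1| * |f p.2 - g p.2| * V e p) := by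
  have hd := hf.sub hg
  have id := hd.integrable hγ
  have if' := hf.integrable hγ
  have ig := hg.integrable hγ
  have j1 := integrable_mul_V (integrable_fst_snd id.abs if'.abs) e
  have j2 := integrable_mul_V (integrable_fst_snd ig.abs id.abs) e
  rw [gainTwo, gainTwo, ← integral_sub (integrable_gainTwo hγ hf e) (integrable_gainTwo hγ hg e)]
  refine abs_integral_le_integral_abs.trans (integral_mono
    ((integrable_gainTwo hγ hf e).sub (integrable_gainTwo hγ hg e)).abs (j1.add j2) fun p => ?_)
  rw [show f p.1 * f p.2 * V e p - g p.1 * g p.2 * V e p =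
    (f p.1 - g p.1) * f p.2 * V e p + g p.1 * (f p.2 - g p.2) * V e p by ring]
  refine (abs_add_le _ _).trans (le_of_eq ?_)
  simp only [abs_mul, abs_of_nonneg (V_nonneg _ _)]

lemma gainTwo_sub_crude (hγ : 5 / 2 < γ) (hf : Dec γ R f) (hg : Dec γ R g)
    (e : ℝ) : |gainTwo f e - gainTwo g e| ≤
      mom (fun u => f u - g u) * mom f + mom g * mom (fun u => f u - g u) := by
  have hd := hf.sub hg
  have id := (hd.integrable hγ).abs
  have if' := (hf.integrable hγ).abs
  have ig := (hg.integrable hγ).abs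
  have b1 := abs_integral_mul_V_le (integrable_fst_snd id if') e
  have b2 := abs_integral_mul_V_le (integrable_fst_snd ig id) e
  rw [integral_fst_snd (fun u => |f u - g u|) (fun u => |f u|)] at b1
  rw [integral_fst_snd (fun u => |g u|) (fun u => |f u - g u|)] at b2
  simp only [abs_abs] at b1 b2
  have md := hd.integral_abs_le_mom hγ
  have mf := hf.integral_abs_le_mom hγ
  have mg := hg.integral_abs_le_mom hγ
  have nd : 0 ≤ ∫ u, |f u - g u| := integral_nonneg fun _ => abs_nonneg _
  have nf : 0 ≤ ∫ u, |f u| := integral_nonneg fun _ => abs_nonneg _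
  have ng : 0 ≤ ∫ u, |g u| := integral_nonneg fun _ => abs_nonneg _
  refine (gainTwo_sub_le hγ hf hg e).trans ?_
  rw [integral_add (integrable_mul_V (integrable_fst_snd id if') e)
    (integrable_mul_V (integrable_fst_snd ig id) e)]
  exact add_le_add
    ((le_abs_self _).trans (b1.trans (mul_le_mul md mf nf (nd.trans md))))
    ((le_abs_self _).trans (b2.trans (mul_le_mul mg md nd (ng.trans mg))))

/-- The sharp difference estimate for the quadratic gain term. With `d = f - g` and `|g| ≤ f + |d|`,
the collisions in which `d` carries most of the energy are weighted by the mass of `f` alone. -/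
lemma gainTwo_sub_sharp (hβ : 5 / 2 < β) (hγ : 5 / 2 < γ) (hf : Dec γ R f)
    (f0 : ∀ u, 0 ≤ f u) (hg : Dec γ R g) (hd : Dec β D (fun u => f u - g u)) {e : ℝ} (he : 0 < e) :
    |gainTwo f e - gainTwo g e| ≤
      2 * (D * (1 + e) ^ (-β) * (√e * mass f / (β - 1) + gainConst β * mom f) +
        R * (1 + e) ^ (-γ) * (√e * mass (fun u => |f u - g u|) / (γ - 1) +
          gainConst γ * mom (fun u => f u - g u))) +
      4 * (R * (1 + e) ^ (-γ) * (√e * mass (fun u => |f u - g u|) / (γ - 1) +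
          gainConst γ * mom (fun u => f u - g u))) := by
  have hd2 := (hf.sub hg).abs
  have id := (hd.integrable hβ).abs
  have if' := hf.integrable hγ
  have ig := (hg.integrable hγ).abs
  have k1 := integral_gain_le hβ hγ hd.abs hf (fun _ => abs_nonneg _) f0 he
  have k2 := integral_gain_le hγ hβ hf hd.abs f0 (fun _ => abs_nonneg _) he
  have k3 := integral_gain_le hγ hγ hd2 hd2 (fun _ => abs_nonneg _) (fun _ => abs_nonneg _) he
  rw [mom_abs (fun u => f u - g u)] at k1 k2 k3
  have i1 := integrable_mul_V (integrable_fst_snd id if') e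
  have i2 := integrable_mul_V (integrable_fst_snd if' id) e
  have i3 := integrable_mul_V (integrable_fst_snd id id) e
  have i4 := integrable_mul_V (integrable_fst_snd id if'.abs) e
  have i5 := integrable_mul_V (integrable_fst_snd ig id) e
  have i12 : Integrable (fun p : ℝ × ℝ => |f p.1 - g p.1| * f p.2 * V e p +
      f p.1 * |f p.2 - g p.2| * V e p) := i1.add i2
  have key : |gainTwo f e - gainTwo g e| ≤
      (∫ p : ℝ × ℝ, |f p.1 - g p.1| * f p.2 * V e p) +
      (∫ p : ℝ × ℝ, f p.1 * |f p.2 - g p.2| * V e p) +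
      ∫ p : ℝ × ℝ, |f p.1 - g p.1| * |f p.2 - g p.2| * V e p := by
    rw [← integral_add i1 i2, ← integral_add i12 i3]
    refine (gainTwo_sub_le hγ hf hg e).trans (integral_mono (i4.add i5) (i12.add i3) fun p => ?_)
    simp only [abs_of_nonneg (f0 _)]
    have a1 : |g p.1| ≤ f p.1 + |f p.1 - g p.1| := by
      have := abs_sub_abs_le_abs_sub (g p.1) (f p.1)
      rw [abs_of_nonneg (f0 p.1), abs_sub_comm] at this
      linarith
    have a2 : 0 ≤ |f p.2 - g p.2| * V e p := mul_nonneg (abs_nonneg _) (V_nonneg _ _)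
    nlinarith
  linarith

lemma gainThree_sub_le (hβ : 5 / 2 < β) (hβγ : β ≤ γ) (hf : Dec γ R f) (hg : Dec γ R g)
    (hd : Dec β D (fun u => f u - g u)) {e : ℝ} (he : 0 < e) :
    |gainThree f e - gainThree g e| ≤ 2 ^ β * (1 + e) ^ (-β) *
      ((D * mom f + R * mom (fun u => f u - g u)) * mom f +
       (R * mom (fun u => f u - g u) + D * mom g) * mom f +
       (R * mom g + R * mom g) * mom (fun u => f u - g u)) := by
  have hf' := hf.anti hβγ
  have hg' := hg.anti hβγ
  have t1 := integral_triple_le hβ hd hf' hf' he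
  have t2 := integral_triple_le hβ hg' hd hf' he
  have t3 := integral_triple_le hβ hg' hg' hd he
  have i1 := integrable_mul_V (integrable_triple hβ hd hf' hf' e) e
  have i2 := integrable_mul_V (integrable_triple hβ hg' hd hf' e) e
  have i3 := integrable_mul_V (integrable_triple hβ hg' hg' hd e) e
  have i12 : Integrable (fun p : ℝ × ℝ => (f p.1 - g p.1) * f p.2 * f (p.1 + p.2 - e) * V e p +
      g p.1 * (f p.2 - g p.2) * f (p.1 + p.2 - e) * V e p) := i1.add i2
  have e1 : gainThree f e - gainThree g e =
      (∫ p : ℝ × ℝ, (f p.1 - g p.1) * f p.2 * f (p.1 + p.2 - e) * V e p) +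
      (∫ p : ℝ × ℝ, g p.1 * (f p.2 - g p.2) * f (p.1 + p.2 - e) * V e p) +
      ∫ p : ℝ × ℝ, g p.1 * g p.2 * (f (p.1 + p.2 - e) - g (p.1 + p.2 - e)) * V e p := by
    rw [gainThree, gainThree, ← integral_sub (integrable_gainThree hβ hf' e)
      (integrable_gainThree hβ hg' e), ← integral_add i1 i2, ← integral_add i12 i3]
    congr 1; ext p; ring
  rw [e1]
  calc _ ≤ _ := abs_add_three _ _ _
    _ ≤ _ := add_le_add (add_le_add t1 t2) t3
    _ = _ := by ring

/-- The loss rate is Lipschitz, with a constant growing like `√ε₁`. -/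
lemma exists_lossRate_sub_le (hβ : 5 / 2 < β) (hβγ : β ≤ γ) (R : ℝ) : ∃ C : ℝ, 0 ≤ C ∧
    ∀ (f g : ℝ → ℝ) (D : ℝ), Dec γ R f → Dec γ R g → Dec β D (fun u => f u - g u) →
      ∀ e, 0 < e → |lossRate f e - lossRate g e| ≤ C * D * √(1 + e) := by
  rcases lt_or_ge R 0 with hR | hR
  · exact ⟨0, le_rfl, fun f g D hf => absurd hf.nonneg (not_le.2 hR)⟩
  have hγ : 5 / 2 < γ := hβ.trans_le hβγ
  have hcβ := mom_wt_nonneg β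
  have hcγ := mom_wt_nonneg γ
  refine ⟨c₀ * (2 * mom (wt β) + 4 * (mom (wt β) * (R * mom (wt γ)))), by
    have := c₀_pos; positivity, fun f g D hf hg hd e he => ?_⟩
  have h1 := abs_integral_two_le hβ hd he
  have h2 := abs_lossTwo_sub_le hγ hf hg e
  have h3 : lossOne f e - lossOne g e = ∫ p : ℝ × ℝ,
    (f (p.1 + p.2 - e) - g (p.1 + p.2 - e)) * V e p := lossOne_sub hγ hf hg e
  rw [← h3] at h1
  have mf := hf.mom_le hγ
  have mg := hg.mom_le hγ
  have md := hd.mom_le hβ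
  have nf := hf.mom_nonneg
  have ng := hg.mom_nonneg
  have nd := hd.mom_nonneg
  have hD := hd.nonneg
  have hs := one_le_sqrt_one_add he.le
  rw [lossRate_eq hγ hf, lossRate_eq hγ hg, ← mul_sub, abs_mul, abs_of_pos c₀_pos,
    show lossOne f e + 2 * lossTwo f e - (lossOne g e + 2 * lossTwo g e) =
      (lossOne f e - lossOne g e) + 2 * (lossTwo f e - lossTwo g e) by ring, mul_assoc, mul_assoc]
  refine mul_le_mul_of_nonneg_left ?_ c₀_pos.le
  have h4 : |lossTwo f e - lossTwo g e| ≤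
      (D * mom (wt β)) * (R * mom (wt γ)) + (R * mom (wt γ)) * (D * mom (wt β)) :=
    h2.trans (by gcongr)
  have h5 : |lossOne f e - lossOne g e| ≤ 2 * √(1 + e) * (D * mom (wt β)) := h1.trans (by gcongr)
  calc _ ≤ |lossOne f e - lossOne g e| + 2 * |lossTwo f e - lossTwo g e| := by
        refine (abs_add_le _ _).trans (le_of_eq ?_)
        rw [abs_mul, abs_two]
    _ ≤ 2 * √(1 + e) * (D * mom (wt β)) +
        4 * ((D * mom (wt β)) * (R * mom (wt γ))) * √(1 + e) := by
        have : (D * mom (wt β)) * (R * mom (wt γ)) ≤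
            (D * mom (wt β)) * (R * mom (wt γ)) * √(1 + e) :=
          le_mul_of_one_le_right (by positivity) hs
        linarith
    _ = _ := by ring

/-- The gain term is Lipschitz up to a term of size `√ε₁` whose coefficient `2/(β-1)` times the mass
is, for `β > 3`, smaller than the corresponding coefficient of the loss rate. -/
lemma exists_gain_sub_le (hβ : 5 / 2 < β) (hβγ : β ≤ γ) (R : ℝ) : ∃ C : ℝ, 0 ≤ C ∧
    ∀ (f g : ℝ → ℝ) (D : ℝ), Dec γ R f → (∀ u, 0 ≤ f u) → Dec γ R g →
      Dec β D (fun u => f u - g u) → ∀ e, 0 < e → |gain f e - gain g e| ≤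
        D * (2 / (β - 1) * (√e * mass f) * (1 + e) ^ (-β) +
          C * ((1 + e) ^ (-β) + √(1 + e) * (1 + e) ^ (-γ))) := by
  rcases lt_or_ge R 0 with hR | hR
  · exact ⟨0, le_rfl, fun f g D hf => absurd hf.nonneg (not_le.2 hR)⟩
  have hγ : 5 / 2 < γ := hβ.trans_le hβγ
  have hcβ := mom_wt_nonneg β
  set cβ := mom (wt β) with hcβd
  have hcγ := mom_wt_nonneg γ
  set A := R * mom (wt γ) with hAd
  have hA : 0 ≤ A := mul_nonneg hR hcγ
  have hGβ := (gainConst_pos β).le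
  have hGγ := (gainConst_pos γ).le
  refine ⟨2 * gainConst β * A + 6 * R * (1 + gainConst γ) * cβ + (A * A + 2 * R * A * cβ) +
    2 ^ β * (2 * (A + R * cβ) * A + 2 * R * A * cβ), by positivity,
    fun f g D hf f0 hg hd e he => ?_⟩
  have mf : mom f ≤ A := hf.mom_le hγ
  have mg : mom g ≤ A := hg.mom_le hγ
  have md : mom (fun u => f u - g u) ≤ D * cβ := hd.mom_le hβ
  have nf := hf.mom_nonneg
  have ng := hg.mom_nonneg
  have nd := hd.mom_nonneg
  have hD := hd.nonneg
  have s1 := gainTwo_sub_sharp hβ hγ hf f0 hg hd he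
  have s2 := gainTwo_sub_crude hγ hf hg e
  have s3 := gainThree_sub_le hβ hβγ hf hg hd he
  have s4 := abs_gainTwo_le hγ hf e
  have hs := one_le_sqrt_one_add he.le
  have hes : √e ≤ √(1 + e) := Real.sqrt_le_sqrt (by linarith)
  have hab : (1 + e) ^ (-γ) ≤ (1 + e) ^ (-β) := by
    have := wt_anti hβγ e
    rwa [wt_of_pos he, wt_of_pos he] at this
  have nmd : 0 ≤ mass (fun u => |f u - g u|) := mass_nonneg fun _ => abs_nonneg _
  have mmd : mass (fun u => |f u - g u|) ≤ D * cβ := (hd.mass_abs_le_mom hβ).trans md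
  have nM : 0 ≤ mass f := mass_nonneg f0
  have hdb := hd.bound e
  rw [wt_of_pos he] at hdb
  have hgb := hg.bound e
  rw [wt_of_pos he] at hgb
  set a := (1 + e) ^ (-β) with ha
  set b := (1 + e) ^ (-γ) with hb
  set s := √(1 + e) with hsd
  set md' := mom (fun u => f u - g u) with hmd'
  set M' := mass (fun u => |f u - g u|) with hM'
  have ha0 : 0 ≤ a := by positivity
  have hb0 : 0 ≤ b := by positivity
  have hbs : 0 ≤ s * b := by positivity
  -- the quadratic part
  have q1 : |gainTwo f e - gainTwo g e| ≤ D * (2 / (β - 1) * (√e * mass f) * a) +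
      D * ((2 * gainConst β * A) * a + (6 * R * (1 + gainConst γ) * cβ) * (s * b)) := by
    have c1 : √e * M' / (γ - 1) ≤ s * (D * cβ) := by
      refine (div_le_self (by positivity) (by linarith)).trans ?_
      gcongr
    have c2 : gainConst γ * md' ≤ s * (gainConst γ * (D * cβ)) :=
      (mul_le_mul_of_nonneg_left md hGγ).trans (le_mul_of_one_le_left (by positivity) hs)
    have c3 : R * b * (√e * M' / (γ - 1) + gainConst γ * md') ≤
        R * b * (s * (D * cβ) + s * (gainConst γ * (D * cβ))) := by gcongr
    have c4 : D * a * (√e * mass f / (β - 1) + gainConst β * mom f) ≤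
        D * a * (√e * mass f / (β - 1) + gainConst β * A) := by gcongr
    calc _ ≤ _ := s1
      _ ≤ 2 * (D * a * (√e * mass f / (β - 1) + gainConst β * A) +
          R * b * (s * (D * cβ) + s * (gainConst γ * (D * cβ)))) +
          4 * (R * b * (s * (D * cβ) + s * (gainConst γ * (D * cβ)))) := by gcongr
      _ = _ := by ring
  have q2 : |f e * gainTwo f e - g e * gainTwo g e| ≤ D * ((A * A + 2 * R * A * cβ) * a) := by
    rw [show f e * gainTwo f e - g e * gainTwo g e =
      (f e - g e) * gainTwo f e + g e * (gainTwo f e - gainTwo g e) by ring]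
    have c1 : |gainTwo f e| ≤ A * A := s4.trans (by gcongr)
    have c2 : |gainTwo f e - gainTwo g e| ≤ D * cβ * A + A * (D * cβ) :=
      s2.trans (by gcongr)
    have c3 : |g e| ≤ R * a := hgb.trans (by gcongr)
    calc _ ≤ |f e - g e| * |gainTwo f e| + |g e| * |gainTwo f e - gainTwo g e| := by
          rw [← abs_mul, ← abs_mul]; exact abs_add_le _ _
      _ ≤ (D * a) * (A * A) + (R * a) * (D * cβ * A + A * (D * cβ)) := by gcongr
      _ = _ := by ring
  have q3 : |gainThree f e - gainThree g e| ≤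
      D * ((2 ^ β * (2 * (A + R * cβ) * A + 2 * R * A * cβ)) * a) := by
    calc _ ≤ _ := s3
      _ ≤ 2 ^ β * a * ((D * A + R * (D * cβ)) * A + (R * (D * cβ) + D * A) * A +
        (R * A + R * A) * (D * cβ)) := by gcongr
      _ = _ := by ring
  rw [gain_eq hγ hf, gain_eq hγ hg,
    show (1 + f e) * gainTwo f e + gainThree f e - ((1 + g e) * gainTwo g e + gainThree g e) =
    (gainTwo f e - gainTwo g e) + (f e * gainTwo f e - g e * gainTwo g e) +
      (gainThree f e - gainThree g e) by ring]
  refine (abs_add_three _ _ _).trans ((add_le_add (add_le_add q1 q2) q3).trans ?_)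
  have r1 : 0 ≤ D * ((2 * gainConst β * A + (A * A + 2 * R * A * cβ) +
      2 ^ β * (2 * (A + R * cβ) * A + 2 * R * A * cβ)) * (s * b)) := by positivity
  have r2 : 0 ≤ D * ((6 * R * (1 + gainConst γ) * cβ) * a) := by positivity
  linarith

/-- A cruder Lipschitz bound for the gain term of possibly signed profiles. -/
lemma exists_gain_sub_crude (hβ : 5 / 2 < β) (hβγ : β ≤ γ) (R : ℝ) : ∃ C : ℝ, 0 ≤ C ∧
    ∀ (f g : ℝ → ℝ) (D : ℝ), Dec γ R f → Dec γ R g →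
      Dec β D (fun u => f u - g u) → ∀ e, 0 < e → |gain f e - gain g e| ≤ C * D := by
  rcases lt_or_ge R 0 with hR | hR
  · exact ⟨0, le_rfl, fun f g D hf => absurd hf.nonneg (not_le.2 hR)⟩
  have hγ : 5 / 2 < γ := hβ.trans_le hβγ
  have hcβ := mom_wt_nonneg β
  set cβ := mom (wt β) with hcβd
  have hcγ := mom_wt_nonneg γ
  set A := R * mom (wt γ) with hAd
  have hA : 0 ≤ A := mul_nonneg hR hcγ
  refine ⟨2 * A * cβ + (A * A + 2 * R * A * cβ) +
    2 ^ β * (2 * (A + R * cβ) * A + 2 * R * A * cβ), by positivity,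
    fun f g D hf hg hd e he => ?_⟩
  have mf : mom f ≤ A := hf.mom_le hγ
  have mg : mom g ≤ A := hg.mom_le hγ
  have md : mom (fun u => f u - g u) ≤ D * cβ := hd.mom_le hβ
  have nf := hf.mom_nonneg
  have ng := hg.mom_nonneg
  have nd := hd.mom_nonneg
  have hD := hd.nonneg
  have s2 := gainTwo_sub_crude hγ hf hg e
  have s3 := gainThree_sub_le hβ hβγ hf hg hd he
  have s4 := abs_gainTwo_le hγ hf e
  have hdb : |f e - g e| ≤ D := hd.le (by linarith) e
  have hgb := hg.le (by linarith) e
  have ha1 : (1 + e) ^ (-β) ≤ 1 := by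
    have := wt_le_one (β := β) (by linarith) e
    rwa [wt_of_pos he] at this
  set a := (1 + e) ^ (-β) with ha
  have ha0 : 0 ≤ a := by positivity
  set md' := mom (fun u => f u - g u) with hmd'
  have c1 : |gainTwo f e| ≤ A * A := s4.trans (by gcongr)
  have c2 : |gainTwo f e - gainTwo g e| ≤ D * cβ * A + A * (D * cβ) := s2.trans (by gcongr)
  have q2 : |f e * gainTwo f e - g e * gainTwo g e| ≤ D * (A * A + 2 * R * A * cβ) := by
    rw [show f e * gainTwo f e - g e * gainTwo g e =
      (f e - g e) * gainTwo f e + g e * (gainTwo f e - gainTwo g e) by ring]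
    calc _ ≤ |f e - g e| * |gainTwo f e| + |g e| * |gainTwo f e - gainTwo g e| := by
          rw [← abs_mul, ← abs_mul]; exact abs_add_le _ _
      _ ≤ D * (A * A) + R * (D * cβ * A + A * (D * cβ)) := by gcongr
      _ = _ := by ring
  have q3 : |gainThree f e - gainThree g e| ≤
      D * (2 ^ β * (2 * (A + R * cβ) * A + 2 * R * A * cβ)) := by
    calc _ ≤ _ := s3
      _ ≤ 2 ^ β * 1 * ((D * A + R * (D * cβ)) * A + (R * (D * cβ) + D * A) * A +
        (R * A + R * A) * (D * cβ)) := by gcongr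
      _ = _ := by ring
  rw [gain_eq hγ hf, gain_eq hγ hg,
    show (1 + f e) * gainTwo f e + gainThree f e - ((1 + g e) * gainTwo g e + gainThree g e) =
    (gainTwo f e - gainTwo g e) + (f e * gainTwo f e - g e * gainTwo g e) +
      (gainThree f e - gainThree g e) by ring]
  refine (abs_add_three _ _ _).trans ((add_le_add (add_le_add c2 q2) q3).trans (le_of_eq ?_))
  ring

end diff

/-! ### Absorbing the gain into the loss -/

lemma exists_mul_rpow_neg_le {κ η C : ℝ} (hκ : 0 < κ) (hη : 0 < η) (hC : 0 ≤ C) :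
    ∃ C' : ℝ, 0 ≤ C' ∧ ∀ x : ℝ, 1 ≤ x → C * (√x * x ^ (-κ)) ≤ η * √x + C' := by
  have h1 : Tendsto (fun x : ℝ => C * x ^ (-κ)) atTop (𝓝 (C * 0)) :=
    (tendsto_rpow_neg_atTop hκ).const_mul C
  rw [mul_zero] at h1
  obtain ⟨X, hX⟩ := eventually_atTop.1 (h1.eventually (ge_mem_nhds hη))
  refine ⟨C * √X, by positivity, fun x hx => ?_⟩
  rcases le_total X x with h | h
  · have := mul_le_mul_of_nonneg_right (hX x h) (Real.sqrt_nonneg x)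
    have : 0 ≤ C * √X := by positivity
    linarith
  · have h2 : x ^ (-κ) ≤ 1 := Real.rpow_le_one_of_one_le_of_nonpos hx (by linarith)
    have h3 : √x * x ^ (-κ) ≤ √X * 1 :=
      mul_le_mul (Real.sqrt_le_sqrt h) h2 (by positivity) (Real.sqrt_nonneg _)
    have h4 : 0 ≤ η * √x := by positivity
    nlinarith

/-- The parameters of the exponentially weighted norm in which the mild map contracts. The exponent
`β` is chosen in `(3, γ)` when the mass `M` stays away from `0`: then the loss rate `a` absorbs the
gain, as `2/(β-1) < 1`. When the mass vanishes, `β = γ - 1/2` makes all terms bounded. -/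
lemma exists_absorb {γ : ℝ} (hγ : 3 < γ) {S : Set ℝ}
    (hS : (∀ M ∈ S, M = 0) ∨ ∃ m₀ : ℝ, 0 < m₀ ∧ ∀ M ∈ S, m₀ ≤ M) :
    ∃ β : ℝ, 5 / 2 < β ∧ β ≤ γ ∧ ∀ C A : ℝ, 0 ≤ C → 0 ≤ A → ∃ Λ ρ : ℝ, 0 ≤ Λ ∧ 0 ≤ ρ ∧ ρ < 1 ∧
      ∀ M ∈ S, ∀ e, 0 < e → ∀ a, 0 ≤ a → c₀ * (√e * M - A) ≤ a →
        c₀ * (2 / (β - 1) * (√e * M)) + C * (1 + √(1 + e) * (1 + e) ^ (-(γ - β))) ≤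
          ρ * (Λ + a) := by
  rcases hS with hS | ⟨m₀, hm₀, hS⟩
  · refine ⟨γ - 1 / 2, by linarith, by linarith, fun C A hC hA =>
      ⟨4 * C, 1 / 2, by positivity, by norm_num, by norm_num, fun M hM e he a ha _ => ?_⟩⟩
    rw [hS M hM]
    have h1 : √(1 + e) * (1 + e) ^ (-(γ - (γ - 1 / 2))) = 1 := by
      rw [Real.sqrt_eq_rpow, ← Real.rpow_add (by linarith)]
      norm_num
    rw [h1]
    simp only [mul_zero]
    linarith
  · set β := (3 + γ) / 2 with hβ
    set θ := 2 / (β - 1) with hθ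
    have hθ0 : 0 < θ := by rw [hθ]; exact div_pos two_pos (by linarith)
    have hθ1 : θ < 1 := by rw [hθ, div_lt_one (by linarith)]; linarith
    refine ⟨β, by linarith, by linarith, fun C A hC hA => ?_⟩
    have hc := c₀_pos
    set ρ := (1 + θ) / 2 with hρ
    have hρ0 : 0 < ρ := by linarith
    have hη : 0 < c₀ * ((ρ - θ) * m₀) := by
      have : 0 < ρ - θ := by linarith
      positivity
    obtain ⟨C', hC', hb⟩ := exists_mul_rpow_neg_le (κ := γ - β) (by linarith) hη hC
    set η := c₀ * ((ρ - θ) * m₀) with hηd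
    refine ⟨c₀ * A + (C + η + C') / ρ, ρ, by positivity, hρ0.le, by linarith,
      fun M hM e he a ha hMa => ?_⟩
    have h1 := hb (1 + e) (by linarith)
    have h2 : √(1 + e) ≤ 1 + √e := by
      rw [Real.sqrt_le_left (by positivity)]
      nlinarith [Real.sq_sqrt he.le, Real.sqrt_nonneg e]
    have h3 : η * √e ≤ c₀ * ((ρ - θ) * (√e * M)) := by
      rw [hηd, mul_assoc, mul_assoc]
      refine mul_le_mul_of_nonneg_left (mul_le_mul_of_nonneg_left ?_ (by linarith)) hc.le
      rw [mul_comm]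
      exact mul_le_mul_of_nonneg_left (hS M hM) (Real.sqrt_nonneg _)
    have h4 : ρ * (c₀ * A + (C + η + C') / ρ + a) = ρ * (c₀ * A) + (C + η + C') + ρ * a := by
      field_simp
    have h5 : ρ * (c₀ * (√e * M - A)) ≤ ρ * a := mul_le_mul_of_nonneg_left hMa hρ0.le
    rw [h4]
    have h6 : η * √(1 + e) ≤ η * (1 + √e) := mul_le_mul_of_nonneg_left h2 hη.le
    nlinarith

/-! ### Linear differential equations and comparison -/

section ode

variable {a b F S : ℝ → ℝ} {T : ℝ}

lemma hasDerivAt_primitive (ha : Continuous a) (t : ℝ) :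
    HasDerivAt (fun t => ∫ s in (0 : ℝ)..t, a s) (a t) t :=
  intervalIntegral.integral_hasDerivAt_right (ha.intervalIntegrable _ _)
    ha.stronglyMeasurable.stronglyMeasurableAtFilter ha.continuousAt

lemma ode_nonneg {G G' : ℝ → ℝ} (ha : Continuous a) (hG : ContinuousOn G (Icc 0 T))
    (hd : ∀ t ∈ Ioo 0 T, HasDerivAt G (G' t) t) (hn : ∀ t ∈ Ioo 0 T, 0 ≤ G' t + a t * G t)
    (h0 : 0 ≤ G 0) : ∀ t ∈ Icc 0 T, 0 ≤ G t := by
  intro t ht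
  have hA : Continuous fun t => Real.exp (∫ s in (0 : ℝ)..t, a s) :=
    Real.continuous_exp.comp (continuous_iff_continuousAt.2
      fun t => (hasDerivAt_primitive ha t).continuousAt)
  have hd' : ∀ t ∈ Ioo 0 T, HasDerivAt (fun t => G t * Real.exp (∫ s in (0 : ℝ)..t, a s))
      (G' t * Real.exp (∫ s in (0 : ℝ)..t, a s) +
        G t * (Real.exp (∫ s in (0 : ℝ)..t, a s) * a t)) t :=
    fun t ht => (hd t ht).mul (hasDerivAt_primitive ha t).exp
  have hmono : MonotoneOn (fun t => G t * Real.exp (∫ s in (0 : ℝ)..t, a s)) (Icc 0 T) := by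
    refine monotoneOn_of_deriv_nonneg (convex_Icc _ _) (hG.mul hA.continuousOn) ?_ ?_
    · intro s hs
      rw [interior_Icc] at hs
      exact (hd' s hs).differentiableAt.differentiableWithinAt
    · intro s hs
      rw [interior_Icc] at hs
      rw [(hd' s hs).deriv]
      have := mul_nonneg (hn s hs) (Real.exp_pos (∫ r in (0 : ℝ)..s, a r)).le
      linarith
  have h1 := hmono ⟨le_rfl, ht.1.trans ht.2⟩ ht ht.1
  simp only [intervalIntegral.integral_same, Real.exp_zero, mul_one] at h1
  exact nonneg_of_mul_nonneg_left (h0.trans h1) (Real.exp_pos _)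

/-- Comparison with the supersolution `κ e^{Λt}`. -/
lemma ode_abs_le (ha : Continuous a) (hF : ContinuousOn F (Icc 0 T))
    (hd : ∀ t ∈ Ioo 0 T, HasDerivAt F (-(a t * F t) + S t) t) {Λ κ : ℝ}
    (hS : ∀ t ∈ Ioo 0 T, |S t| ≤ (Λ + a t) * (κ * Real.exp (Λ * t))) (h0 : |F 0| ≤ κ) :
    ∀ t ∈ Icc 0 T, |F t| ≤ κ * Real.exp (Λ * t) := by
  intro t ht
  have hE : Continuous fun t : ℝ => κ * Real.exp (Λ * t) := by fun_prop
  have hE' : ∀ t : ℝ, HasDerivAt (fun t : ℝ => κ * Real.exp (Λ * t))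
      (κ * (Real.exp (Λ * t) * Λ)) t := fun t => by
    have : HasDerivAt (fun t : ℝ => Λ * t) Λ t := by
      simpa using (hasDerivAt_id t).const_mul Λ
    exact this.exp.const_mul κ
  have h00 := abs_le.1 h0
  have u1 := ode_nonneg (G := fun t => κ * Real.exp (Λ * t) - F t) ha (hE.continuousOn.sub hF)
    (fun t ht => (hE' t).sub (hd t ht)) (fun t ht => by
      have := (abs_le.1 (hS t ht)).2
      nlinarith) (by simpa using h00.2) t ht
  have u2 := ode_nonneg (G := fun t => κ * Real.exp (Λ * t) + F t) ha (hE.continuousOn.add hF)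
    (fun t ht => (hE' t).add (hd t ht)) (fun t ht => by
      have := (abs_le.1 (hS t ht)).1
      nlinarith) (by simp only [mul_zero, Real.exp_zero, mul_one]; linarith [h00.1]) t ht
  rw [abs_le]
  constructor <;> linarith

lemma ode_lower (ha : Continuous a) (hF : ContinuousOn F (Icc 0 T))
    (hd : ∀ t ∈ Ioo 0 T, HasDerivAt F (-(a t * F t) + S t) t) {α : ℝ}
    (hα : ∀ t ∈ Ioo 0 T, a t ≤ α) (hS : ∀ t ∈ Ioo 0 T, 0 ≤ S t) (h0 : 0 ≤ F 0) :
    ∀ t ∈ Icc 0 T, F 0 * Real.exp (-(α * t)) ≤ F t := by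
  intro t ht
  have hE' : ∀ t : ℝ, HasDerivAt (fun t : ℝ => F 0 * Real.exp (-(α * t)))
      (F 0 * (Real.exp (-(α * t)) * -α)) t := fun t => by
    have : HasDerivAt (fun t : ℝ => -(α * t)) (-α) t := by
      simpa using ((hasDerivAt_id t).const_mul α).fun_neg
    exact this.exp.const_mul (F 0)
  have := ode_nonneg (G := fun t => F t - F 0 * Real.exp (-(α * t))) ha
    (hF.sub (by fun_prop)) (fun t ht => (hd t ht).sub (hE' t)) (fun t ht => by
      have h1 : 0 ≤ (α - a t) * (F 0 * Real.exp (-(α * t))) :=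
        mul_nonneg (by linarith [hα t ht]) (mul_nonneg h0 (Real.exp_pos _).le)
      have h2 := hS t ht
      nlinarith) (by simp) t ht
  linarith

lemma ode_unique {F' : ℝ → ℝ} (ha : Continuous a) (hF : ContinuousOn F (Icc 0 T))
    (hF' : ContinuousOn F' (Icc 0 T))
    (hd : ∀ t ∈ Ioo 0 T, HasDerivAt F (-(a t * F t) + S t) t)
    (hd' : ∀ t ∈ Ioo 0 T, HasDerivAt F' (-(a t * F' t) + S t) t) (h0 : F 0 = F' 0) :
    ∀ t ∈ Icc 0 T, F t = F' t := by
  intro t ht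
  have := ode_abs_le (F := fun t => F t - F' t) (S := fun _ => 0) (Λ := 0) (κ := 0) ha
    (hF.sub hF') (fun t ht => by
      have := (hd t ht).sub (hd' t ht)
      refine this.congr_deriv (by ring)) (by simp) (by simp [h0]) t ht
  rw [zero_mul] at this
  exact sub_eq_zero.1 (abs_eq_zero.1 (le_antisymm this (abs_nonneg _)))

/-- Duhamel's formula for the solution of `F' = -a F + b`, `F 0 = F₀`. -/
def duhamel (a b : ℝ → ℝ) (F₀ t : ℝ) : ℝ :=
  Real.exp (-∫ s in (0 : ℝ)..t, a s) *
    (F₀ + ∫ s in (0 : ℝ)..t, Real.exp (∫ r in (0 : ℝ)..s, a r) * b s)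

@[simp]
lemma duhamel_zero (a b : ℝ → ℝ) (F₀ : ℝ) : duhamel a b F₀ 0 = F₀ := by simp [duhamel]

lemma continuous_exp_primitive (ha : Continuous a) :
    Continuous fun t => Real.exp (∫ s in (0 : ℝ)..t, a s) :=
  Real.continuous_exp.comp (continuous_iff_continuousAt.2
    fun t => (hasDerivAt_primitive ha t).continuousAt)

lemma hasDerivAt_duhamel (ha : Continuous a) (hb : Continuous b) (F₀ t : ℝ) :
    HasDerivAt (duhamel a b F₀) (-(a t * duhamel a b F₀ t) + b t) t := by
  have h1 := (hasDerivAt_primitive ha t).fun_neg.exp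
  have h2 := (hasDerivAt_primitive ((continuous_exp_primitive ha).mul hb) t).const_add F₀
  refine (h1.mul h2).congr_deriv ?_
  rw [duhamel]
  simp only [Pi.mul_apply]
  have h3 : Real.exp (-∫ s in (0 : ℝ)..t, a s) * Real.exp (∫ s in (0 : ℝ)..t, a s) = 1 := by
    rw [← Real.exp_add, neg_add_cancel, Real.exp_zero]
  linear_combination b t * h3

lemma continuous_duhamel (ha : Continuous a) (hb : Continuous b) (F₀ : ℝ) :
    Continuous (duhamel a b F₀) :=
  continuous_iff_continuousAt.2 fun t => (hasDerivAt_duhamel ha hb F₀ t).continuousAt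

end ode

/-- The right-hand side of the mild formulation is Duhamel's formula. -/
lemma mildRHS_eq_duhamel (f₀ : ℝ → ℝ) (f : ℝ → ℝ → ℝ) (t e : ℝ) :
    mildRHS 0 f₀ f t e =
      duhamel (fun s => lossRate (f s) e) (fun s => c₀ * gain (f s) e) (f₀ e) t := by
  rw [mildRHS, duhamel, mul_add, mul_comm (f₀ e)]
  congr 1
  rw [← intervalIntegral.integral_const_mul, ← intervalIntegral.integral_const_mul]
  refine intervalIntegral.integral_congr fun s _ => ?_
  simp only [Psi]
  rw [Real.exp_neg (∫ r in (0 : ℝ)..s, lossRate (f r) e), div_inv_eq_mul]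
  ring

/-! ### Time-dependent profiles -/

/-- A time-dependent profile, defined at all real times, that decays uniformly in time and is
continuous in time at each energy. -/
structure Reg (γ K : ℝ) (f : ℝ → ℝ → ℝ) : Prop where
  dec : ∀ t, Dec γ K (f t)
  cont : ∀ ε, Continuous fun t => f t ε

lemma gain_of_nonpos (h : ℝ → ℝ) {e : ℝ} (he : e ≤ 0) : gain h e = 0 := by
  simp [gain, W, Real.sqrt_eq_zero_of_nonpos he]

lemma lossRate_of_nonpos (h : ℝ → ℝ) {e : ℝ} (he : e ≤ 0) : lossRate h e = 0 := by
  simp [lossRate, W, Real.sqrt_eq_zero_of_nonpos he]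

lemma measurable_V_comp {α : Type*} [MeasurableSpace α] {u : α → ℝ} {v : α → ℝ × ℝ}
    (hu : Measurable u) (hv : Measurable v) : Measurable fun a => V (u a) (v a) :=
  measurable_V_uncurry.comp (hu.prodMk hv)

section

variable {β γ K : ℝ} {h : ℝ → ℝ} {f : ℝ → ℝ → ℝ}

lemma Dec.measurable_lossRate (hγ : 5 / 2 < γ) (hd : Dec γ K h) : Measurable (lossRate h) := by
  have hm := hd.meas
  rw [funext (lossRate_eq_integral hγ hd)]
  have hV : Measurable fun z : ℝ × (ℝ × ℝ) => V z.1 z.2 :=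
    measurable_V_comp measurable_fst measurable_snd
  have : Measurable (fun z : ℝ × (ℝ × ℝ) =>
      h (z.2.1 + z.2.2 - z.1) * (1 + h z.2.1 + h z.2.2) * V z.1 z.2) := by fun_prop
  exact (this.stronglyMeasurable.integral_prod_right' (ν := volume)).measurable.const_mul _

lemma Dec.measurable_gain (hγ : 5 / 2 < γ) (hd : Dec γ K h) : Measurable (gain h) := by
  have hm := hd.meas
  rw [funext (gain_eq_integral hγ hd)]
  have hV : Measurable fun z : ℝ × (ℝ × ℝ) => V z.1 z.2 :=
    measurable_V_comp measurable_fst measurable_snd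
  have : Measurable (fun z : ℝ × (ℝ × ℝ) =>
      h z.2.1 * h z.2.2 * (1 + h z.1 + h (z.2.1 + z.2.2 - z.1)) * V z.1 z.2) := by fun_prop
  exact (this.stronglyMeasurable.integral_prod_right' (ν := volume)).measurable

lemma Reg.continuous_lossRate (hγ : 5 / 2 < γ) (hf : Reg γ K f) (e : ℝ) :
    Continuous fun t => lossRate (f t) e := by
  simp_rw [fun t => lossRate_eq_integral hγ (hf.dec t) e]
  have hK := (hf.dec 0).nonneg
  refine continuous_const.mul (continuous_of_dominated
    (bound := fun p => K * (1 + K + K) * (wt γ (p.1 + p.2 - e) * V e p)) (fun t => ?_)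
    (fun t => ae_of_all _ fun p => ?_) ((integrable_two' hγ (dec_wt γ) e).const_mul _)
    (ae_of_all _ fun p => ?_))
  · have hm := (hf.dec t).meas
    exact Measurable.aestronglyMeasurable (by fun_prop)
  · rw [Real.norm_eq_abs, abs_mul, abs_mul, abs_of_nonneg (V_nonneg e p)]
    have h1 := (hf.dec t).bound (p.1 + p.2 - e)
    have h2 := (hf.dec t).le (by linarith) p.1
    have h3 := (hf.dec t).le (by linarith) p.2
    have h4 : |1 + f t p.1 + f t p.2| ≤ 1 + K + K := by
      refine (abs_add_three _ _ _).trans ?_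
      rw [abs_one]; linarith
    have h5 := V_nonneg e p
    have h6 := wt_nonneg γ (p.1 + p.2 - e)
    calc _ ≤ (K * wt γ (p.1 + p.2 - e)) * (1 + K + K) * V e p := by gcongr
      _ = _ := by ring
  · have h1 := hf.cont p.1
    have h2 := hf.cont p.2
    have h3 := hf.cont (p.1 + p.2 - e)
    fun_prop

lemma Reg.continuous_gain (hγ : 5 / 2 < γ) (hf : Reg γ K f) (e : ℝ) :
    Continuous fun t => gain (f t) e := by
  simp_rw [fun t => gain_eq_integral hγ (hf.dec t) e]
  have hK := (hf.dec 0).nonneg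
  refine continuous_of_dominated
    (bound := fun p => K * K * (1 + K + K) * (wt γ p.1 * wt γ p.2 * V e p)) (fun t => ?_)
    (fun t => ae_of_all _ fun p => ?_) ((integrable_gainTwo hγ (dec_wt γ) e).const_mul _)
    (ae_of_all _ fun p => ?_)
  · have hm := (hf.dec t).meas
    exact Measurable.aestronglyMeasurable (by fun_prop)
  · rw [Real.norm_eq_abs, abs_mul, abs_mul, abs_mul, abs_of_nonneg (V_nonneg e p)]
    have h1 := (hf.dec t).bound p.1
    have h1' := (hf.dec t).bound p.2
    have h2 := (hf.dec t).le (by linarith) e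
    have h3 := (hf.dec t).le (by linarith) (p.1 + p.2 - e)
    have h4 : |1 + f t e + f t (p.1 + p.2 - e)| ≤ 1 + K + K := by
      refine (abs_add_three _ _ _).trans ?_
      rw [abs_one]; linarith
    have h5 := V_nonneg e p
    have h6 := wt_nonneg γ p.1
    have h7 := wt_nonneg γ p.2
    calc _ ≤ (K * wt γ p.1) * (K * wt γ p.2) * (1 + K + K) * V e p := by gcongr
      _ = _ := by ring
  · have h1 := hf.cont p.1
    have h2 := hf.cont p.2
    have h3 := hf.cont (p.1 + p.2 - e)
    have h4 := hf.cont e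
    fun_prop

lemma collision_of_nonpos (hγ : 5 / 2 < γ) (hd : Dec γ K h) {e : ℝ} (he : e ≤ 0) :
    collision h e = 0 := by
  rw [collision_eq hγ hd, gain_of_nonpos h he, lossRate_of_nonpos h he]; simp

lemma Reg.continuous_collision (hγ : 5 / 2 < γ) (hf : Reg γ K f) (e : ℝ) :
    Continuous fun t => collision (f t) e := by
  simp_rw [fun t => collision_eq hγ (hf.dec t) e]
  exact ((hf.continuous_gain hγ e).const_mul _).sub
    ((hf.continuous_lossRate hγ e).mul (hf.cont e))

lemma Dec.measurable_collision (hγ : 5 / 2 < γ) (hd : Dec γ K h) : Measurable (collision h) := by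
  rw [funext (collision_eq hγ hd)]
  exact ((hd.measurable_gain hγ).const_mul _).sub ((hd.measurable_lossRate hγ).mul hd.meas)

lemma measurable_uncurry {u : ℝ → ℝ → ℝ} (h1 : ∀ e, Continuous fun t => u t e)
    (h2 : ∀ t, Measurable (u t)) : Measurable (Function.uncurry u) :=
  measurable_uncurry_of_continuous_of_measurable h1 h2

lemma Reg.measurable_uncurry (hf : Reg γ K f) : Measurable (Function.uncurry f) :=
  Nordheim.measurable_uncurry hf.cont fun t => (hf.dec t).meas

lemma measurable_intervalIntegral {u : ℝ → ℝ → ℝ} (hu : Measurable (Function.uncurry u)) (t : ℝ) :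
    Measurable fun e => ∫ s in (0 : ℝ)..t, u s e := by
  have h : ∀ S : Set ℝ, Measurable fun e => ∫ s in S, u s e := fun S =>
    (hu.stronglyMeasurable.integral_prod_left' (μ := volume.restrict S)).measurable
  exact (h _).sub (h _)

lemma measurable_duhamel {a b : ℝ → ℝ → ℝ} {f₀ : ℝ → ℝ} (ha : ∀ e, Continuous fun t => a t e)
    (ha' : ∀ t, Measurable (a t)) (hb : ∀ e, Continuous fun t => b t e)
    (hb' : ∀ t, Measurable (b t)) (hf₀ : Measurable f₀) (t : ℝ) :
    Measurable fun e => duhamel (fun s => a s e) (fun s => b s e) (f₀ e) t := by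
  have h1 : ∀ t, Measurable fun e => ∫ s in (0 : ℝ)..t, a s e :=
    measurable_intervalIntegral (measurable_uncurry ha ha')
  refine ((h1 t).neg.exp).mul (hf₀.add (measurable_intervalIntegral
    (u := fun s e => Real.exp (∫ r in (0 : ℝ)..s, a r e) * b s e) (measurable_uncurry ?_ ?_) t))
  · exact fun e => (continuous_exp_primitive (ha e)).mul (hb e)
  · exact fun s => (h1 s).exp.mul (hb' s)

end

/-! ### The mild map and its contraction property -/

/-- One application of the mild map to `f`, with time frozen outside `[0, T]`. -/
def mildMap (T : ℝ) (f₀ : ℝ → ℝ) (f : ℝ → ℝ → ℝ) (t e : ℝ) : ℝ :=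
  duhamel (fun s => lossRate (f s) e) (fun s => c₀ * gain (f s) e) (f₀ e) (max 0 (min t T))

section

variable {γ K T : ℝ} {f₀ : ℝ → ℝ} {f : ℝ → ℝ → ℝ}

lemma clamp_eq {t : ℝ} (ht : t ∈ Icc 0 T) : max 0 (min t T) = t := by
  rw [min_eq_left ht.2, max_eq_right ht.1]

lemma clamp_mem (hT : 0 ≤ T) (t : ℝ) : max 0 (min t T) ∈ Icc 0 T :=
  ⟨le_max_left _ _, max_le hT (min_le_right _ _)⟩

lemma mildMap_clamp (hT : 0 ≤ T) (t e : ℝ) :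
    mildMap T f₀ f (max 0 (min t T)) e = mildMap T f₀ f t e := by
  rw [mildMap, mildMap, clamp_eq (clamp_mem hT t)]

lemma continuous_mildMap (hγ : 5 / 2 < γ) (hf : Reg γ K f) (e : ℝ) :
    Continuous fun t => mildMap T f₀ f t e :=
  (continuous_duhamel (hf.continuous_lossRate hγ e) ((hf.continuous_gain hγ e).const_mul _) _).comp
    (by fun_prop)

lemma measurable_mildMap (hγ : 5 / 2 < γ) (hf : Reg γ K f) (hf₀ : Measurable f₀) (t : ℝ) :
    Measurable (mildMap T f₀ f t) :=
  measurable_duhamel (a := fun s e => lossRate (f s) e) (b := fun s e => c₀ * gain (f s) e)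
    (hf.continuous_lossRate hγ) (fun s => (hf.dec s).measurable_lossRate hγ)
    (fun e => (hf.continuous_gain hγ e).const_mul _)
    (fun s => ((hf.dec s).measurable_gain hγ).const_mul _) hf₀ _

lemma mildMap_of_nonpos {e : ℝ} (he : e ≤ 0) (t : ℝ) : mildMap T f₀ f t e = f₀ e := by
  simp [mildMap, duhamel, gain_of_nonpos _ he, lossRate_of_nonpos _ he]

lemma mildMap_zero (hT : 0 ≤ T) (e : ℝ) : mildMap T f₀ f 0 e = f₀ e := by
  rw [mildMap, clamp_eq ⟨le_rfl, hT⟩, duhamel_zero]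

lemma hasDerivAt_mildMap (hγ : 5 / 2 < γ) (hf : Reg γ K f) (e : ℝ) {t : ℝ} (ht : t ∈ Ioo 0 T) :
    HasDerivAt (fun t => mildMap T f₀ f t e)
      (-(lossRate (f t) e * mildMap T f₀ f t e) + c₀ * gain (f t) e) t := by
  have h1 := hasDerivAt_duhamel (hf.continuous_lossRate hγ e)
    ((hf.continuous_gain hγ e).const_mul c₀) (f₀ e) t
  have h2 : mildMap T f₀ f t e =
      duhamel (fun s => lossRate (f s) e) (fun s => c₀ * gain (f s) e) (f₀ e) t := by
    rw [mildMap, clamp_eq (Ioo_subset_Icc_self ht)]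
  rw [h2]
  refine h1.congr_of_eventuallyEq ?_
  filter_upwards [isOpen_Ioo.mem_nhds ht] with s hs
  rw [mildMap, clamp_eq (Ioo_subset_Icc_self hs)]

end

/-- Contraction in an exponentially weighted norm: if `F` and `G` solve the linear equations with
coefficients taken from `f` and `g`, their distance is at most `ρ < 1` times that of `f` and `g`.
The masses of `f` are either bounded below or all zero. -/
lemma exists_contract {γ : ℝ} (hγ : 3 < γ) (R : ℝ) {S : Set ℝ}
    (hS : (∀ M ∈ S, M = 0) ∨ ∃ m₀ : ℝ, 0 < m₀ ∧ ∀ M ∈ S, m₀ ≤ M) :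
    ∃ β Λ ρ : ℝ, 5 / 2 < β ∧ β ≤ γ ∧ 0 ≤ Λ ∧ 0 ≤ ρ ∧ ρ < 1 ∧
      ∀ (T κ : ℝ) (f g : ℝ → ℝ → ℝ), Reg γ R f → (∀ t e, 0 ≤ f t e) → Reg γ R g →
        (∀ t ∈ Icc 0 T, mass (f t) ∈ S) → 0 ≤ κ →
        (∀ t ∈ Icc 0 T, ∀ e, |f t e - g t e| ≤ κ * Real.exp (Λ * t) * wt β e) →
        ∀ e, 0 < e → ∀ F G : ℝ → ℝ, Continuous F → Continuous G →
        (∀ t ∈ Ioo 0 T, HasDerivAt F (-(lossRate (f t) e * F t) + c₀ * gain (f t) e) t) →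
        (∀ t ∈ Ioo 0 T, HasDerivAt G (-(lossRate (g t) e * G t) + c₀ * gain (g t) e) t) →
        (∀ t, |G t| ≤ R * wt γ e) → F 0 = G 0 →
        ∀ t ∈ Icc 0 T, |F t - G t| ≤ ρ * κ * Real.exp (Λ * t) * wt β e := by
  rcases lt_or_ge R 0 with hR | hR
  · exact ⟨γ, 0, 0, by linarith, le_rfl, le_rfl, le_rfl, one_pos,
      fun T κ f g hf => absurd (hf.dec 0).nonneg (not_le.2 hR)⟩
  obtain ⟨β, hβ, hβγ, habs⟩ := exists_absorb hγ hS
  obtain ⟨C₁, hC₁, hloss⟩ := exists_lossRate_sub_le hβ hβγ R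
  obtain ⟨C₂, hC₂, hgain⟩ := exists_gain_sub_le hβ hβγ R
  have hc := c₀_pos
  have hA : 0 ≤ R * mom (wt γ) := mul_nonneg hR (mom_wt_nonneg γ)
  obtain ⟨Λ, ρ, hΛ, hρ, hρ1, hab⟩ := habs (C₁ * R + c₀ * C₂) (R * mom (wt γ)) (by positivity) hA
  refine ⟨β, Λ, ρ, hβ, hβγ, hΛ, hρ, hρ1, fun T κ f g hf f0 hg hM hκ hfg e he F G hF hG hFd hGd
    hGb h0 t ht => ?_⟩
  have hγ' : 5 / 2 < γ := by linarith
  have hw : 0 ≤ wt β e := wt_nonneg _ _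
  have key := ode_abs_le (F := fun t => F t - G t) (a := fun t => lossRate (f t) e)
    (S := fun t => -((lossRate (f t) e - lossRate (g t) e) * G t) +
      c₀ * (gain (f t) e - gain (g t) e)) (Λ := Λ) (κ := ρ * κ * wt β e) (T := T)
    (hf.continuous_lossRate hγ' e) (hF.sub hG).continuousOn
    (fun t ht => ((hFd t ht).sub (hGd t ht)).congr_deriv (by ring)) ?_
    (by simp only [h0, sub_self, abs_zero]; positivity) t ht
  · calc _ ≤ _ := key
      _ = _ := by ring
  intro s hs
  have hs' := Ioo_subset_Icc_self hs
  have hd : Dec β (κ * Real.exp (Λ * s)) (fun u => f s u - g s u) :=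
    ⟨(hf.dec s).meas.sub (hg.dec s).meas, hfg s hs'⟩
  have l1 := hloss _ _ _ (hf.dec s) (hg.dec s) hd e he
  have l2 := hgain _ _ _ (hf.dec s) (f0 s) (hg.dec s) hd e he
  have l3 := lossRate_nonneg hγ' (hf.dec s) (f0 s) e
  have l4 := le_lossRate hγ' (hf.dec s) (f0 s) he
  have l5 : mom (f s) ≤ R * mom (wt γ) := (hf.dec s).mom_le hγ'
  have l6 := hab _ (hM s hs') e he _ l3
    (le_trans (mul_le_mul_of_nonneg_left (by linarith) hc.le) l4)
  have l7 := hGb s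
  rw [wt_of_pos he] at l7 ⊢
  have hsplit : (1 + e) ^ (-γ) = (1 + e) ^ (-β) * (1 + e) ^ (-(γ - β)) := by
    rw [← Real.rpow_add (by linarith)]; congr 1; ring
  set D := κ * Real.exp (Λ * s) with hD
  have hD0 : 0 ≤ D := by positivity
  rw [hsplit] at l7 l2
  set a := (1 + e) ^ (-β) with ha
  set b := (1 + e) ^ (-(γ - β)) with hb
  have ha0 : 0 ≤ a := by positivity
  have hb0 : 0 ≤ b := by positivity
  have l8 : |(lossRate (f s) e - lossRate (g s) e) * G s| ≤
      (C₁ * D * √(1 + e)) * (R * (a * b)) := by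
    rw [abs_mul]
    exact mul_le_mul l1 l7 (abs_nonneg _) (by positivity)
  have l9 : |c₀ * (gain (f s) e - gain (g s) e)| ≤
      c₀ * (D * (2 / (β - 1) * (√e * mass (f s)) * a + C₂ * (a + √(1 + e) * (a * b)))) := by
    rw [abs_mul, abs_of_pos hc]
    exact mul_le_mul_of_nonneg_left l2 hc.le
  have l10 : 0 ≤ C₁ * R * D * a := by positivity
  calc _ ≤ |(lossRate (f s) e - lossRate (g s) e) * G s| +
        |c₀ * (gain (f s) e - gain (g s) e)| := by
        refine (abs_add_le _ _).trans ?_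
        rw [abs_neg]
    _ ≤ D * a * (c₀ * (2 / (β - 1) * (√e * mass (f s))) +
        (C₁ * R + c₀ * C₂) * (1 + √(1 + e) * b)) := by nlinarith
    _ ≤ D * a * (ρ * (Λ + lossRate (f s) e)) := by gcongr
    _ = _ := by rw [hD]; ring

/-! ### Conservation of mass and energy -/

lemma sqrt_mul_rpow {γ e : ℝ} (he : 0 < e) : √(1 + e) * (1 + e) ^ (-γ) = wt (γ - 1 / 2) e := by
  rw [wt_of_pos he, Real.sqrt_eq_rpow, ← Real.rpow_add (by linarith)]
  congr 1; ring

/-- The collision operator loses half a power of decay. -/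
lemma exists_collision_le {γ : ℝ} (hγ : 3 < γ) (K : ℝ) : ∃ C : ℝ, 0 ≤ C ∧
    ∀ h : ℝ → ℝ, Dec γ K h → ∀ e, |collision h e| ≤ C * wt (γ - 1 / 2) e := by
  rcases lt_or_ge K 0 with hK | hK
  · exact ⟨0, le_rfl, fun h hd => absurd hd.nonneg (not_le.2 hK)⟩
  have hγ' : 5 / 2 < γ := by linarith
  have hc := c₀_pos
  set A := K * mom (wt γ) with hA
  have hA0 : 0 ≤ A := mul_nonneg hK (mom_wt_nonneg γ)
  have hb := boundConst_nonneg (γ := γ) hA0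
  refine ⟨c₀ * (K * (A + boundConst γ A)) + c₀ * (2 * (A + A * A)) * K, by positivity,
    fun h hd e => ?_⟩
  rcases lt_or_ge 0 e with he | he
  · have hm : mom h ≤ A := hd.mom_le hγ'
    have hm0 := hd.mom_nonneg
    have h1 := abs_gain_le hγ hd hm he
    have h2 := abs_lossRate_le hγ' hd he
    have h3 := hd.bound e
    rw [wt_of_pos he] at h3
    rw [collision_eq hγ' hd, ← sqrt_mul_rpow he]
    have h4 : c₀ * (2 * (mom h + mom h * mom h)) * √(1 + e) ≤
        c₀ * (2 * (A + A * A)) * √(1 + e) := by gcongr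
    calc |c₀ * gain h e - lossRate h e * h e| ≤ |c₀ * gain h e| + |lossRate h e * h e| :=
          abs_sub _ _
      _ = c₀ * |gain h e| + |lossRate h e| * |h e| := by
          rw [abs_mul, abs_mul, abs_of_pos hc]
      _ ≤ c₀ * (K * (A + boundConst γ A) * (√(1 + e) * (1 + e) ^ (-γ))) +
          (c₀ * (2 * (A + A * A)) * √(1 + e)) * (K * (1 + e) ^ (-γ)) := by
          gcongr
          exact h2.trans h4
      _ = _ := by ring
  · rw [collision_of_nonpos hγ' hd he, wt_of_nonpos he]; simp

/-- The symmetric part `min {√ε₁, √ε₂, √ε₃, √ε₄}` of the kernel. -/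
def minSqrt (a b c d : ℝ) : ℝ := min (min (√a) (√b)) (min (√c) (√d))

lemma minSqrt_nonneg (a b c d : ℝ) : 0 ≤ minSqrt a b c d := by unfold minSqrt; positivity

lemma V_mul_sqrt (e : ℝ) (p : ℝ × ℝ) :
    V e p * √e = minSqrt e (p.1 + p.2 - e) p.1 p.2 := by
  rcases lt_or_ge 0 e with he | he
  · have : √e ≠ 0 := (Real.sqrt_pos.2 he).ne'
    rw [V, W, minSqrt, div_mul_cancel₀ _ this]
  · rw [V_of_nonpos he, zero_mul]
    refine (le_antisymm ?_ (minSqrt_nonneg _ _ _ _)).symm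
    refine ((min_le_left _ _).trans (min_le_left _ _)).trans (le_of_eq ?_)
    exact Real.sqrt_eq_zero_of_nonpos he

lemma pos_of_minSqrt_ne_zero {a b c d : ℝ} (h : minSqrt a b c d ≠ 0) :
    0 < a ∧ 0 < b ∧ 0 < c ∧ 0 < d := by
  have h' : 0 < minSqrt a b c d := lt_of_le_of_ne (minSqrt_nonneg _ _ _ _) h.symm
  simpa [minSqrt, and_assoc] using h'

/-- The integrand of the weak formulation, without the test function; the point `z` is
`((ε₃, ε₄), ε₁)`. -/
def weakKer (h : ℝ → ℝ) (z : (ℝ × ℝ) × ℝ) : ℝ :=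
  q (h z.2) (h (z.1.1 + z.1.2 - z.2)) (h z.1.1) (h z.1.2) *
    minSqrt z.2 (z.1.1 + z.1.2 - z.2) z.1.1 z.1.2

/-- Exchange of `ε₁` and `ε₂`. -/
def swapTwo (z : (ℝ × ℝ) × ℝ) : (ℝ × ℝ) × ℝ := (z.1, z.1.1 + z.1.2 - z.2)

/-- Exchange of the pairs `(ε₁, ε₂)` and `(ε₃, ε₄)`. -/
def swapPairs (z : (ℝ × ℝ) × ℝ) : (ℝ × ℝ) × ℝ := ((z.2, z.1.1 + z.1.2 - z.2), z.1.1)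

lemma measurePreserving_swapTwo : MeasurePreserving swapTwo := by
  refine MeasurePreserving.skew_product (f := id) (g := fun (p : ℝ × ℝ) e => p.1 + p.2 - e)
    (MeasurePreserving.id _) (by fun_prop) (ae_of_all _ fun p => ?_)
  exact (Measure.measurePreserving_sub_left volume (p.1 + p.2)).map_eq

lemma measurePreserving_swapPairs : MeasurePreserving swapPairs := by
  have h1 : ∀ x : ℝ, MeasurePreserving (fun w : ℝ × ℝ => (w.2, x + w.1 - w.2)) := fun x => by
    have a1 : MeasurePreserving (fun w : ℝ × ℝ => (w.1, x + w.2 - w.1)) := by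
      refine MeasurePreserving.skew_product (f := id) (g := fun (e : ℝ) y => x + y - e)
        (MeasurePreserving.id _) (by fun_prop) (ae_of_all _ fun e => ?_)
      have := (measurePreserving_add_left (volume : Measure ℝ) (x - e)).map_eq
      refine Eq.trans ?_ this
      congr 1; ext y; ring
    exact a1.comp Measure.measurePreserving_swap
  have h2 : MeasurePreserving (fun w : ℝ × (ℝ × ℝ) => (w.1, (w.2.2, w.1 + w.2.1 - w.2.2))) :=
    MeasurePreserving.skew_product (f := id)
      (g := fun (x : ℝ) (w : ℝ × ℝ) => (w.2, x + w.1 - w.2))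
      (MeasurePreserving.id _) (by fun_prop) (ae_of_all _ fun x => (h1 x).map_eq)
  have h3 : MeasurePreserving (MeasurableEquiv.prodAssoc : (ℝ × ℝ) × ℝ ≃ᵐ ℝ × ℝ × ℝ) :=
    measurePreserving_prodAssoc volume volume volume
  have h4 : MeasurePreserving (Prod.swap : ℝ × (ℝ × ℝ) → (ℝ × ℝ) × ℝ) :=
    Measure.measurePreserving_swap
  exact h4.comp (h2.comp h3)

lemma integral_comp_of_measurePreserving {s : (ℝ × ℝ) × ℝ → (ℝ × ℝ) × ℝ}
    (hs : MeasurePreserving s) {F : (ℝ × ℝ) × ℝ → ℝ} (hF : Measurable F) :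
    ∫ z, F (s z) = ∫ z, F z := by
  have := integral_map (μ := (volume : Measure ((ℝ × ℝ) × ℝ))) hs.measurable.aemeasurable
    hF.aestronglyMeasurable
  rw [hs.map_eq] at this
  exact this.symm

section weak

variable {γ K : ℝ} {h : ℝ → ℝ} {f : ℝ → ℝ → ℝ}

lemma measurable_weakKer (hm : Measurable h) : Measurable (weakKer h) := by
  unfold weakKer q minSqrt; fun_prop

lemma weakKer_swapTwo (h : ℝ → ℝ) (z : (ℝ × ℝ) × ℝ) : weakKer h (swapTwo z) = weakKer h z := by
  simp only [weakKer, swapTwo, q, minSqrt]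
  rw [show z.1.1 + z.1.2 - (z.1.1 + z.1.2 - z.2) = z.2 by ring,
    min_comm (√(z.1.1 + z.1.2 - z.2))]
  ring

lemma weakKer_swapPairs (h : ℝ → ℝ) (z : (ℝ × ℝ) × ℝ) :
    weakKer h (swapPairs z) = -weakKer h z := by
  simp only [weakKer, swapPairs, q, minSqrt]
  rw [show z.2 + (z.1.1 + z.1.2 - z.2) - z.1.1 = z.1.2 by ring,
    min_comm (min (√z.1.1) _)]
  ring

/-- The dominating function for the weak formulation. -/
def weakDom (γ : ℝ) (z : (ℝ × ℝ) × ℝ) : ℝ :=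
  wt γ z.1.1 * wt γ z.1.2 * minSqrt z.2 (z.1.1 + z.1.2 - z.2) z.1.1 z.1.2 *
    (2 + z.1.1 + z.1.2)

lemma integrable_weakDom (hγ : 3 < γ) : Integrable (weakDom γ) := by
  have hw := measurable_wt γ
  let B : ℝ × ℝ → ℝ := fun p => wt γ p.1 * wt γ p.2 * √(min p.1 p.2) * (2 + p.1 + p.2)
  have hBm : Measurable B := by fun_prop
  have hB0 : ∀ p, 0 ≤ B p := fun p => by
    rcases lt_or_ge 0 p.1 with h1 | h1
    · rcases lt_or_ge 0 p.2 with h2 | h2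
      · have := wt_nonneg γ p.1
        have := wt_nonneg γ p.2
        positivity
      · simp [B, wt_of_nonpos h2]
    · simp [B, wt_of_nonpos h1]
  have hBint : Integrable (fun p => B p * (p.1 + p.2)) := by
    have i1 := (integrable_wt (β := γ - 2) (by linarith)).mul_prod
      (integrable_wt (β := γ - 1 / 2) (by linarith))
    have i2 := (integrable_wt (β := γ - 1 / 2) (by linarith)).mul_prod
      (integrable_wt (β := γ - 2) (by linarith))
    refine ((i1.add i2).const_mul 2).mono' (Measurable.aestronglyMeasurable (by fun_prop))
      (ae_of_all _ fun p => ?_)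
    simp only [Pi.add_apply]
    have n1 := mul_nonneg (wt_nonneg (γ - 2) p.1) (wt_nonneg (γ - 1 / 2) p.2)
    have n2 := mul_nonneg (wt_nonneg (γ - 1 / 2) p.1) (wt_nonneg (γ - 2) p.2)
    rcases lt_or_ge 0 p.1 with h1 | h1
    · rcases lt_or_ge 0 p.2 with h2 | h2
      · have hw1 := wt_nonneg γ p.1
        have hw2 := wt_nonneg γ p.2
        rw [Real.norm_eq_abs, abs_of_nonneg (mul_nonneg (hB0 p) (by linarith)),
          ← wt_mul_rpow (σ := 2) h1, ← wt_mul_rpow (σ := 1 / 2) h2,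
          ← wt_mul_rpow (σ := 1 / 2) h1, ← wt_mul_rpow (σ := 2) h2, ← Real.sqrt_eq_rpow,
          ← Real.sqrt_eq_rpow, Real.rpow_two, Real.rpow_two]
        have s1 : √(min p.1 p.2) ≤ √(1 + p.2) :=
          Real.sqrt_le_sqrt (by linarith [min_le_right p.1 p.2])
        have s2 : √(min p.1 p.2) ≤ √(1 + p.1) :=
          Real.sqrt_le_sqrt (by linarith [min_le_left p.1 p.2])
        have s3 : (2 + p.1 + p.2) * (p.1 + p.2) ≤ 2 * (1 + p.1) ^ 2 + 2 * (1 + p.2) ^ 2 := by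
          nlinarith [sq_nonneg (p.1 - p.2)]
        have s4 : √(min p.1 p.2) * ((2 + p.1 + p.2) * (p.1 + p.2)) ≤
            2 * ((1 + p.1) ^ 2 * √(1 + p.2)) + 2 * (√(1 + p.1) * (1 + p.2) ^ 2) := by
          calc _ ≤ √(min p.1 p.2) * (2 * (1 + p.1) ^ 2 + 2 * (1 + p.2) ^ 2) := by gcongr
            _ = 2 * ((1 + p.1) ^ 2 * √(min p.1 p.2)) +
                2 * (√(min p.1 p.2) * (1 + p.2) ^ 2) := by ring
            _ ≤ _ := by gcongr
        calc B p * (p.1 + p.2) = (wt γ p.1 * wt γ p.2) *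
              (√(min p.1 p.2) * ((2 + p.1 + p.2) * (p.1 + p.2))) := by simp only [B]; ring
          _ ≤ (wt γ p.1 * wt γ p.2) *
              (2 * ((1 + p.1) ^ 2 * √(1 + p.2)) + 2 * (√(1 + p.1) * (1 + p.2) ^ 2)) := by gcongr
          _ = _ := by ring
      · simp only [B, wt_of_nonpos h2]; simp
    · simp only [B, wt_of_nonpos h1]; simp
  have hD : Integrable (fun z : (ℝ × ℝ) × ℝ =>
      B z.1 * {z : (ℝ × ℝ) × ℝ | 0 < z.2 ∧ z.2 < z.1.1 + z.1.2}.indicator 1 z) := by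
    have hS : MeasurableSet {z : (ℝ × ℝ) × ℝ | 0 < z.2 ∧ z.2 < z.1.1 + z.1.2} :=
      (measurableSet_lt measurable_const measurable_snd).inter
        (measurableSet_lt measurable_snd (by fun_prop))
    have hmeas : Measurable (fun z : (ℝ × ℝ) × ℝ =>
      B z.1 * {z : (ℝ × ℝ) × ℝ | 0 < z.2 ∧ z.2 < z.1.1 + z.1.2}.indicator (1 : (ℝ × ℝ) × ℝ → ℝ) z) :=
      (hBm.comp measurable_fst).mul (measurable_one.indicator hS)
    have hline : ∀ p : ℝ × ℝ, (fun e : ℝ =>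
        {z : (ℝ × ℝ) × ℝ | 0 < z.2 ∧ z.2 < z.1.1 + z.1.2}.indicator (1 : (ℝ × ℝ) × ℝ → ℝ) (p, e)) =
        (Ioo 0 (p.1 + p.2)).indicator 1 := fun p => rfl
    have hi : ∀ p : ℝ × ℝ, Integrable ((Ioo 0 (p.1 + p.2)).indicator (1 : ℝ → ℝ)) := fun p =>
      (integrable_indicator_iff measurableSet_Ioo).2 (integrableOn_const (by simp))
    refine (integrable_prod_iff hmeas.aestronglyMeasurable).2 ⟨ae_of_all _ fun p => ?_, ?_⟩
    · refine Integrable.const_mul ?_ (B p)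
      have := hi p
      rwa [← hline p] at this
    · refine hBint.congr (ae_of_all _ fun p => ?_)
      have e1 : ∀ e : ℝ, ‖B p * {z : (ℝ × ℝ) × ℝ | 0 < z.2 ∧ z.2 < z.1.1 + z.1.2}.indicator
          (1 : (ℝ × ℝ) × ℝ → ℝ) (p, e)‖ = B p * (Ioo 0 (p.1 + p.2)).indicator (1 : ℝ → ℝ) e := fun e => by
        rw [← hline p, Real.norm_eq_abs, abs_of_nonneg]
        exact mul_nonneg (hB0 p) (indicator_nonneg (fun _ _ => zero_le_one) _)
      simp only [e1]
      rw [integral_const_mul, integral_indicator measurableSet_Ioo]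
      rcases lt_or_ge 0 p.1 with h1 | h1
      · rcases lt_or_ge 0 p.2 with h2 | h2
        · simp [Measure.real, ENNReal.toReal_ofReal (show 0 ≤ p.1 + p.2 by linarith)]
        · simp only [B, wt_of_nonpos h2]; simp
      · simp only [B, wt_of_nonpos h1]; simp
  refine hD.mono' (Measurable.aestronglyMeasurable (by unfold weakDom minSqrt; fun_prop))
    (ae_of_all _ fun z => ?_)
  by_cases hm : minSqrt z.2 (z.1.1 + z.1.2 - z.2) z.1.1 z.1.2 = 0
  · rw [weakDom, hm]
    simp only [mul_zero, zero_mul, norm_zero]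
    exact mul_nonneg (hB0 _) (indicator_nonneg (fun _ _ => zero_le_one) _)
  · obtain ⟨p1, p2, p3, p4⟩ := pos_of_minSqrt_ne_zero hm
    have hz : z ∈ {z : (ℝ × ℝ) × ℝ | 0 < z.2 ∧ z.2 < z.1.1 + z.1.2} := ⟨p1, by linarith⟩
    rw [indicator_of_mem hz, Pi.one_apply, mul_one, Real.norm_eq_abs, abs_of_nonneg]
    · have := wt_nonneg γ z.1.1
      have := wt_nonneg γ z.1.2
      have hle : minSqrt z.2 (z.1.1 + z.1.2 - z.2) z.1.1 z.1.2 ≤ √(min z.1.1 z.1.2) := by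
        refine (min_le_right _ _).trans ?_
        rcases le_total z.1.1 z.1.2 with h | h
        · rw [min_eq_left h]; exact min_le_left _ _
        · rw [min_eq_right h]; exact min_le_right _ _
      simp only [weakDom, B]
      gcongr
    · have := wt_nonneg γ z.1.1
      have := wt_nonneg γ z.1.2
      have := minSqrt_nonneg z.2 (z.1.1 + z.1.2 - z.2) z.1.1 z.1.2
      unfold weakDom; positivity

lemma integrable_weakKer (hγ : 3 < γ) (hd : Dec γ K h) {φ : ℝ → ℝ} (hφ : Measurable φ)
    (hb : ∀ e, 0 < e → |φ e| ≤ 1 + e) : Integrable (fun z => weakKer h z * φ z.2) := by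
  have i1 := integrable_weakDom hγ
  have i2 := measurePreserving_swapPairs.integrable_comp_of_integrable i1
  have hK := hd.nonneg
  refine ((i1.add i2).const_mul ((1 + 2 * K) * (K * K))).mono'
    ((measurable_weakKer hd.meas).mul (hφ.comp measurable_snd)).aestronglyMeasurable
    (ae_of_all _ fun z => ?_)
  simp only [Pi.add_apply, Function.comp_apply]
  have e1 : weakDom γ (swapPairs z) = wt γ z.2 * wt γ (z.1.1 + z.1.2 - z.2) *
      minSqrt z.2 (z.1.1 + z.1.2 - z.2) z.1.1 z.1.2 * (2 + z.1.1 + z.1.2) := by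
    simp only [weakDom, swapPairs, minSqrt]
    rw [show z.2 + (z.1.1 + z.1.2 - z.2) - z.1.1 = z.1.2 by ring,
      min_comm (min (√z.1.1) _)]
    ring
  rw [e1, weakDom, weakKer, Real.norm_eq_abs]
  by_cases hm : minSqrt z.2 (z.1.1 + z.1.2 - z.2) z.1.1 z.1.2 = 0
  · rw [hm]; simp
  obtain ⟨p1, p2, p3, p4⟩ := pos_of_minSqrt_ne_zero hm
  have hmn := minSqrt_nonneg z.2 (z.1.1 + z.1.2 - z.2) z.1.1 z.1.2
  set m := minSqrt z.2 (z.1.1 + z.1.2 - z.2) z.1.1 z.1.2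
  set u := z.1.1 + z.1.2 - z.2 with hu
  have b := hd.bound
  have l : ∀ v, |h v| ≤ K := hd.le (by linarith)
  have w := wt_nonneg γ
  have hq : |q (h z.2) (h u) (h z.1.1) (h z.1.2)| ≤
      (1 + 2 * K) * (K * K) * (wt γ z.1.1 * wt γ z.1.2 + wt γ z.2 * wt γ u) := by
    have c1 : |h z.1.1 * h z.1.2| ≤ (K * wt γ z.1.1) * (K * wt γ z.1.2) := by
      rw [abs_mul]; exact mul_le_mul (b _) (b _) (abs_nonneg _) (mul_nonneg hK (w _))
    have c2 : |h z.2 * h u| ≤ (K * wt γ z.2) * (K * wt γ u) := by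
      rw [abs_mul]; exact mul_le_mul (b _) (b _) (abs_nonneg _) (mul_nonneg hK (w _))
    have c3 : |1 + h z.2 + h u| ≤ 1 + 2 * K :=
      (abs_add_three _ _ _).trans (by rw [abs_one]; linarith [l z.2, l u])
    have c4 : |1 + h z.1.1 + h z.1.2| ≤ 1 + 2 * K :=
      (abs_add_three _ _ _).trans (by rw [abs_one]; linarith [l z.1.1, l z.1.2])
    rw [show q (h z.2) (h u) (h z.1.1) (h z.1.2) = h z.1.1 * h z.1.2 * (1 + h z.2 + h u) -
      h z.2 * h u * (1 + h z.1.1 + h z.1.2) by unfold q; ring]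
    have w1 := w z.1.1
    have w2 := w z.1.2
    have w3 := w z.2
    have w4 := w u
    calc _ ≤ |h z.1.1 * h z.1.2| * |1 + h z.2 + h u| +
          |h z.2 * h u| * |1 + h z.1.1 + h z.1.2| := by
          rw [← abs_mul, ← abs_mul]; exact abs_sub _ _
      _ ≤ (K * wt γ z.1.1) * (K * wt γ z.1.2) * (1 + 2 * K) +
          (K * wt γ z.2) * (K * wt γ u) * (1 + 2 * K) := by gcongr
      _ = _ := by ring
  have hφ' : |φ z.2| ≤ 2 + z.1.1 + z.1.2 := (hb _ p1).trans (by linarith)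
  rw [abs_mul, abs_mul, abs_of_nonneg hmn]
  calc _ ≤ ((1 + 2 * K) * (K * K) * (wt γ z.1.1 * wt γ z.1.2 + wt γ z.2 * wt γ u)) * m *
        (2 + z.1.1 + z.1.2) := by
        have w1 := w z.1.1
        have w2 := w z.1.2
        have w3 := w z.2
        have w4 := w u
        gcongr
    _ = _ := by ring

/-- The weak formulation: by the symmetries of the kernel the collision operator is orthogonal to
`√ε` and `ε √ε`. -/
lemma integral_collision_eq_zero (hγ : 3 < γ) (hd : Dec γ K h) {A B : ℝ} (hA : 0 ≤ A) (hB : 0 ≤ B)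
    (hA1 : A ≤ 1) (hB1 : B ≤ 1) : ∫ e, collision h e * (√e * (A + B * e)) = 0 := by
  set φ : ℝ → ℝ := fun e => A + B * e with hφ
  have hφm : Measurable φ := by fun_prop
  have hφb : ∀ e, 0 < e → |φ e| ≤ 1 + e := fun e he => by
    rw [abs_of_nonneg (by positivity)]
    simp only [hφ]; nlinarith
  have hm := measurable_weakKer hd.meas
  have i1 := integrable_weakKer hγ hd hφm hφb
  have m1 : Measurable (fun z => weakKer h z * φ z.2) := hm.mul (hφm.comp measurable_snd)
  have m2 : Measurable (fun z => weakKer h z * φ (swapTwo z).2) :=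
    hm.mul (hφm.comp (measurable_snd.comp measurePreserving_swapTwo.measurable))
  have i2 : Integrable (fun z => weakKer h z * φ (swapTwo z).2) := by
    refine (measurePreserving_swapTwo.integrable_comp_of_integrable i1).congr
      (ae_of_all _ fun z => ?_)
    simp only [Function.comp_apply, weakKer_swapTwo]
  have i3 : Integrable (fun z => weakKer h z * φ z.1.1) := by
    refine (measurePreserving_swapPairs.integrable_comp_of_integrable i1).neg.congr
      (ae_of_all _ fun z => ?_)
    simp only [Pi.neg_apply, Function.comp_apply, weakKer_swapPairs, neg_mul, neg_neg]
    rfl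
  have e2' : ∀ z, φ (swapTwo (swapPairs z)).2 = φ z.1.2 := fun z => by
    simp only [swapTwo, swapPairs]; congr 1; ring
  have i4 : Integrable (fun z => weakKer h z * φ z.1.2) := by
    refine (measurePreserving_swapPairs.integrable_comp_of_integrable i2).neg.congr
      (ae_of_all _ fun z => ?_)
    simp only [Pi.neg_apply, Function.comp_apply, weakKer_swapPairs, neg_mul, neg_neg, e2']
  have e2 : ∫ z, weakKer h z * φ (swapTwo z).2 = ∫ z, weakKer h z * φ z.2 := by
    rw [← integral_comp_of_measurePreserving measurePreserving_swapTwo m1]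
    simp only [weakKer_swapTwo]
  have e3 : ∫ z, weakKer h z * φ z.2 = -∫ z, weakKer h z * φ z.1.1 := by
    rw [← integral_comp_of_measurePreserving measurePreserving_swapPairs m1, ← integral_neg]
    simp only [weakKer_swapPairs, neg_mul]
    rfl
  have e4 : ∫ z, weakKer h z * φ (swapTwo z).2 = -∫ z, weakKer h z * φ z.1.2 := by
    rw [← integral_comp_of_measurePreserving measurePreserving_swapPairs m2, ← integral_neg]
    simp only [weakKer_swapPairs, neg_mul, e2']
  have i12 : Integrable (fun z => weakKer h z * φ z.2 + weakKer h z * φ (swapTwo z).2) := i1.add i2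
  have i34 : Integrable (fun z => weakKer h z * φ z.1.1 + weakKer h z * φ z.1.2) := i3.add i4
  have e5 : (∫ z, weakKer h z * φ z.2) + (∫ z, weakKer h z * φ (swapTwo z).2) -
      ((∫ z, weakKer h z * φ z.1.1) + ∫ z, weakKer h z * φ z.1.2) = 0 := by
    rw [← integral_add i1 i2, ← integral_add i3 i4, ← integral_sub i12 i34]
    refine integral_eq_zero_of_ae (ae_of_all _ fun z => ?_)
    simp only [hφ, swapTwo, Pi.zero_apply]; ring
  have e6 : ∫ z, weakKer h z * φ z.2 = 0 := by linarith
  have e7 : ∫ z, weakKer h z * φ z.2 = ∫ e, ∫ p : ℝ × ℝ, weakKer h (p, e) * φ e :=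
    integral_prod_symm _ i1
  rw [e6] at e7
  rw [← mul_zero c₀, e7, ← integral_const_mul]
  refine integral_congr_ae (ae_of_all _ fun e => ?_)
  simp only
  rw [collision_eq_integral (by linarith) hd, mul_assoc, ← integral_mul_const]
  congr 2; ext p
  rw [weakKer, ← V_mul_sqrt]
  ring

end weak

/-! ### Regular solutions -/

/-- A nonnegative solution on `[0, T]` of the integrated Nordheim equation, everywhere in energy.
Outside `[0, T]` the values of `f` carry no information. -/
structure IsSol (γ K T : ℝ) (f₀ : ℝ → ℝ) (f : ℝ → ℝ → ℝ) : Prop where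
  reg : Reg γ K f
  nonneg : ∀ t e, 0 ≤ f t e
  init : ∀ e, f 0 e = f₀ e
  eq : ∀ t ∈ Icc 0 T, ∀ e, f t e = f₀ e + ∫ s in (0 : ℝ)..t, collision (f s) e

section sol

variable {γ K T : ℝ} {f₀ : ℝ → ℝ} {f : ℝ → ℝ → ℝ}

lemma IsSol.hasDerivAt (hγ : 3 < γ) (hf : IsSol γ K T f₀ f) {t : ℝ} (ht : t ∈ Ioo 0 T) (e : ℝ) :
    HasDerivAt (fun t => f t e) (collision (f t) e) t := by
  have h1 := (hasDerivAt_primitive (hf.reg.continuous_collision (by linarith) e) t).const_add (f₀ e)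
  refine h1.congr_of_eventuallyEq ?_
  filter_upwards [isOpen_Ioo.mem_nhds ht] with s hs
  exact hf.eq s (Ioo_subset_Icc_self hs) e

lemma IsSol.hasDerivAt' (hγ : 3 < γ) (hf : IsSol γ K T f₀ f) {t : ℝ} (ht : t ∈ Ioo 0 T) (e : ℝ) :
    HasDerivAt (fun t => f t e) (-(lossRate (f t) e * f t e) + c₀ * gain (f t) e) t := by
  refine (hf.hasDerivAt hγ ht e).congr_deriv ?_
  rw [collision_eq (by linarith) (hf.reg.dec t)]; ring

lemma Reg.eq_integral (hγ : 3 < γ) (hf : Reg γ K f) (e : ℝ)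
    (hd : ∀ t ∈ Ioo 0 T, HasDerivAt (fun t => f t e)
      (-(lossRate (f t) e * f t e) + c₀ * gain (f t) e) t) :
    ∀ t ∈ Icc 0 T, f t e = f 0 e + ∫ s in (0 : ℝ)..t, collision (f s) e := by
  intro t ht
  have := intervalIntegral.integral_eq_sub_of_hasDerivAt_of_le ht.1
    (f := fun t => f t e) (f' := fun s => collision (f s) e) (hf.cont e).continuousOn
    (fun s hs => (hd s ⟨hs.1, hs.2.trans_le ht.2⟩).congr_deriv
      (by rw [collision_eq (by linarith) (hf.dec s)]; ring))
    ((hf.continuous_collision (by linarith) e).intervalIntegrable _ _)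
  rw [this]; ring

/-- Conservation of the moments with weight `√ε (A + B ε)`. -/
lemma IsSol.conserved (hγ : 3 < γ) (hf : IsSol γ K T f₀ f) {A B : ℝ} (hA : 0 ≤ A) (hB : 0 ≤ B)
    (hA1 : A ≤ 1) (hB1 : B ≤ 1) {t : ℝ} (ht : t ∈ Icc 0 T) :
    ∫ e, f t e * (√e * (A + B * e)) = ∫ e, f₀ e * (√e * (A + B * e)) := by
  obtain ⟨C, hC, hcoll⟩ := exists_collision_le hγ K
  have hγ' : 5 / 2 < γ := by linarith
  set φ : ℝ → ℝ := fun e => √e * (A + B * e) with hφ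
  have hφm : Measurable φ := by fun_prop
  have hφb : ∀ e, 0 < e → |φ e| ≤ mw e := fun e he => by
    rw [abs_of_nonneg (by positivity)]
    have h1 : √e ≤ √(1 + e) := Real.sqrt_le_sqrt (by linarith)
    have h2 : A + B * e ≤ 1 + e := by nlinarith
    simp only [hφ, mw]
    rw [mul_comm]
    exact mul_le_mul h2 h1 (Real.sqrt_nonneg _) (by linarith)
  have e0 : f₀ = f 0 := funext fun e => (hf.init e).symm
  have i0 : Integrable (fun e => f₀ e * φ e) := by
    rw [e0]; exact (hf.reg.dec 0).integrable_mul hγ' hφm hφb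
  have hu : Measurable (Function.uncurry fun s e => collision (f s) e) :=
    measurable_uncurry (hf.reg.continuous_collision hγ')
      fun s => (hf.reg.dec s).measurable_collision hγ'
  have hpt : ∀ e, f t e * φ e = f₀ e * φ e + ∫ s in Ioc 0 t, collision (f s) e * φ e := by
    intro e
    rw [hf.eq t ht e, add_mul, intervalIntegral.integral_of_le ht.1, integral_mul_const]
  have hint : Integrable (Function.uncurry fun (e s : ℝ) => collision (f s) e * φ e)
      (volume.prod (volume.restrict (Ioc 0 t))) := by
    have j1 : Integrable (fun z : ℝ × ℝ => (C * wt (γ - 2) z.1) * (1 : ℝ))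
        (volume.prod (volume.restrict (Ioc 0 t))) :=
      ((integrable_wt (by linarith)).const_mul C).mul_prod (integrable_const (1 : ℝ))
    refine j1.mono' ?_ (ae_of_all _ fun z => ?_)
    · exact ((hu.comp measurable_swap).mul (hφm.comp measurable_fst)).aestronglyMeasurable
    · simp only [Function.uncurry, mul_one]
      rw [Real.norm_eq_abs, abs_mul]
      have h1 := hcoll _ (hf.reg.dec z.2) z.1
      rcases lt_or_ge 0 z.1 with hz | hz
      · calc |collision (f z.2) z.1| * |φ z.1| ≤ (C * wt (γ - 1 / 2) z.1) * mw z.1 :=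
              mul_le_mul h1 (hφb _ hz) (abs_nonneg _) (mul_nonneg hC (wt_nonneg _ _))
          _ = C * wt (γ - 2) z.1 := by
              rw [mw_eq_rpow hz, mul_assoc, wt_mul_rpow hz]; congr 2; ring
      · rw [collision_of_nonpos hγ' (hf.reg.dec _) hz, wt_of_nonpos hz]; simp
  have h1 : ∫ e, ∫ s in Ioc 0 t, collision (f s) e * φ e = 0 := by
    rw [integral_integral_swap hint]
    refine integral_eq_zero_of_ae (ae_of_all _ fun s => ?_)
    exact integral_collision_eq_zero hγ (hf.reg.dec s) hA hB hA1 hB1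
  change ∫ e, f t e * φ e = ∫ e, f₀ e * φ e
  simp_rw [hpt]
  have i1 : Integrable (fun e => ∫ s in Ioc 0 t, collision (f s) e * φ e) := hint.integral_prod_left
  rw [integral_add i0 i1, h1, add_zero]

lemma IsSol.mass_eq (hγ : 3 < γ) (hf : IsSol γ K T f₀ f) {t : ℝ} (ht : t ∈ Icc 0 T) :
    mass (f t) = mass f₀ := by
  simpa [mass] using hf.conserved hγ (A := 1) (B := 0) zero_le_one le_rfl le_rfl zero_le_one ht

end sol

/-! ### Uniqueness -/

section unique

variable {γ K K' T : ℝ} {f₀ : ℝ → ℝ} {f g : ℝ → ℝ → ℝ}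

/-- Uniqueness of a nonnegative solution `f` among all, possibly signed, decaying profiles `g`. At
each energy `g` either solves the equation or equals `f`. -/
lemma IsSol.unique_of_forall (hγ : 3 < γ) (hf : IsSol γ K T f₀ f) (hg : Reg γ K' g)
    (hd : ∀ e, 0 < e → (∀ t, g t e = f t e) ∨ (g 0 e = f₀ e ∧
      ∀ t ∈ Ioo 0 T, HasDerivAt (fun t => g t e)
        (-(lossRate (g t) e * g t e) + c₀ * gain (g t) e) t)) :
    ∀ t ∈ Icc 0 T, ∀ e, g t e = f t e := by
  have hf' : Reg γ (max K K') f := ⟨fun t => (hf.reg.dec t).mono (le_max_left _ _), hf.reg.cont⟩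
  have hg' : Reg γ (max K K') g := ⟨fun t => (hg.dec t).mono (le_max_right _ _), hg.cont⟩
  set R := max K K' with hR
  have hR0 : 0 ≤ R := (hf'.dec 0).nonneg
  have hS : (∀ M ∈ ({mass f₀} : Set ℝ), M = 0) ∨
      ∃ m₀ : ℝ, 0 < m₀ ∧ ∀ M ∈ ({mass f₀} : Set ℝ), m₀ ≤ M := by
    have e0 : f₀ = f 0 := funext fun e => (hf.init e).symm
    have hn : 0 ≤ mass f₀ := by rw [e0]; exact mass_nonneg (hf.nonneg 0)
    rcases hn.eq_or_lt with h | h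
    · exact Or.inl fun M hM => by rw [hM, ← h]
    · exact Or.inr ⟨mass f₀, h, fun M hM => by rw [hM]⟩
  obtain ⟨β, Λ, ρ, hβ, hβγ, hΛ, hρ, hρ1, hc⟩ := exists_contract hγ R hS
  have hiter : ∀ n : ℕ, ∀ t ∈ Icc 0 T, ∀ e, |f t e - g t e| ≤
      ρ ^ n * (2 * R) * Real.exp (Λ * t) * wt β e := by
    intro n
    induction n with
    | zero =>
      intro t ht e
      have h1 := ((hf'.dec t).anti hβγ).bound e
      have h2 := ((hg'.dec t).anti hβγ).bound e
      have h3 : 1 ≤ Real.exp (Λ * t) := Real.one_le_exp (mul_nonneg hΛ ht.1)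
      have h4 := wt_nonneg β e
      calc |f t e - g t e| ≤ |f t e| + |g t e| := abs_sub _ _
        _ ≤ (2 * R) * 1 * wt β e := by linarith
        _ ≤ (2 * R) * Real.exp (Λ * t) * wt β e := by gcongr
        _ = _ := by ring
    | succ n ih =>
      intro t ht e
      rcases lt_or_ge 0 e with he | he
      · rcases hd e he with heq | ⟨h0, hd⟩
        · rw [heq, sub_self, abs_zero]
          have := wt_nonneg β e
          positivity
        have := hc T (ρ ^ n * (2 * R)) f g hf' hf.nonneg hg' (fun t ht => hf.mass_eq hγ ht)
          (by positivity) ih e he (fun t => f t e) (fun t => g t e) (hf'.cont e) (hg'.cont e)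
          (fun t ht => hf.hasDerivAt' hγ ht e) hd (fun t => (hg'.dec t).bound e)
          (by simp only [hf.init, h0]) t ht
        rw [pow_succ]
        calc _ ≤ _ := this
          _ = _ := by ring
      · rw [(hf'.dec t).zero he, (hg'.dec t).zero he, wt_of_nonpos he]; simp
  intro t ht e
  have hlim : Tendsto (fun n : ℕ => ρ ^ n * (2 * R) * Real.exp (Λ * t) * wt β e) atTop
      (𝓝 (0 * (2 * R) * Real.exp (Λ * t) * wt β e)) :=
    (((tendsto_pow_atTop_nhds_zero_of_lt_one hρ hρ1).mul_const _).mul_const _).mul_const _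
  have := ge_of_tendsto' hlim fun n => hiter n t ht e
  rw [zero_mul, zero_mul, zero_mul] at this
  exact (sub_eq_zero.1 (abs_eq_zero.1 (le_antisymm this (abs_nonneg _)))).symm

lemma IsSol.unique (hγ : 3 < γ) (hf : IsSol γ K T f₀ f) (hg : IsSol γ K' T f₀ g) :
    ∀ t ∈ Icc 0 T, ∀ e, g t e = f t e :=
  hf.unique_of_forall hγ hg.reg fun e _ =>
    Or.inr ⟨hg.init e, fun _ ht => hg.hasDerivAt' hγ ht e⟩

/-- A property of almost all positive energies holds at the three energies of the kernel, for almost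
all `ε₄`, wherever the kernel does not vanish. -/
lemma ae_energies {P : ℝ → Prop} (h : ∀ᵐ u ∂halfLine, P u) (e : ℝ) :
    ∀ᵐ x : ℝ, ∀ᵐ y : ℝ, W e (x + y - e) x y ≠ 0 → P x ∧ P y ∧ P (x + y - e) := by
  have h' : ∀ᵐ u : ℝ, u ∈ Ioi (0 : ℝ) → P u := (ae_restrict_iff' measurableSet_Ioi).1 h
  filter_upwards [h'] with x hx
  have h2 : ∀ᵐ y : ℝ, (x - e) + y ∈ Ioi (0 : ℝ) → P ((x - e) + y) :=
    (measurePreserving_add_left volume (x - e)).quasiMeasurePreserving.ae h'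
  filter_upwards [h', h2] with y hy hy2 hW
  obtain ⟨-, p1, p2, p3⟩ := pos_of_V_ne_zero (e := e) (p := (x, y)) hW
  simp only at p1 p2 p3
  refine ⟨hx p1, hy p2, ?_⟩
  rw [show x + y - e = (x - e) + y by ring]
  exact hy2 (by simp only [mem_Ioi]; linarith)

lemma lossRate_congr {g h : ℝ → ℝ} (hgh : g =ᵐ[halfLine] h) (e : ℝ) :
    lossRate g e = lossRate h e := by
  unfold lossRate
  congr 1
  refine integral_congr_ae (ae_restrict_of_ae ?_)
  filter_upwards [ae_energies (P := fun u => g u = h u) hgh e] with x hx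
  refine integral_congr_ae (ae_restrict_of_ae ?_)
  filter_upwards [hx] with y hy
  by_cases hW : W e (x + y - e) x y = 0
  · simp only [hW, mul_zero]
  · obtain ⟨h1, h2, h3⟩ := hy hW
    simp only [h1, h2, h3]

lemma gain_congr {g h : ℝ → ℝ} (hgh : g =ᵐ[halfLine] h) {e : ℝ} (he : g e = h e) :
    gain g e = gain h e := by
  unfold gain
  refine integral_congr_ae (ae_restrict_of_ae ?_)
  filter_upwards [ae_energies (P := fun u => g u = h u) hgh e] with x hx
  refine integral_congr_ae (ae_restrict_of_ae ?_)
  filter_upwards [hx] with y hy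
  by_cases hW : W e (x + y - e) x y = 0
  · simp only [hW, mul_zero]
  · obtain ⟨h1, h2, h3⟩ := hy hW
    simp only [h1, h2, h3, he]

/-- Uniqueness when the competitor solves the equation at almost every energy only. -/
lemma IsSol.unique_of_ae (hγ : 3 < γ) (hf : IsSol γ K T f₀ f) (hg : Reg γ K' g)
    (hd : ∀ᵐ e ∂halfLine, g 0 e = f₀ e ∧ ∀ t ∈ Ioo 0 T, HasDerivAt (fun t => g t e)
      (-(lossRate (g t) e * g t e) + c₀ * gain (g t) e) t) :
    ∀ᵐ e ∂halfLine, ∀ t ∈ Icc 0 T, g t e = f t e := by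
  classical
  obtain ⟨N, hNsub, hNm, hN0⟩ := exists_measurable_superset_of_null (ae_iff.1 hd)
  set g' : ℝ → ℝ → ℝ := fun t e => if e ∈ N ∨ e ≤ 0 then f t e else g t e with hg'
  have hS : MeasurableSet {e | e ∈ N ∨ e ≤ 0} := hNm.union measurableSet_Iic
  have hgood : ∀ e, ¬ (e ∈ N ∨ e ≤ 0) → g 0 e = f₀ e ∧ ∀ t ∈ Ioo 0 T,
      HasDerivAt (fun t => g t e) (-(lossRate (g t) e * g t e) + c₀ * gain (g t) e) t := by
    intro e he
    by_contra hcon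
    exact he (Or.inl (hNsub hcon))
  have hae : ∀ᵐ e ∂halfLine, ¬ (e ∈ N ∨ e ≤ 0) := by
    have h1 : ∀ᵐ e ∂halfLine, e ∉ N := measure_eq_zero_iff_ae_notMem.1 hN0
    have h2 : ∀ᵐ e ∂halfLine, e ∈ Ioi (0 : ℝ) := ae_restrict_mem measurableSet_Ioi
    filter_upwards [h1, h2] with e he1 he2
    rintro (h | h)
    · exact he1 h
    · exact absurd (mem_Ioi.1 he2) (not_lt.2 h)
  have heq : ∀ t, g' t =ᵐ[halfLine] g t := fun t => by
    filter_upwards [hae] with e he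
    simp only [hg', if_neg he]
  have hreg : Reg γ (max K K') g' := by
    refine ⟨fun t => ⟨Measurable.ite hS (hf.reg.dec t).meas (hg.dec t).meas, fun e => ?_⟩,
      fun e => ?_⟩
    · simp only [hg']
      split_ifs
      · exact ((hf.reg.dec t).mono (le_max_left _ _)).bound e
      · exact ((hg.dec t).mono (le_max_right _ _)).bound e
    · by_cases he : e ∈ N ∨ e ≤ 0
      · simp only [hg', if_pos he]; exact hf.reg.cont e
      · simp only [hg', if_neg he]; exact hg.cont e
  have hun := hf.unique_of_forall hγ hreg fun e _ => by
    by_cases he : e ∈ N ∨ e ≤ 0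
    · exact Or.inl fun t => by simp only [hg', if_pos he]
    · refine Or.inr ⟨by simpa only [hg', if_neg he] using (hgood e he).1, fun t ht => ?_⟩
      have h1 := (hgood e he).2 t ht
      have h2 : g' t e = g t e := by simp only [hg', if_neg he]
      rw [lossRate_congr (heq t) e, gain_congr (heq t) h2, h2]
      simpa only [hg', if_neg he] using h1
  filter_upwards [hae] with e he t ht
  have := hun t ht e
  simpa only [hg', if_neg he] using this

end unique

/-! ### Local existence -/

section mass

variable {β K : ℝ} {h k : ℝ → ℝ}

lemma mass_mono (hβ : 5 / 2 < β) (hh : Dec β K h) (hk : Dec β K k) (hle : ∀ u, h u ≤ k u) :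
    mass h ≤ mass k :=
  integral_mono (hh.integrable_sqrt hβ) (hk.integrable_sqrt hβ) fun u =>
    mul_le_mul_of_nonneg_right (hle u) (Real.sqrt_nonneg u)

lemma ae_eq_zero_of_mass (hβ : 5 / 2 < β) (hh : Dec β K h) (h0 : ∀ u, 0 ≤ h u)
    (hm : mass h = 0) : h =ᵐ[volume] 0 := by
  have h1 := (integral_eq_zero_iff_of_nonneg
    (fun u => mul_nonneg (h0 u) (Real.sqrt_nonneg u)) (hh.integrable_sqrt hβ)).1 hm
  filter_upwards [h1] with u hu
  rcases lt_or_ge 0 u with hp | hp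
  · exact (mul_eq_zero.1 hu).resolve_right (Real.sqrt_pos.2 hp).ne'
  · exact hh.zero hp

lemma mom_of_ae_eq_zero (h0 : h =ᵐ[volume] 0) : mom h = 0 := by
  refine integral_eq_zero_of_ae ?_
  filter_upwards [h0] with u hu
  simp [hu]

lemma mass_of_ae_eq_zero (h0 : h =ᵐ[volume] 0) : mass h = 0 := by
  refine integral_eq_zero_of_ae ?_
  filter_upwards [h0] with u hu
  simp [hu]

lemma collision_eq_zero_of_mom (hβ : 5 / 2 < β) (hh : Dec β K h) (hm : mom h = 0) (e : ℝ) :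
    collision h e = 0 := by
  rcases lt_or_ge 0 e with he | he
  · have h1 := abs_gainTwo_le hβ hh e
    have h2 := abs_lossRate_le hβ hh he
    have h3 := integral_triple_le hβ hh hh hh he
    change |gainThree h e| ≤ _ at h3
    simp only [hm, mul_zero, zero_mul, add_zero, abs_nonpos_iff] at h1 h2 h3
    rw [collision_eq hβ hh, gain_eq hβ hh, h1, h2, h3]
    simp
  · exact collision_of_nonpos hβ hh he

end mass

/-- Initial data without mass are stationary. -/
lemma isSol_const {γ K : ℝ} (hγ : 5 / 2 < γ) {f₀ : ℝ → ℝ} (hd : Dec γ K f₀) (h0 : ∀ u, 0 ≤ f₀ u)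
    (hm : mass f₀ = 0) (T : ℝ) : IsSol γ K T f₀ fun _ => f₀ where
  reg := ⟨fun _ => hd, fun _ => continuous_const⟩
  nonneg := fun _ => h0
  init := fun _ => rfl
  eq := fun t _ e => by
    simp [collision_eq_zero_of_mom hγ hd (mom_of_ae_eq_zero (ae_eq_zero_of_mass hγ hd h0 hm))]

/-- The set of profiles on which the mild map is iterated. The upper bound, valid on `[0, T]`, is
reproduced because the gain is dominated by the loss at high energies; the lower bound keeps the mass
away from `0`. -/
structure IterSet (γ B L α T : ℝ) (f₀ : ℝ → ℝ) (f : ℝ → ℝ → ℝ) : Prop where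
  reg : Reg γ (2 * B) f
  nonneg : ∀ t e, 0 ≤ f t e
  init : ∀ e, f 0 e = f₀ e
  upper : ∀ t ∈ Icc 0 T, ∀ e, f t e ≤ B * Real.exp (L * t) * wt γ e
  lower : ∀ t ∈ Icc 0 T, ∀ e, f₀ e * Real.exp (-(α * √(1 + e) * T)) ≤ f t e
  freeze : ∀ t e, f (max 0 (min t T)) e = f t e

/-- The bound for the moments of profiles in `IterSet`. -/
def momBound (γ B : ℝ) : ℝ := 2 * B * mom (wt γ)

/-- The growth rate in `IterSet`. -/
def growth (γ B : ℝ) : ℝ := c₀ * (boundConst γ (momBound γ B) + momBound γ B)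

/-- The constant of the lower bound in `IterSet`. -/
def decayRate (γ B : ℝ) : ℝ := c₀ * (2 * (momBound γ B + momBound γ B * momBound γ B))

section iter

variable {γ B T : ℝ} {f₀ : ℝ → ℝ} {f : ℝ → ℝ → ℝ}

lemma momBound_nonneg (hB : 0 ≤ B) : 0 ≤ momBound γ B := by
  have := mom_wt_nonneg γ
  unfold momBound; positivity

lemma growth_nonneg (hB : 0 ≤ B) : 0 ≤ growth γ B := by
  have := momBound_nonneg (γ := γ) hB
  have := boundConst_nonneg (γ := γ) this
  have := c₀_pos
  unfold growth; positivity

lemma decayRate_nonneg (hB : 0 ≤ B) : 0 ≤ decayRate γ B := by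
  have := momBound_nonneg (γ := γ) hB
  have := c₀_pos
  unfold decayRate; positivity

lemma iterSet_const (hB : 0 ≤ B) (hT : 0 ≤ T) (hd : Dec γ B f₀) (h0 : ∀ u, 0 ≤ f₀ u) :
    IterSet γ B (growth γ B) (decayRate γ B) T f₀ fun _ => f₀ where
  reg := ⟨fun _ => hd.mono (by linarith), fun _ => continuous_const⟩
  nonneg := fun _ => h0
  init := fun _ => rfl
  upper := fun t ht e => by
    have h1 := (le_abs_self _).trans (hd.bound e)
    have h2 : 1 ≤ Real.exp (growth γ B * t) :=
      Real.one_le_exp (mul_nonneg (growth_nonneg hB) ht.1)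
    have h3 := wt_nonneg γ e
    calc f₀ e ≤ B * 1 * wt γ e := by linarith
      _ ≤ _ := by gcongr
  lower := fun t ht e => by
    have h1 := decayRate_nonneg (γ := γ) hB
    refine mul_le_of_le_one_right (h0 e) (Real.exp_le_one_iff.2 ?_)
    have : 0 ≤ decayRate γ B * √(1 + e) * T := by positivity
    linarith
  freeze := fun _ _ => rfl

/-- The lower bound holds because the gain is nonnegative and the loss rate is at most `α √(1+ε)`. -/
lemma IterSet.mildMap (hγ : 3 < γ) (hB : 0 ≤ B) (hT : 0 ≤ T)
    (hTL : Real.exp (growth γ B * T) ≤ 2) (hd : Dec γ B f₀) (h0 : ∀ u, 0 ≤ f₀ u)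
    (hf : IterSet γ B (growth γ B) (decayRate γ B) T f₀ f) :
    IterSet γ B (growth γ B) (decayRate γ B) T f₀ (mildMap T f₀ f) := by
  have hγ' : 5 / 2 < γ := by linarith
  have hc := c₀_pos
  set A := momBound γ B with hA
  have hA0 : 0 ≤ A := momBound_nonneg hB
  set L := growth γ B with hL
  have hL0 : 0 ≤ L := growth_nonneg hB
  set α := decayRate γ B with hα
  have hα0 : 0 ≤ α := decayRate_nonneg hB
  have hmom : ∀ t, mom (f t) ≤ A := fun t => (hf.reg.dec t).mom_le hγ'
  have hupper : ∀ t ∈ Icc 0 T, ∀ e, 0 < e →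
      |Nordheim.mildMap T f₀ f t e| ≤ B * wt γ e * Real.exp (L * t) := by
    intro t ht e he
    refine ode_abs_le (a := fun t => lossRate (f t) e) (S := fun t => c₀ * gain (f t) e)
      (hf.reg.continuous_lossRate hγ' e)
      (continuous_mildMap hγ' hf.reg e).continuousOn
      (fun t ht => hasDerivAt_mildMap hγ' hf.reg e ht) (fun s hs => ?_) ?_ t ht
    · have hs' := Ioo_subset_Icc_self hs
      have hds : Dec γ (B * Real.exp (L * s)) (f s) :=
        ⟨(hf.reg.dec s).meas, fun e => by
          rw [abs_of_nonneg (hf.nonneg s e)]; exact hf.upper s hs' e⟩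
      have g1 := gain_le hγ' hds (hf.nonneg s) (hmom s) he
      have g2 := gain_nonneg hγ' hds (hf.nonneg s) e
      have g3 := le_lossRate hγ' (hf.reg.dec s) (hf.nonneg s) he
      have g4 : 2 / (γ - 1) * (√e * mass (f s)) ≤ √e * mass (f s) :=
        mul_le_of_le_one_left (mul_nonneg (Real.sqrt_nonneg _) (mass_nonneg (hf.nonneg s)))
          (by rw [div_le_one (by linarith)]; linarith)
      -- as `2 / (γ - 1) < 1`, the loss rate absorbs the growing part of the gain
      have g5 : c₀ * (2 / (γ - 1) * (√e * mass (f s)) + boundConst γ A) ≤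
          L + lossRate (f s) e := by
        have : c₀ * (√e * mass (f s) - A) ≤ c₀ * (√e * mass (f s) - mom (f s)) :=
          mul_le_mul_of_nonneg_left (by linarith [hmom s]) hc.le
        have h7 := mul_le_mul_of_nonneg_left g4 hc.le
        rw [hL, growth]
        linarith
      rw [abs_of_nonneg (mul_nonneg hc.le g2), wt_of_pos he]
      calc c₀ * gain (f s) e ≤ c₀ * (B * Real.exp (L * s) * (1 + e) ^ (-γ) *
            (2 / (γ - 1) * (√e * mass (f s)) + boundConst γ A)) := by gcongr
        _ = (c₀ * (2 / (γ - 1) * (√e * mass (f s)) + boundConst γ A)) *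
            (B * (1 + e) ^ (-γ) * Real.exp (L * s)) := by ring
        _ ≤ _ := by gcongr
    · rw [mildMap_zero hT]; exact hd.bound e
  have hlower : ∀ t ∈ Icc 0 T, ∀ e, 0 < e →
      f₀ e * Real.exp (-(α * √(1 + e) * T)) ≤ Nordheim.mildMap T f₀ f t e := by
    intro t ht e he
    have h1 := ode_lower (F := fun t => Nordheim.mildMap T f₀ f t e)
      (a := fun t => lossRate (f t) e) (S := fun t => c₀ * gain (f t) e)
      (α := α * √(1 + e)) (hf.reg.continuous_lossRate hγ' e)
      (continuous_mildMap hγ' hf.reg e).continuousOn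
      (fun t ht => hasDerivAt_mildMap hγ' hf.reg e ht) (fun s hs => ?_) (fun s hs => ?_)
      (by rw [mildMap_zero hT]; exact h0 e) t ht
    · rw [mildMap_zero hT] at h1
      refine le_trans (mul_le_mul_of_nonneg_left (Real.exp_le_exp.2 ?_) (h0 e)) h1
      have : α * √(1 + e) * t ≤ α * √(1 + e) * T :=
        mul_le_mul_of_nonneg_left ht.2 (by positivity)
      linarith
    · refine ((le_abs_self _).trans (abs_lossRate_le hγ' (hf.reg.dec s) he)).trans ?_
      have := hmom s
      have := (hf.reg.dec s).mom_nonneg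
      rw [hα, decayRate, ← hA]
      gcongr
    · exact mul_nonneg hc.le (gain_nonneg hγ' (hf.reg.dec s) (hf.nonneg s) e)
  have hnn : ∀ t e, 0 ≤ Nordheim.mildMap T f₀ f t e := by
    intro t e
    rcases lt_or_ge 0 e with he | he
    · rw [← mildMap_clamp hT]
      exact (mul_nonneg (h0 e) (Real.exp_pos _).le).trans (hlower _ (clamp_mem hT t) e he)
    · rw [mildMap_of_nonpos he]; exact h0 e
  refine ⟨⟨fun t => ⟨measurable_mildMap hγ' hf.reg hd.meas t, fun e => ?_⟩,
    continuous_mildMap hγ' hf.reg⟩, hnn, mildMap_zero hT, fun t ht e => ?_, fun t ht e => ?_,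
    mildMap_clamp hT⟩
  · rcases lt_or_ge 0 e with he | he
    · rw [← mildMap_clamp hT]
      have hmem := clamp_mem hT t
      refine (hupper _ hmem e he).trans ?_
      have h1 : Real.exp (L * max 0 (min t T)) ≤ 2 :=
        le_trans (Real.exp_le_exp.2 (mul_le_mul_of_nonneg_left hmem.2 hL0)) hTL
      have h2 := wt_nonneg γ e
      calc _ ≤ B * wt γ e * 2 := by gcongr
        _ = _ := by ring
    · rw [mildMap_of_nonpos he, hd.zero he, wt_of_nonpos he]; simp
  · rcases lt_or_ge 0 e with he | he
    · refine (le_abs_self _).trans ((hupper t ht e he).trans (le_of_eq (by ring)))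
    · rw [mildMap_of_nonpos he, hd.zero he, wt_of_nonpos he]; simp
  · rcases lt_or_ge 0 e with he | he
    · exact hlower t ht e he
    · rw [mildMap_of_nonpos he, hd.zero he]; simp

/-- Solutions exist up to a time depending only on `γ` and the size `B` of the initial datum. -/
lemma exists_isSol_of_exp_le (hγ : 3 < γ) (hB : 0 ≤ B) (hT : 0 ≤ T)
    (hTL : Real.exp (growth γ B * T) ≤ 2) (hd : Dec γ B f₀) (h0 : ∀ u, 0 ≤ f₀ u) :
    ∃ f, IsSol γ (2 * B) T f₀ f := by
  have hγ' : 5 / 2 < γ := by linarith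
  rcases (mass_nonneg h0).eq_or_lt with hm | hm
  · exact ⟨_, isSol_const hγ' (hd.mono (by linarith)) h0 hm.symm T⟩
  set α := decayRate γ B with hα
  have hα0 : 0 ≤ α := decayRate_nonneg hB
  -- a lower bound for the mass of all iterates
  set l : ℝ → ℝ := fun e => f₀ e * Real.exp (-(α * √(1 + e) * T)) with hl
  have hld : Dec γ (2 * B) l := by
    have hm := hd.meas
    refine ⟨by fun_prop, fun e => ?_⟩
    rw [hl, abs_mul, abs_of_pos (Real.exp_pos _)]
    refine (mul_le_of_le_one_right (abs_nonneg _) (Real.exp_le_one_iff.2 ?_)).trans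
      ((hd.mono (by linarith)).bound e)
    have : 0 ≤ α * √(1 + e) * T := by positivity
    linarith
  have hl0 : ∀ u, 0 ≤ l u := fun u => mul_nonneg (h0 u) (Real.exp_pos _).le
  have hlm : 0 < mass l := by
    refine lt_of_le_of_ne (mass_nonneg hl0) fun h => hm.ne ?_
    refine (mass_of_ae_eq_zero ?_).symm
    filter_upwards [ae_eq_zero_of_mass hγ' hld hl0 h.symm] with u hu
    exact (mul_eq_zero.1 hu).resolve_right (Real.exp_pos _).ne'
  obtain ⟨β, Λ, ρ, hβ, hβγ, hΛ, hρ, hρ1, hc⟩ := exists_contract hγ (2 * B) (S := Ici (mass l))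
    (Or.inr ⟨mass l, hlm, fun M hM => hM⟩)
  set φ : ℕ → ℝ → ℝ → ℝ := fun n => (mildMap T f₀)^[n] (fun _ => f₀) with hφ
  have hφs : ∀ n, φ (n + 1) = mildMap T f₀ (φ n) := fun n => by
    simp only [hφ, Function.iterate_succ_apply']
  have hφI : ∀ n, IterSet γ B (growth γ B) α T f₀ (φ n) := by
    intro n
    induction n with
    | zero => exact iterSet_const hB hT hd h0
    | succ n ih => rw [hφs]; exact ih.mildMap hγ hB hT hTL hd h0
  have hmass : ∀ n, ∀ t ∈ Icc 0 T, mass (φ n t) ∈ Ici (mass l) := fun n t ht =>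
    mass_mono hγ' hld ((hφI n).reg.dec t) ((hφI n).lower t ht)
  have hstep : ∀ n : ℕ, ∀ t ∈ Icc 0 T, ∀ e, |φ (n + 1) t e - φ n t e| ≤
      ρ ^ n * (4 * B) * Real.exp (Λ * t) * wt β e := by
    intro n
    induction n with
    | zero =>
      intro t ht e
      have h1 := (((hφI 1).reg.dec t).anti hβγ).bound e
      have h2 := (((hφI 0).reg.dec t).anti hβγ).bound e
      have h3 : 1 ≤ Real.exp (Λ * t) := Real.one_le_exp (mul_nonneg hΛ ht.1)
      have h4 := wt_nonneg β e
      calc |φ 1 t e - φ 0 t e| ≤ |φ 1 t e| + |φ 0 t e| := abs_sub _ _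
        _ ≤ (4 * B) * 1 * wt β e := by linarith
        _ ≤ (4 * B) * Real.exp (Λ * t) * wt β e := by gcongr
        _ = _ := by ring
    | succ n ih =>
      intro t ht e
      rcases lt_or_ge 0 e with he | he
      · have := hc T (ρ ^ n * (4 * B)) (φ (n + 1)) (φ n) (hφI _).reg (hφI _).nonneg (hφI n).reg
          (hmass _) (by positivity) ih e he (fun t => φ (n + 2) t e) (fun t => φ (n + 1) t e)
          ((hφI _).reg.cont e) ((hφI _).reg.cont e)
          (fun t ht => by
            rw [hφs (n + 1)]; exact hasDerivAt_mildMap hγ' (hφI (n + 1)).reg e ht)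
          (fun t ht => by
            rw [hφs n]; exact hasDerivAt_mildMap hγ' (hφI n).reg e ht)
          (fun t => ((hφI (n + 1)).reg.dec t).bound e)
          (by simp only [(hφI _).init]) t ht
        rw [pow_succ]
        calc _ ≤ _ := this
          _ = _ := by ring
      · rw [((hφI _).reg.dec t).zero he, ((hφI _).reg.dec t).zero he, wt_of_nonpos he]; simp
  -- the iterates converge geometrically, uniformly in time
  set C : ℝ → ℝ := fun e => 4 * B * Real.exp (Λ * T) * wt β e with hC
  have hC0 : ∀ e, 0 ≤ C e := fun e => by
    have := wt_nonneg β e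
    simp only [hC]; positivity
  have hgeo : ∀ t e n, dist (φ n t e) (φ (n + 1) t e) ≤ C e * ρ ^ n := by
    intro t e n
    rw [dist_comm, Real.dist_eq, ← (hφI n).freeze, ← (hφI (n + 1)).freeze]
    have hmem := clamp_mem hT t
    refine (hstep n _ hmem e).trans ?_
    have h2 := wt_nonneg β e
    calc _ ≤ ρ ^ n * (4 * B) * Real.exp (Λ * T) * wt β e := by
          have := hmem.2
          gcongr
      _ = _ := by simp only [hC]; ring
  choose f hf using fun t e => cauchySeq_tendsto_of_complete
    (cauchySeq_of_le_geometric ρ (C e) hρ1 (hgeo t e))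
  have hrate : ∀ n t e, |φ n t e - f t e| ≤ C e * ρ ^ n / (1 - ρ) := fun n t e => by
    rw [← Real.dist_eq]
    exact dist_le_of_le_geometric_of_tendsto ρ (C e) hρ1 (hgeo t e) (hf t e) n
  have hratelim : ∀ e, Tendsto (fun n : ℕ => C e * ρ ^ n / (1 - ρ)) atTop (𝓝 0) := fun e => by
    have := ((tendsto_pow_atTop_nhds_zero_of_lt_one hρ hρ1).const_mul (C e)).div_const (1 - ρ)
    simpa using this
  have hreg : Reg γ (2 * B) f := by
    refine ⟨fun t => ⟨?_, fun e => ?_⟩, fun e => ?_⟩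
    · exact measurable_of_tendsto_metrizable (fun n => ((hφI n).reg.dec t).meas)
        (tendsto_pi_nhds.2 fun e => hf t e)
    · exact le_of_tendsto' (hf t e).abs fun n => ((hφI n).reg.dec t).bound e
    · have hu : TendstoUniformly (fun n t => φ n t e) (fun t => f t e) atTop := by
        rw [Metric.tendstoUniformly_iff]
        intro ε hε
        filter_upwards [(hratelim e).eventually (gt_mem_nhds hε)] with n hn t
        rw [dist_comm, Real.dist_eq]
        exact (hrate n t e).trans_lt hn
      exact hu.continuous (Frequently.of_forall fun n => (hφI n).reg.cont e)
  have hfn : ∀ t e, 0 ≤ f t e := fun t e => ge_of_tendsto' (hf t e) fun n => (hφI n).nonneg t e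
  have hfi : ∀ e, f 0 e = f₀ e := fun e =>
    tendsto_nhds_unique (hf 0 e) (by simp only [(hφI _).init]; exact tendsto_const_nhds)
  have hfm : ∀ t ∈ Icc 0 T, mass (f t) ∈ Ici (mass l) := fun t ht =>
    mass_mono hγ' hld (hreg.dec t) fun e =>
      ge_of_tendsto' (hf t e) fun n => (hφI n).lower t ht e
  -- the limit is a fixed point
  have hfix : ∀ e, 0 < e → ∀ t ∈ Icc 0 T, mildMap T f₀ f t e = f t e := by
    intro e he t ht
    have hb : ∀ n, |mildMap T f₀ f t e - φ (n + 1) t e| ≤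
        C e * ρ ^ n / (1 - ρ) * Real.exp (Λ * T) := by
      intro n
      have h1ρ : 0 < 1 - ρ := by linarith
      have := hc T (4 * B * Real.exp (Λ * T) * ρ ^ n / (1 - ρ)) f (φ n) hreg hfn (hφI n).reg hfm
        (by positivity) (fun t ht e => ?_) e he (fun t => mildMap T f₀ f t e)
        (fun t => φ (n + 1) t e) (continuous_mildMap hγ' hreg e) ((hφI _).reg.cont e)
        (fun t ht => hasDerivAt_mildMap hγ' hreg e ht)
        (fun t ht => by
            rw [hφs n]; exact hasDerivAt_mildMap hγ' (hφI n).reg e ht)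
        (fun t => ((hφI (n + 1)).reg.dec t).bound e)
        (by simp only [(hφI _).init, mildMap_zero hT]) t ht
      · refine this.trans ?_
        have h2 := wt_nonneg β e
        have h3 := ht.2
        calc _ ≤ 1 * (4 * B * Real.exp (Λ * T) * ρ ^ n / (1 - ρ)) * Real.exp (Λ * T) *
              wt β e := by gcongr
          _ = _ := by simp only [hC]; ring
      · rw [abs_sub_comm]
        refine (hrate n t e).trans ?_
        have h3 : 1 ≤ Real.exp (Λ * t) := Real.one_le_exp (mul_nonneg hΛ ht.1)
        have h2 := wt_nonneg β e
        calc C e * ρ ^ n / (1 - ρ) =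
              (4 * B * Real.exp (Λ * T) * ρ ^ n / (1 - ρ)) * 1 * wt β e := by
              simp only [hC]; ring
          _ ≤ _ := by gcongr
    have hlim0 : Tendsto (fun n : ℕ => C e * ρ ^ n / (1 - ρ) * Real.exp (Λ * T)) atTop (𝓝 0) := by
      simpa using (hratelim e).mul_const (Real.exp (Λ * T))
    have hle := le_of_tendsto_of_tendsto'
      ((tendsto_const_nhds (x := mildMap T f₀ f t e)).sub
        ((hf t e).comp (tendsto_add_atTop_nat 1))).abs hlim0 hb
    exact sub_eq_zero.1 (abs_eq_zero.1 (le_antisymm hle (abs_nonneg _)))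
  refine ⟨f, hreg, hfn, hfi, fun t ht e => ?_⟩
  rcases lt_or_ge 0 e with he | he
  · rw [← hfi]
    refine hreg.eq_integral hγ e (fun s hs => ?_) t ht
    have h1 := hasDerivAt_mildMap (f₀ := f₀) hγ' hreg e hs
    rw [hfix e he s (Ioo_subset_Icc_self hs)] at h1
    refine h1.congr_of_eventuallyEq ?_
    filter_upwards [isOpen_Ioo.mem_nhds hs] with r hr
    exact (hfix e he r (Ioo_subset_Icc_self hr)).symm
  · rw [(hreg.dec t).zero he, hd.zero he]
    simp [fun s => collision_of_nonpos hγ' (hreg.dec s) he]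

lemma exists_time (hB : 0 ≤ B) : ∃ T : ℝ, 0 < T ∧ Real.exp (growth γ B * T) ≤ 2 := by
  have hL := growth_nonneg (γ := γ) hB
  refine ⟨Real.log 2 / (growth γ B + 1), by positivity, ?_⟩
  rw [← Real.le_log_iff_exp_le two_pos, ← mul_div_assoc, div_le_iff₀ (by linarith)]
  have := Real.log_nonneg one_le_two
  nlinarith

/-- The existence time is uniform over data with the same weighted bound; this is what allows
continuation. -/
lemma exists_local (hγ : 3 < γ) (hB : 0 ≤ B) : ∃ T : ℝ, 0 < T ∧ ∀ f₀ : ℝ → ℝ, Dec γ B f₀ →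
    (∀ u, 0 ≤ f₀ u) → ∃ f, IsSol γ (2 * B) T f₀ f := by
  obtain ⟨T, hT, hTL⟩ := exists_time (γ := γ) hB
  exact ⟨T, hT, fun f₀ hd h0 => exists_isSol_of_exp_le hγ hB hT.le hTL hd h0⟩

end iter

/-! ### Restriction and concatenation of solutions -/

section concat

variable {γ K K' T τ : ℝ} {f₀ : ℝ → ℝ} {f g : ℝ → ℝ → ℝ}

lemma IsSol.restrict (hf : IsSol γ K T f₀ f) {T' : ℝ} (h : T' ≤ T) : IsSol γ K T' f₀ f :=
  ⟨hf.reg, hf.nonneg, hf.init, fun t ht e => hf.eq t ⟨ht.1, ht.2.trans h⟩ e⟩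

/-- A solution started from `f T` at time `T` continues `f`. -/
lemma IsSol.append (hγ : 3 < γ) (hT : 0 ≤ T) (hf : IsSol γ K T f₀ f)
    (hg : IsSol γ K' τ (f T) g) :
    IsSol γ (max K K') (T + τ) f₀ fun t => if t ≤ T then f t else g (t - T) := by
  have hγ' : 5 / 2 < γ := by linarith
  have hreg : Reg γ (max K K') fun t => if t ≤ T then f t else g (t - T) := by
    refine ⟨fun t => ?_, fun e => ?_⟩
    · split_ifs
      · exact (hf.reg.dec t).mono (le_max_left _ _)
      · exact (hg.reg.dec _).mono (le_max_right _ _)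
    · have : Continuous fun t => if t ≤ T then f t e else g (t - T) e :=
        Continuous.if_le (hf.reg.cont e) ((hg.reg.cont e).comp (continuous_id.sub continuous_const))
          continuous_id continuous_const fun t ht => by
            have ht : t = T := ht
            simp only [ht, sub_self, hg.init]
      refine this.congr fun t => ?_
      split_ifs <;> rfl
  refine ⟨hreg, fun t e => ?_, fun e => ?_, fun t ht e => ?_⟩
  · split_ifs
    · exact hf.nonneg _ _
    · exact hg.nonneg _ _
  · simp only [if_pos hT, hf.init]
  · have hc := hreg.continuous_collision hγ' e
    have h1 : ∀ r ≤ T, 0 ≤ r → ∫ s in (0 : ℝ)..r,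
        collision ((fun t => if t ≤ T then f t else g (t - T)) s) e =
        ∫ s in (0 : ℝ)..r, collision (f s) e := fun r hr h0 => by
      refine intervalIntegral.integral_congr fun s hs => ?_
      rw [uIcc_of_le h0] at hs
      simp only [if_pos (hs.2.trans hr)]
    rcases le_or_gt t T with htT | htT
    · rw [h1 t htT ht.1]
      simp only [if_pos htT]
      exact hf.eq t ⟨ht.1, htT⟩ e
    · rw [← intervalIntegral.integral_add_adjacent_intervals
        (hc.intervalIntegrable 0 T) (hc.intervalIntegrable T t), h1 T le_rfl hT, ← add_assoc,
        ← hf.eq T ⟨hT, le_rfl⟩]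
      simp only [if_neg (not_le.2 htT)]
      rw [hg.eq (t - T) ⟨by linarith, by linarith [ht.2]⟩ e]
      congr 1
      have h2 : ∫ s in T..t, collision (if s ≤ T then f s else g (s - T)) e =
          ∫ s in T..t, collision (g (s - T)) e := by
        refine intervalIntegral.integral_congr fun s hs => ?_
        rw [uIcc_of_le htT.le] at hs
        rcases hs.1.eq_or_lt with h | h
        · have : g 0 = f T := funext hg.init
          simp [← h, this]
        · simp only [if_neg (not_le.2 h)]
      rw [h2, intervalIntegral.integral_comp_sub_right (fun s => collision (g s) e), sub_self]

end concat

/-! ### Propagation of the decay in energy -/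

section bound

variable {γ K T : ℝ} {f₀ : ℝ → ℝ} {f : ℝ → ℝ → ℝ}

/-- As long as the moment stays bounded, the decaying bound grows at most exponentially, at a rate
independent of the bound already known: by the comparison of gain and loss, any bound `N` improves to
the larger of `K₀` and `2 / (γ - 1) * N`. -/
lemma IsSol.le_of_mom_le (hγ : 3 < γ) {A K₀ : ℝ} (hf : IsSol γ K T f₀ f) (h0 : Dec γ K₀ f₀)
    (hA : ∀ t ∈ Icc 0 T, mom (f t) ≤ A) {t : ℝ} (ht : t ∈ Icc 0 T) (e : ℝ) :
    f t e ≤ K₀ * Real.exp (c₀ * ((γ - 1) / 2 * boundConst γ A + A) * t) * wt γ e := by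
  have hγ' : 5 / 2 < γ := by linarith
  have hc := c₀_pos
  have hA0 : 0 ≤ A := (hf.reg.dec t).mom_nonneg.trans (hA t ht)
  have hb := boundConst_nonneg (γ := γ) hA0
  have hK := h0.nonneg
  have hK' := (hf.reg.dec 0).nonneg
  set L := c₀ * ((γ - 1) / 2 * boundConst γ A + A) with hL
  have hL0 : 0 ≤ L := mul_nonneg hc.le (add_nonneg (mul_nonneg (by linarith) hb) hA0)
  set ρ := 2 / (γ - 1) with hρ
  have hγ1 : 0 < γ - 1 := by linarith
  have hρ0 : 0 ≤ ρ := by positivity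
  have hρ1 : ρ < 1 := by rw [hρ, div_lt_one hγ1]; linarith
  have hiter : ∀ n : ℕ, ∀ s ∈ Icc 0 T, ∀ e,
      f s e ≤ max K₀ (ρ ^ n * K) * Real.exp (L * s) * wt γ e := by
    intro n
    induction n with
    | zero =>
      intro s hs e
      have h1 := (le_abs_self _).trans ((hf.reg.dec s).bound e)
      have h2 : 1 ≤ Real.exp (L * s) := Real.one_le_exp (mul_nonneg hL0 hs.1)
      have h3 := wt_nonneg γ e
      have h4 : K ≤ max K₀ (ρ ^ 0 * K) := by simp
      have h5 : 0 ≤ max K₀ (ρ ^ 0 * K) := hK.trans (le_max_left _ _)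
      calc f s e ≤ K * 1 * wt γ e := by linarith
        _ ≤ _ := by gcongr
    | succ n ih =>
      intro s hs e
      set N := max K₀ (ρ ^ n * K) with hN
      have hN0 : 0 ≤ N := hK.trans (le_max_left _ _)
      rcases le_or_gt e 0 with he | he
      · rw [(hf.reg.dec s).zero he, wt_of_nonpos he, mul_zero]
      have hw := wt_nonneg γ e
      have hstep : max K₀ (ρ * N) ≤ max K₀ (ρ ^ (n + 1) * K) := by
        refine max_le (le_max_left _ _) ?_
        rw [hN, mul_max_of_nonneg _ _ hρ0]
        refine max_le_max (mul_le_of_le_one_left hK hρ1.le) (le_of_eq (by ring))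
      have key := ode_abs_le (F := fun t => f t e) (a := fun t => lossRate (f t) e)
        (S := fun t => c₀ * gain (f t) e) (Λ := L) (κ := max K₀ (ρ * N) * wt γ e) (T := T)
        (hf.reg.continuous_lossRate hγ' e) (hf.reg.cont e).continuousOn
        (fun t ht => hf.hasDerivAt' hγ ht e) (fun r hr => ?_) ?_ s hs
      · refine (le_abs_self _).trans (key.trans ?_)
        calc _ = max K₀ (ρ * N) * Real.exp (L * s) * wt γ e := by ring
          _ ≤ _ := by gcongr
      · have hr' := Ioo_subset_Icc_self hr
        have hds : Dec γ (N * Real.exp (L * r)) (f r) :=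
          ⟨(hf.reg.dec r).meas, fun e => by
            rw [abs_of_nonneg (hf.nonneg r e)]; exact ih r hr' e⟩
        have g1 := gain_le hγ' hds (hf.nonneg r) (hA r hr') he
        have g2 := gain_nonneg hγ' hds (hf.nonneg r) e
        have g3 := le_lossRate hγ' (hf.reg.dec r) (hf.nonneg r) he
        have g5 : c₀ * (2 / (γ - 1) * (√e * mass (f r)) + boundConst γ A) ≤
            ρ * (L + lossRate (f r) e) := by
          have h6 : c₀ * (√e * mass (f r) - A) ≤ c₀ * (√e * mass (f r) - mom (f r)) :=
            mul_le_mul_of_nonneg_left (by linarith [hA r hr']) hc.le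
          have h7 : ρ * (L + c₀ * (√e * mass (f r) - A)) ≤ ρ * (L + lossRate (f r) e) :=
            mul_le_mul_of_nonneg_left (by linarith) hρ0
          refine le_trans (le_of_eq ?_) h7
          rw [hL, hρ]
          field_simp
          ring
        have g6 : ρ * N ≤ max K₀ (ρ * N) := le_max_right _ _
        have g7 := lossRate_nonneg hγ' (hf.reg.dec r) (hf.nonneg r) e
        rw [abs_of_nonneg (mul_nonneg hc.le g2), wt_of_pos he]
        calc c₀ * gain (f r) e ≤ c₀ * (N * Real.exp (L * r) * (1 + e) ^ (-γ) *
              (2 / (γ - 1) * (√e * mass (f r)) + boundConst γ A)) := by gcongr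
          _ = (c₀ * (2 / (γ - 1) * (√e * mass (f r)) + boundConst γ A)) *
              (N * (1 + e) ^ (-γ) * Real.exp (L * r)) := by ring
          _ ≤ (ρ * (L + lossRate (f r) e)) * (N * (1 + e) ^ (-γ) * Real.exp (L * r)) := by gcongr
          _ = (L + lossRate (f r) e) * (ρ * N * (1 + e) ^ (-γ) * Real.exp (L * r)) := by ring
          _ ≤ _ := by gcongr
      · simp only [hf.init]
        exact (h0.bound e).trans (mul_le_mul_of_nonneg_right (le_max_left _ _) hw)
  have hlim : Tendsto (fun n : ℕ => max K₀ (ρ ^ n * K) * Real.exp (L * t) * wt γ e) atTop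
      (𝓝 (max K₀ (0 * K) * Real.exp (L * t) * wt γ e)) :=
    ((tendsto_const_nhds.max
      ((tendsto_pow_atTop_nhds_zero_of_lt_one hρ0 hρ1).mul_const _)).mul_const _).mul_const _
  have := ge_of_tendsto' hlim fun n => hiter n t ht e
  rwa [zero_mul, max_eq_left hK] at this

/-- The moment is controlled by a pointwise bound, at low energies, and by the conserved mass and
energy, at high energies. -/
lemma IsSol.mom_le_of_ae_le (hγ : 3 < γ) {M : ℝ} (hf : IsSol γ K T f₀ f) {t : ℝ}
    (ht : t ∈ Icc 0 T) (hM : ∀ᵐ e ∂halfLine, f t e ≤ M) :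
    mom (f t) ≤ 3 * M + 3 * ∫ e, f₀ e * (√e * (1 + 1 * e)) := by
  have hγ' : 5 / 2 < γ := by linarith
  have hd := hf.reg.dec t
  rw [← hf.conserved hγ zero_le_one zero_le_one le_rfl le_rfl ht]
  have hφ : ∀ u : ℝ, 0 < u → |√u * (1 + 1 * u)| ≤ mw u := fun u hu => by
    rw [abs_of_nonneg (by positivity), mw, one_mul, mul_comm]
    exact mul_le_mul_of_nonneg_left (Real.sqrt_le_sqrt (by linarith)) (by linarith)
  have i1 : Integrable fun u => f t u * (√u * (1 + 1 * u)) :=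
    hd.integrable_mul hγ' (by fun_prop) hφ
  have i2 : Integrable (indicator (Ioc (0 : ℝ) 1) fun _ => 3 * M) :=
    (integrable_indicator_iff measurableSet_Ioc).2
      (integrableOn_const (by simp))
  have e2 : ∫ u, indicator (Ioc (0 : ℝ) 1) (fun _ => 3 * M) u = 3 * M := by
    rw [integral_indicator measurableSet_Ioc]; simp
  rw [← e2, ← integral_const_mul, ← integral_add i2 (i1.const_mul 3)]
  refine integral_mono_ae (hd.integrable_mom hγ') (i2.add (i1.const_mul 3)) ?_
  have hM' := (ae_restrict_iff' measurableSet_Ioi).1 hM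
  filter_upwards [hM'] with u hu
  rcases le_or_gt u 0 with h0 | h0
  · have : u ∉ Ioc (0 : ℝ) 1 := fun h => absurd h.1 (not_lt.2 h0)
    simp [hd.zero h0, indicator_of_notMem this]
  have hu := hu h0
  have hn := hf.nonneg t u
  rw [abs_of_nonneg hn]
  simp only [one_mul]
  rcases le_or_gt u 1 with h1 | h1
  · rw [indicator_of_mem (show u ∈ Ioc (0 : ℝ) 1 from ⟨h0, h1⟩)]
    have h2 : √(1 + u) ≤ 3 / 2 := by
      rw [Real.sqrt_le_left (by norm_num)]; linarith
    have h3 : mw u ≤ 3 := by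
      rw [mw]; nlinarith [Real.sqrt_nonneg (1 + u)]
    have h4 : 0 ≤ √u * (1 + u) := by positivity
    have h5 : f t u * mw u ≤ f t u * 3 := mul_le_mul_of_nonneg_left h3 hn
    have := mul_nonneg hn h4
    linarith
  · have : u ∉ Ioc (0 : ℝ) 1 := fun h => absurd h.2 (not_le.2 h1)
    rw [indicator_of_notMem this, zero_add]
    have h2 : √(1 + u) ≤ 3 * √u := by
      rw [show (3 : ℝ) * √u = √(9 * u) by
        rw [Real.sqrt_mul (by norm_num), show (9 : ℝ) = 3 ^ 2 by norm_num,
          Real.sqrt_sq (by norm_num)]]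
      exact Real.sqrt_le_sqrt (by linarith)
    have h3 : mw u ≤ 3 * (√u * (1 + u)) := by
      rw [mw]; nlinarith
    calc _ ≤ f t u * (3 * (√u * (1 + u))) := mul_le_mul_of_nonneg_left h3 hn
      _ = _ := by ring

end bound

/-! ### The maximal solution -/

/-- `F` is the maximal solution with datum `f₀'`: it is a regular solution exactly up to the times
before `Tmax`, and it blows up there if `Tmax` is finite. -/
structure IsMaximal (γ : ℝ) (f₀' : ℝ → ℝ) (Tmax : EReal) (F : ℝ → ℝ → ℝ) : Prop where
  exists_isSol : ∀ S : ℝ, 0 ≤ S → (S : EReal) < Tmax →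
    ∃ K f, IsSol γ K S f₀' f ∧ ∀ t ∈ Icc 0 S, f t = F t
  lt : ∀ S K f, 0 ≤ S → IsSol γ K S f₀' f → (S : EReal) < Tmax
  blowup : ∀ S : ℝ, Tmax = (S : EReal) →
    limsup (fun t => eLpNorm (F t) ∞ halfLine) (𝓝[<] S) = ∞

/-- Solutions with a given datum agree with one another, can be extended past any time up to which
they exist, and can be extended past a finite supremum of such times unless they blow up there. -/
lemma exists_isMaximal {γ B : ℝ} (hγ : 3 < γ) {f₀ : ℝ → ℝ} (hd : Dec γ B f₀) (h0 : ∀ u, 0 ≤ f₀ u) :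
    ∃ Tmax F, IsMaximal γ f₀ Tmax F := by
  classical
  set P : ℝ → Prop := fun S => ∃ K f, IsSol γ K S f₀ f with hP
  have hanti : ∀ {S S' : ℝ}, S' ≤ S → P S → P S' := fun h ⟨K, f, hf⟩ => ⟨K, f, hf.restrict h⟩
  have hext : ∀ S, 0 ≤ S → P S → ∃ S', S < S' ∧ P S' := by
    rintro S hS ⟨K, f, hf⟩
    obtain ⟨τ, hτ, hloc⟩ := exists_local hγ (hf.reg.dec 0).nonneg
    obtain ⟨g, hg⟩ := hloc (f S) (hf.reg.dec S) (hf.nonneg S)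
    exact ⟨S + τ, by linarith, _, _, hf.append hγ hS hg⟩
  set F : ℝ → ℝ → ℝ := fun t => if h : P t then h.choose_spec.choose t else 0 with hF
  have hFeq : ∀ {S K f}, IsSol γ K S f₀ f → ∀ t ∈ Icc 0 S, f t = F t := by
    intro S K f hf t ht
    have h : P t := ⟨K, f, hf.restrict ht.2⟩
    simp only [hF, dif_pos h]
    exact funext fun e => h.choose_spec.choose_spec.unique hγ (hf.restrict ht.2) t ⟨ht.1, le_rfl⟩ e
  set Tmax : EReal := sSup ((fun S : ℝ => (S : EReal)) '' {S | P S}) with hTmax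
  have hlt : ∀ S : ℝ, (S : EReal) < Tmax → P S := by
    intro S hS
    obtain ⟨_, ⟨S', hS', rfl⟩, h⟩ := lt_sSup_iff.1 hS
    exact hanti (EReal.coe_lt_coe_iff.1 h).le hS'
  have hPlt : ∀ S, 0 ≤ S → P S → (S : EReal) < Tmax := by
    intro S hS h
    obtain ⟨S', hSS', h'⟩ := hext S hS h
    exact (EReal.coe_lt_coe_iff.2 hSS').trans_le (le_sSup ⟨S', h', rfl⟩)
  refine ⟨Tmax, F, fun S _ h => ?_, fun S K f hS hf => hPlt S hS ⟨K, f, hf⟩, fun S hS => ?_⟩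
  · obtain ⟨K, f, hf⟩ := hlt S h
    exact ⟨K, f, hf, hFeq hf⟩
  -- if the norm stays below `M` near `S`, the solution decays uniformly on `[0, S)`
  by_contra hlim
  obtain ⟨M, hM, -⟩ := ENNReal.lt_iff_exists_nnreal_btwn.1 (lt_top_iff_ne_top.2 hlim)
  have hpos : 0 < S := by
    obtain ⟨T, hT, hloc⟩ := exists_local hγ hd.nonneg
    obtain ⟨f, hf⟩ := hloc f₀ hd h0
    have := hPlt T hT.le ⟨_, f, hf⟩
    rw [hS] at this
    exact hT.trans (EReal.coe_lt_coe_iff.1 this)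
  have hev : ∀ᶠ t in 𝓝[<] S, eLpNorm (F t) ∞ halfLine < M := eventually_lt_of_limsup_lt hM
  obtain ⟨t₁, ht₁, hbd⟩ := (mem_nhdsLT_iff_exists_Ioo_subset' hpos).1 hev
  set t₀ := max 0 t₁ with ht₀
  have ht₀S : t₀ < S := max_lt hpos ht₁
  obtain ⟨K₁, f₁, hf₁⟩ := hlt t₀ (by rw [hS]; exact EReal.coe_lt_coe_iff.2 ht₀S)
  have hMae : ∀ t ∈ Ico 0 S, ∀ᵐ e ∂halfLine, F t e ≤ max K₁ M := by
    intro t ht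
    rcases le_or_gt t t₀ with h | h
    · refine ae_of_all _ fun e => ?_
      rw [← hFeq hf₁ t ⟨ht.1, h⟩]
      exact (le_abs_self _).trans (((hf₁.reg.dec t).le (by linarith) e).trans (le_max_left _ _))
    · have h1 : eLpNorm (F t) ∞ halfLine < M := hbd ⟨(le_max_right _ _).trans_lt h, ht.2⟩
      rw [eLpNorm_exponent_top] at h1
      filter_upwards [enorm_ae_le_eLpNormEssSup (F t) halfLine] with e he
      have h2 : ‖F t e‖ₑ ≤ (M : ℝ≥0∞) := he.trans h1.le
      have h3 : ‖F t e‖₊ ≤ M := by exact_mod_cast h2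
      have h4 : ‖F t e‖ ≤ M := h3
      exact (le_abs_self _).trans (h4.trans (le_max_right _ _))
  set A := 3 * max K₁ M + 3 * ∫ e, f₀ e * (√e * (1 + 1 * e)) with hA
  set L := c₀ * ((γ - 1) / 2 * boundConst γ A + A) with hL
  have hdec : ∀ t ∈ Ico 0 S, Dec γ (B * Real.exp (|L| * S)) (F t) := by
    intro t ht
    obtain ⟨K, f, hf⟩ := hlt t (by rw [hS]; exact EReal.coe_lt_coe_iff.2 ht.2)
    have hmem : t ∈ Icc 0 t := ⟨ht.1, le_rfl⟩
    have hmom : ∀ s ∈ Icc 0 t, mom (f s) ≤ A := fun s hs =>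
      hf.mom_le_of_ae_le hγ hs (by
        rw [hFeq hf s hs]; exact hMae s ⟨hs.1, hs.2.trans_lt ht.2⟩)
    rw [← hFeq hf t hmem]
    refine ⟨(hf.reg.dec t).meas, fun e => ?_⟩
    rw [abs_of_nonneg (hf.nonneg t e)]
    refine (hf.le_of_mom_le hγ hd hmom hmem e).trans ?_
    have h1 := wt_nonneg γ e
    have h2 := hd.nonneg
    have h3 : L * t ≤ |L| * S :=
      mul_le_mul (le_abs_self L) ht.2.le ht.1 (abs_nonneg L)
    gcongr
  -- a restart at distance less than `τ` from `S` goes past `S`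
  obtain ⟨τ, hτ, hloc⟩ := exists_local hγ (B := B * Real.exp (|L| * S))
    (mul_nonneg hd.nonneg (Real.exp_pos _).le)
  set s := max 0 (S - τ / 2) with hs
  have hsS : s < S := max_lt hpos (by linarith)
  have hs0 : 0 ≤ s := le_max_left _ _
  obtain ⟨K, f, hf⟩ := hlt s (by rw [hS]; exact EReal.coe_lt_coe_iff.2 hsS)
  have hfs := hFeq hf s ⟨hs0, le_rfl⟩
  obtain ⟨g, hg⟩ := hloc (f s) (by rw [hfs]; exact hdec s ⟨hs0, hsS⟩) (hf.nonneg s)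
  have := hPlt (s + τ) (by linarith) ⟨_, _, hf.append hγ hs0 hg⟩
  rw [hS] at this
  have h1 := EReal.coe_lt_coe_iff.1 this
  have h2 : S - τ / 2 ≤ s := le_max_right _ _
  linarith

/-! ### Arbitrary mild solutions have regular representatives -/

section coefficients

variable {a b a' b' : ℝ → ℝ} {Ca Cb S : ℝ}

lemma intervalIntegrable_of_bounded (ha : Measurable a) (h : ∀ s, |a s| ≤ Ca) (s t : ℝ) :
    IntervalIntegrable a volume s t :=
  intervalIntegrable_const (c := Ca) |>.mono_fun ha.aestronglyMeasurable
    (ae_of_all _ fun r => (h r).trans (le_abs_self Ca))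

lemma continuous_exp_primitive_of_bounded (ha : Measurable a) (hCa : ∀ s, |a s| ≤ Ca) :
    Continuous fun t => Real.exp (∫ s in (0 : ℝ)..t, a s) :=
  (intervalIntegral.continuous_primitive (intervalIntegrable_of_bounded ha hCa) 0).rexp

lemma continuous_duhamel_of_bounded (ha : Measurable a) (hCa : ∀ s, |a s| ≤ Ca)
    (hb : Measurable b) (hCb : ∀ s, |b s| ≤ Cb) (F₀ : ℝ) : Continuous (duhamel a b F₀) := by
  have h1 := intervalIntegral.continuous_primitive (intervalIntegrable_of_bounded ha hCa) 0
  have h2 : Continuous fun t => ∫ s in (0 : ℝ)..t, Real.exp (∫ r in (0 : ℝ)..s, a r) * b s :=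
    intervalIntegral.continuous_primitive (fun s t =>
      (intervalIntegrable_of_bounded hb hCb s t).continuousOn_mul h1.rexp.continuousOn) 0
  exact h1.neg.rexp.mul (continuous_const.add h2)

lemma duhamel_congr_ae (h : ∀ᵐ s ∂volume.restrict (Icc 0 S), a s = a' s ∧ b s = b' s) (F₀ : ℝ)
    {t : ℝ} (ht : t ∈ Icc 0 S) : duhamel a b F₀ t = duhamel a' b' F₀ t := by
  have h' := (ae_restrict_iff' measurableSet_Icc).1 h
  have hsub : ∀ t ∈ Icc 0 S, ∀ s ∈ uIoc 0 t, s ∈ Icc 0 S := fun t ht s hs => by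
    rw [uIoc_of_le ht.1] at hs
    exact ⟨hs.1.le, hs.2.trans ht.2⟩
  have hI : ∀ t ∈ Icc 0 S, ∫ s in (0 : ℝ)..t, a s = ∫ s in (0 : ℝ)..t, a' s := fun t ht =>
    intervalIntegral.integral_congr_ae (by
      filter_upwards [h'] with s hs hst
      exact (hs (hsub t ht s hst)).1)
  rw [duhamel, duhamel, hI t ht]
  congr 2
  refine intervalIntegral.integral_congr_ae ?_
  filter_upwards [h'] with s hs hst
  rw [hI s (hsub t ht s hst), (hs (hsub t ht s hst)).2]

end coefficients

/-! The coefficients of a profile that is merely measurable in time are measurable and bounded in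
time. -/

section measurable

variable {γ K S : ℝ} {f₀ : ℝ → ℝ} {G : ℝ → ℝ → ℝ}

lemma measurable_uncurry_lossRate (hγ : 5 / 2 < γ) (hm : Measurable (Function.uncurry G))
    (hd : ∀ t, Dec γ K (G t)) : Measurable (Function.uncurry fun s e => lossRate (G s) e) := by
  have h0 : (Function.uncurry fun s e => lossRate (G s) e) = fun z : ℝ × ℝ =>
      c₀ * ∫ p : ℝ × ℝ, G z.1 (p.1 + p.2 - z.2) * (1 + G z.1 p.1 + G z.1 p.2) * V z.2 p :=
    funext fun z => lossRate_eq_integral hγ (hd z.1) z.2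
  have hG : ∀ {u v : (ℝ × ℝ) × (ℝ × ℝ) → ℝ}, Measurable u → Measurable v →
      Measurable fun z => G (u z) (v z) := fun hu hv => hm.comp (hu.prodMk hv)
  have hV : Measurable fun z : (ℝ × ℝ) × (ℝ × ℝ) => V z.1.2 z.2 :=
    measurable_V_comp (by fun_prop) (by fun_prop)
  have h1 : Measurable fun z : (ℝ × ℝ) × (ℝ × ℝ) => G z.1.1 (z.2.1 + z.2.2 - z.1.2) :=
    hG (by fun_prop) (by fun_prop)
  have h2 : Measurable fun z : (ℝ × ℝ) × (ℝ × ℝ) => G z.1.1 z.2.1 := hG (by fun_prop) (by fun_prop)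
  have h3 : Measurable fun z : (ℝ × ℝ) × (ℝ × ℝ) => G z.1.1 z.2.2 := hG (by fun_prop) (by fun_prop)
  have h4 : Measurable (fun z : (ℝ × ℝ) × (ℝ × ℝ) =>
      G z.1.1 (z.2.1 + z.2.2 - z.1.2) * (1 + G z.1.1 z.2.1 + G z.1.1 z.2.2) * V z.1.2 z.2) :=
    (h1.mul ((h2.const_add 1).add h3)).mul hV
  rw [h0]
  exact (h4.stronglyMeasurable.integral_prod_right' (ν := volume)).measurable.const_mul _

lemma measurable_uncurry_gain (hγ : 5 / 2 < γ) (hm : Measurable (Function.uncurry G))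
    (hd : ∀ t, Dec γ K (G t)) : Measurable (Function.uncurry fun s e => gain (G s) e) := by
  have h0 : (Function.uncurry fun s e => gain (G s) e) = fun z : ℝ × ℝ =>
      ∫ p : ℝ × ℝ, G z.1 p.1 * G z.1 p.2 * (1 + G z.1 z.2 + G z.1 (p.1 + p.2 - z.2)) * V z.2 p :=
    funext fun z => gain_eq_integral hγ (hd z.1) z.2
  have hG : ∀ {u v : (ℝ × ℝ) × (ℝ × ℝ) → ℝ}, Measurable u → Measurable v →
      Measurable fun z => G (u z) (v z) := fun hu hv => hm.comp (hu.prodMk hv)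
  have hV : Measurable fun z : (ℝ × ℝ) × (ℝ × ℝ) => V z.1.2 z.2 :=
    measurable_V_comp (by fun_prop) (by fun_prop)
  have h1 : Measurable fun z : (ℝ × ℝ) × (ℝ × ℝ) => G z.1.1 (z.2.1 + z.2.2 - z.1.2) :=
    hG (by fun_prop) (by fun_prop)
  have h2 : Measurable fun z : (ℝ × ℝ) × (ℝ × ℝ) => G z.1.1 z.2.1 := hG (by fun_prop) (by fun_prop)
  have h3 : Measurable fun z : (ℝ × ℝ) × (ℝ × ℝ) => G z.1.1 z.2.2 := hG (by fun_prop) (by fun_prop)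
  have h5 : Measurable fun z : (ℝ × ℝ) × (ℝ × ℝ) => G z.1.1 z.1.2 := hG (by fun_prop) (by fun_prop)
  have h4 : Measurable (fun z : (ℝ × ℝ) × (ℝ × ℝ) =>
      G z.1.1 z.2.1 * G z.1.1 z.2.2 * (1 + G z.1.1 z.1.2 + G z.1.1 (z.2.1 + z.2.2 - z.1.2)) *
        V z.1.2 z.2) :=
    ((h2.mul h3).mul ((h5.const_add 1).add h1)).mul hV
  rw [h0]
  exact (h4.stronglyMeasurable.integral_prod_right' (ν := volume)).measurable

lemma exists_lossRate_bound (hγ : 5 / 2 < γ) (hd : ∀ t, Dec γ K (G t)) (e : ℝ) :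
    ∃ C, ∀ t, |lossRate (G t) e| ≤ C := by
  rcases le_or_gt e 0 with he | he
  · exact ⟨0, fun t => by rw [lossRate_of_nonpos _ he, abs_zero]⟩
  have hc := c₀_pos
  refine ⟨c₀ * (2 * (K * mom (wt γ) + K * mom (wt γ) * (K * mom (wt γ)))) * √(1 + e), fun t => ?_⟩
  have h1 := (hd t).mom_le hγ
  have h2 := (hd t).mom_nonneg
  have h3 := h2.trans h1
  refine (abs_lossRate_le hγ (hd t) he).trans ?_
  gcongr

lemma exists_gain_bound (hγ : 3 < γ) (hd : ∀ t, Dec γ K (G t)) (e : ℝ) :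
    ∃ C, ∀ t, |c₀ * gain (G t) e| ≤ C := by
  rcases le_or_gt e 0 with he | he
  · exact ⟨0, fun t => by rw [gain_of_nonpos _ he, mul_zero, abs_zero]⟩
  refine ⟨c₀ * (K * (K * mom (wt γ) + boundConst γ (K * mom (wt γ))) *
    (√(1 + e) * (1 + e) ^ (-γ))), fun t => ?_⟩
  rw [abs_mul, abs_of_pos c₀_pos]
  exact mul_le_mul_of_nonneg_left
    (abs_gain_le hγ (hd t) ((hd t).mom_le (by linarith)) he) c₀_pos.le

lemma continuous_mildMap_of_measurable (hγ : 3 < γ) (hm : Measurable (Function.uncurry G))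
    (hd : ∀ t, Dec γ K (G t)) (e : ℝ) : Continuous fun t => mildMap S f₀ G t e := by
  have hγ' : 5 / 2 < γ := by linarith
  obtain ⟨Ca, hCa⟩ := exists_lossRate_bound hγ' hd e
  obtain ⟨Cb, hCb⟩ := exists_gain_bound hγ hd e
  have h1 : Measurable fun s => lossRate (G s) e :=
    (measurable_uncurry_lossRate hγ' hm hd).comp (measurable_id.prodMk measurable_const)
  have h2 : Measurable fun s => gain (G s) e :=
    (measurable_uncurry_gain hγ' hm hd).comp (measurable_id.prodMk measurable_const)
  exact (continuous_duhamel_of_bounded h1 hCa (h2.const_mul c₀) hCb _).comp (by fun_prop)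

lemma measurable_mildMap_of_measurable (hγ : 3 < γ) (hm : Measurable (Function.uncurry G))
    (hd : ∀ t, Dec γ K (G t)) (hf₀ : Measurable f₀) (t : ℝ) : Measurable (mildMap S f₀ G t) := by
  have hγ' : 5 / 2 < γ := by linarith
  have h1 := measurable_uncurry_lossRate hγ' hm hd
  have h2 := measurable_uncurry_gain hγ' hm hd
  have h3 := measurable_intervalIntegral h1
  have h4 : Measurable (Function.uncurry fun s e =>
      Real.exp (∫ r in (0 : ℝ)..s, lossRate (G r) e)) := by
    refine measurable_uncurry (fun e => ?_) fun s => (h3 s).exp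
    obtain ⟨Ca, hCa⟩ := exists_lossRate_bound hγ' hd e
    exact continuous_exp_primitive_of_bounded
      (h1.comp (measurable_id.prodMk measurable_const)) hCa
  exact ((h3 _).neg.exp).mul (hf₀.add (measurable_intervalIntegral
    (u := fun s e => Real.exp (∫ r in (0 : ℝ)..s, lossRate (G r) e) * (c₀ * gain (G s) e))
    (h4.mul (h2.const_mul c₀)) _))

end measurable

/-- The norm of `h` bounds its values at almost all energies. -/
lemma ae_abs_le_of_wNorm_le {γ : ℝ} {h : ℝ → ℝ} {K : ℝ≥0} (hK : wNorm γ h ≤ K) :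
    ∀ᵐ e ∂halfLine, |h e| ≤ K * wt γ e := by
  rw [wNorm, eLpNorm_exponent_top] at hK
  filter_upwards [enorm_ae_le_eLpNormEssSup (fun ε => (1 + ε) ^ γ * h ε) halfLine,
    ae_restrict_mem measurableSet_Ioi] with e he he0
  have he0 : 0 < e := he0
  have h2 : ‖(1 + e) ^ γ * h e‖ₑ ≤ (K : ℝ≥0∞) := he.trans hK
  have h3 : ‖(1 + e) ^ γ * h e‖₊ ≤ K := by exact_mod_cast h2
  have h4 : ‖(1 + e) ^ γ * h e‖ ≤ K := h3
  have h5 : 0 < (1 + e) ^ γ := Real.rpow_pos_of_pos (by linarith) _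
  rw [Real.norm_eq_abs, abs_mul, abs_of_pos h5, mul_comm, ← le_div_iff₀ h5] at h4
  rwa [wt_of_pos he0, Real.rpow_neg (by linarith), ← div_eq_mul_inv]

section mild

variable {γ B : ℝ} {f₀ f₀' : ℝ → ℝ} {g u v : ℝ → ℝ → ℝ} {T' : EReal} {S : ℝ}

lemma ae_swap {μ ν : Measure ℝ} [SFinite μ] [SFinite ν] {P : ℝ → ℝ → Prop}
    (h : ∀ᵐ z ∂μ.prod ν, P z.1 z.2) : ∀ᵐ e ∂ν, ∀ᵐ s ∂μ, P s e :=
  Measure.ae_ae_of_ae_prod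
    (Measure.measurePreserving_swap (μ := ν) (ν := μ) |>.quasiMeasurePreserving.ae h)

/-- The coefficients at almost every energy do not see modifications on null sets. The gain involves
the value `f₁` at the given energy, so it has to be compared at almost every energy only. -/
lemma ae_coefficients_eq {μ : Measure ℝ} [SFinite μ]
    (h : ∀ᵐ z ∂μ.prod halfLine, u z.1 z.2 = v z.1 z.2) :
    ∀ᵐ e ∂halfLine, ∀ᵐ s ∂μ, lossRate (u s) e = lossRate (v s) e ∧
      c₀ * gain (u s) e = c₀ * gain (v s) e := by
  filter_upwards [ae_swap (P := fun s e => u s e = v s e) h] with e he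
  filter_upwards [he, Measure.ae_ae_of_ae_prod h] with s hs hs'
  exact ⟨lossRate_congr hs' e, by rw [gain_congr hs' hs]⟩

/-- A continuous function that is almost everywhere at most `c` is at most `c`. -/
lemma le_of_ae_le {φ : ℝ → ℝ} (hφ : Continuous φ) (hS : 0 < S) {c : ℝ}
    (h : ∀ᵐ t ∂volume.restrict (Icc 0 S), φ t ≤ c) : ∀ t ∈ Icc 0 S, φ t ≤ c := by
  intro t ht
  have := Measure.eqOn_Icc_of_ae_eq volume hS.ne (f := fun t => max (φ t) c) (g := fun _ => c)
    (by filter_upwards [h] with s hs; exact max_eq_right hs)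
    (hφ.max continuous_const).continuousOn continuousOn_const ht
  exact max_eq_right_iff.1 this

/-- A mild solution `g` agrees on `[0, S]`, almost everywhere, with a regular profile that solves the
equation at almost every energy. At almost every time the coefficients computed from `g` do not
change when `g` is modified on a null set, and with these coefficients the right-hand side of the
mild formulation is continuous in time. -/
lemma exists_reg_of_isMildSolution (hγ : 3 < γ) (hd : Dec γ B f₀') (hf₀ : f₀ =ᵐ[halfLine] f₀')
    (hg : IsMildSolution γ 0 T' f₀ g) (hS : 0 < S) (hST : (S : EReal) < T') :
    ∃ K g', Reg γ K g' ∧ (∀ᵐ t ∂volume.restrict (Icc 0 S), ∀ᵐ e ∂halfLine, g t e = g' t e) ∧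
      ∀ᵐ e ∂halfLine, g' 0 e = f₀' e ∧ ∀ t ∈ Ioo 0 S, HasDerivAt (fun t => g' t e)
        (-(lossRate (g' t) e * g' t e) + c₀ * gain (g' t) e) t := by
  classical
  have hγ' : 5 / 2 < γ := by linarith
  have hsub : Icc 0 S ⊆ timeIco 0 T' := fun t ht =>
    ⟨ht.1, (EReal.coe_le_coe_iff.2 ht.2).trans_lt hST⟩
  set μ := (volume : Measure ℝ).restrict (Icc 0 S) with hμ
  have hKtop := hg.memLocW.bounded (Icc 0 S) isCompact_Icc hsub
  obtain ⟨K, hK⟩ := WithTop.ne_top_iff_exists.1 hKtop.ne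
  replace hK : (K : ℝ≥0∞) = ⨆ t ∈ Icc 0 S, wNorm γ (g t) := hK
  have hgK : ∀ᵐ t ∂μ, ∀ᵐ e ∂halfLine, |g t e| ≤ K * wt γ e := by
    filter_upwards [ae_restrict_mem measurableSet_Icc] with t ht
    refine ae_abs_le_of_wNorm_le ?_
    rw [hK]
    exact le_iSup₂ (f := fun t (_ : t ∈ Icc 0 S) => wNorm γ (g t)) t ht
  -- a bounded Borel representative
  have hgm : AEStronglyMeasurable (Function.uncurry g) (μ.prod halfLine) := by
    rw [hμ, Measure.prod_restrict, ← Measure.volume_eq_prod]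
    exact hg.memLocW.aestronglyMeasurable.mono_set (prod_mono hsub Subset.rfl)
  obtain ⟨G₀, hG₀m, hG₀⟩ := hgm
  have hG₀m := hG₀m.measurable
  set G : ℝ → ℝ → ℝ := fun t e => max (-(K * wt γ e)) (min (G₀ (t, e)) (K * wt γ e)) with hG
  have hGm : Measurable (Function.uncurry G) := by
    have := measurable_wt γ
    simp only [hG, Function.uncurry_def]
    fun_prop
  have hGd : ∀ t, Dec γ K (G t) := fun t =>
    ⟨hGm.comp measurable_prodMk_left, fun e => by
      have : 0 ≤ K * wt γ e := mul_nonneg K.2 (wt_nonneg _ _)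
      exact abs_le.2 ⟨le_max_left _ _, max_le (by linarith) (min_le_right _ _)⟩⟩
  have hgG' : ∀ᵐ t ∂μ, ∀ᵐ e ∂halfLine, g t e = G t e := by
    filter_upwards [hgK, Measure.ae_ae_of_ae_prod hG₀] with t h1 h2
    filter_upwards [h1, h2] with e h1 h2
    have h2 : g t e = G₀ (t, e) := h2
    have := abs_le.1 h1
    simp only [hG, ← h2, min_eq_left this.2, max_eq_right this.1]
  have hgG : ∀ᵐ z ∂μ.prod halfLine, g z.1 z.2 = G z.1 z.2 := by
    have h1 : ∀ᵐ z ∂μ.prod halfLine, G₀ z = G z.1 z.2 := by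
      refine (Measure.ae_prod_iff_ae_ae (measurableSet_eq_fun hG₀m hGm)).2 ?_
      filter_upwards [hgG', Measure.ae_ae_of_ae_prod hG₀] with t h1 h2
      filter_upwards [h1, h2] with e h1 h2
      exact h2.symm.trans h1
    filter_upwards [hG₀, h1] with z h1 h2
    exact h1.trans h2
  -- the Duhamel formula provides a representative that is continuous in time
  set Φ := mildMap S f₀' G with hΦ
  have hΦc : ∀ e, Continuous fun t => Φ t e := continuous_mildMap_of_measurable hγ hGm hGd
  have hΦm : ∀ t, Measurable (Φ t) := measurable_mildMap_of_measurable hγ hGm hGd hd.meas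
  have hΦu : Measurable (Function.uncurry Φ) := measurable_uncurry hΦc hΦm
  have hmild : ∀ᵐ e ∂halfLine, ∀ t ∈ Icc 0 S, mildRHS 0 f₀ g t e = Φ t e := by
    filter_upwards [ae_coefficients_eq hgG, hf₀] with e he he0 t ht
    rw [mildRHS_eq_duhamel, he0, duhamel_congr_ae he _ ht, hΦ, mildMap, clamp_eq ht]
  have hgΦ : ∀ᵐ t ∂μ, ∀ᵐ e ∂halfLine, g t e = Φ t e := by
    filter_upwards [ae_restrict_of_ae_restrict_of_subset hsub hg.eq_mildRHS,
      ae_restrict_mem measurableSet_Icc] with t h1 ht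
    filter_upwards [h1, hmild] with e h1 h2
    rw [h1, h2 t ht]
  have hΦK : ∀ᵐ e ∂halfLine, ∀ t, |Φ t e| ≤ K * wt γ e := by
    have h1 : ∀ᵐ z ∂μ.prod halfLine, |Φ z.1 z.2| ≤ K * wt γ z.2 := by
      refine (Measure.ae_prod_iff_ae_ae ?_).2 ?_
      · have := measurable_wt γ
        exact measurableSet_le (hΦu.abs) (by fun_prop)
      · filter_upwards [hgK, hgΦ] with t h1 h2
        filter_upwards [h1, h2] with e h1 h2
        rwa [← h2]
    filter_upwards [ae_swap (P := fun t e => |Φ t e| ≤ K * wt γ e) h1] with e he t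
    rw [hΦ, ← mildMap_clamp hS.le]
    exact le_of_ae_le (hΦc e).abs hS he _ (clamp_mem hS.le t)
  -- the bound passes from almost all times to all times; the exceptional energies are removed
  obtain ⟨N, hNsub, hNm, hN0⟩ := exists_measurable_superset_of_null (ae_iff.1 hΦK)
  set g' : ℝ → ℝ → ℝ := fun t e => if e ∈ N ∨ e ≤ 0 then 0 else Φ t e with hg'
  have hNS : MeasurableSet {e | e ∈ N ∨ e ≤ 0} := hNm.union measurableSet_Iic
  have hae : ∀ᵐ e ∂halfLine, ∀ t, g' t e = Φ t e := by
    have h1 : ∀ᵐ e ∂halfLine, e ∉ N := measure_eq_zero_iff_ae_notMem.1 hN0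
    filter_upwards [h1, ae_restrict_mem measurableSet_Ioi] with e he1 he2 t
    have : ¬ (e ∈ N ∨ e ≤ 0) := by
      rintro (h | h)
      · exact he1 h
      · exact absurd (mem_Ioi.1 he2) (not_lt.2 h)
    simp only [hg', if_neg this]
  have hreg : Reg γ K g' := by
    refine ⟨fun t => ⟨Measurable.ite hNS measurable_const (hΦm t), fun e => ?_⟩, fun e => ?_⟩
    · simp only [hg']
      split_ifs with h
      · rw [abs_zero]; exact mul_nonneg K.2 (wt_nonneg _ _)
      · by_contra hcon
        exact h (Or.inl (hNsub fun hall => hcon (hall t)))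
    · by_cases h : e ∈ N ∨ e ≤ 0
      · simp only [hg', if_pos h]; exact continuous_const
      · simp only [hg', if_neg h]; exact hΦc e
  have hgg' : ∀ᵐ t ∂μ, ∀ᵐ e ∂halfLine, g t e = g' t e := by
    filter_upwards [hgΦ] with t h1
    filter_upwards [h1, hae] with e h1 h2
    rw [h1, h2]
  have hGg' : ∀ᵐ z ∂μ.prod halfLine, G z.1 z.2 = g' z.1 z.2 := by
    refine (Measure.ae_prod_iff_ae_ae (measurableSet_eq_fun hGm hreg.measurable_uncurry)).2 ?_
    filter_upwards [hgG', hgg'] with t h1 h2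
    filter_upwards [h1, h2] with e h1 h2
    exact h1.symm.trans h2
  -- `G` and `g'` have the same coefficients, so `g'` is a fixed point of its own mild map
  refine ⟨K, g', hreg, hgg', ?_⟩
  filter_upwards [ae_coefficients_eq hGg', hae] with e he h1
  have hfix : ∀ t, g' t e = mildMap S f₀' g' t e := fun t => by
    rw [h1, hΦ, mildMap, mildMap, duhamel_congr_ae he _ (clamp_mem hS.le t)]
  refine ⟨by rw [hfix, mildMap_zero hS.le], fun t ht => ?_⟩
  rw [hfix t]
  exact (hasDerivAt_mildMap hγ' hreg e ht).congr_of_eventuallyEq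
    (Eventually.of_forall fun s => hfix s)

end mild

/-! ### Regularity in time -/

/-- Integration by parts produces no boundary terms, as test functions vanish at `0` and `T`. -/
lemma memW1Infty_of_hasDerivAt {E : Type*} [NormedAddCommGroup E] [NormedSpace ℝ E]
    [CompleteSpace E] {T : ℝ} (hT : 0 < T) {u v : ℝ → E} (hu : ContinuousOn u (Icc 0 T))
    (hv : ContinuousOn v (Icc 0 T)) (hd : ∀ t ∈ Ioo 0 T, HasDerivAt u (v t) t) :
    MemW1Infty T u := by
  have hmem : ∀ {w : ℝ → E}, ContinuousOn w (Icc 0 T) →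
      MemLp w ∞ (volume.restrict (Ioo 0 T)) := fun {w} hw => by
    obtain ⟨C, hC⟩ := isCompact_Icc.exists_bound_of_continuousOn hw
    refine memLp_top_of_bound ((hw.mono Ioo_subset_Icc_self).aestronglyMeasurable
      measurableSet_Ioo) C ?_
    filter_upwards [ae_restrict_mem measurableSet_Ioo] with t ht
    exact hC t (Ioo_subset_Icc_self ht)
  refine ⟨hmem hu, v, hmem hv, fun φ hφ _ hsupp => ?_⟩
  have hφc : Continuous φ := hφ.continuous
  have hφd : Continuous (deriv φ) := hφ.continuous_deriv (by simp)
  have hφD : ∀ t, HasDerivAt φ (deriv φ t) t := fun t =>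
    ((hφ.differentiable (by simp)) t).hasDerivAt
  have h0 : φ 0 = 0 := image_eq_zero_of_notMem_tsupport fun h => lt_irrefl _ (hsupp h).1
  have h1 : φ T = 0 := image_eq_zero_of_notMem_tsupport fun h => lt_irrefl _ (hsupp h).2
  have c1 : ContinuousOn (fun t => φ t • v t) (Icc 0 T) := hφc.continuousOn.smul hv
  have c2 : ContinuousOn (fun t => deriv φ t • u t) (Icc 0 T) := hφd.continuousOn.smul hu
  have i1 := c1.intervalIntegrable_of_Icc hT.le (μ := volume)
  have i2 := c2.intervalIntegrable_of_Icc hT.le (μ := volume)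
  have key := intervalIntegral.integral_eq_sub_of_hasDerivAt_of_le hT.le
    (hφc.continuousOn.smul hu) (fun t ht => (hφD t).smul (hd t ht)) (i1.add i2)
  rw [intervalIntegral.integral_add i1 i2] at key
  simp only [Pi.smul_apply', h0, h1, zero_smul, sub_zero] at key
  simp only [intervalIntegral.integral_of_le hT.le, integral_Ioc_eq_integral_Ioo] at key
  exact eq_neg_of_add_eq_zero_right key

lemma norm_Lp_top_le {u : Lp ℝ ∞ halfLine} {C : ℝ} (hC : 0 ≤ C) (h : ∀ᵐ e ∂halfLine, |u e| ≤ C) :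
    ‖u‖ ≤ C := by
  rw [Lp.norm_def, eLpNorm_exponent_top]
  exact ENNReal.toReal_le_of_le_ofReal hC (eLpNormEssSup_le_of_ae_bound h)

lemma Dec.memLp {β K : ℝ} {h : ℝ → ℝ} (hβ : 0 ≤ β) (hd : Dec β K h) : MemLp h ∞ halfLine :=
  memLp_top_of_bound hd.meas.aestronglyMeasurable K (ae_of_all _ (hd.le hβ))

section time

variable {γ K T : ℝ} {f₀ : ℝ → ℝ} {f : ℝ → ℝ → ℝ}

lemma IsSol.sub_eq_integral (hγ : 3 < γ) (hf : IsSol γ K T f₀ f) {s t : ℝ} (hs : s ∈ Icc 0 T)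
    (ht : t ∈ Icc 0 T) (e : ℝ) : f t e - f s e = ∫ r in s..t, collision (f r) e := by
  have hc := hf.reg.continuous_collision (by linarith) e
  rw [hf.eq t ht e, hf.eq s hs e, add_sub_add_left_eq_sub,
    intervalIntegral.integral_interval_sub_left (hc.intervalIntegrable _ _)
      (hc.intervalIntegrable _ _)]

/-- Half a power of decay is lost in the Lipschitz bound for the solution itself, and this is just
affordable for the Lipschitz bound of the collision operator. -/
lemma IsSol.exists_lipschitz (hγ : 3 < γ) (hf : IsSol γ K T f₀ f) : ∃ C : ℝ, 0 ≤ C ∧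
    ∀ s ∈ Icc 0 T, ∀ t ∈ Icc 0 T, ∀ e, |f t e - f s e| ≤ C * |t - s| ∧
      |collision (f t) e - collision (f s) e| ≤ C * |t - s| := by
  have hγ' : 5 / 2 < γ := by linarith
  have hβ : 5 / 2 < γ - 1 / 2 := by linarith
  have hβγ : γ - 1 / 2 ≤ γ := by linarith
  have hc := c₀_pos
  have hK := (hf.reg.dec 0).nonneg
  obtain ⟨C, hC, hcoll⟩ := exists_collision_le hγ K
  obtain ⟨C₁, hC₁, hloss⟩ := exists_lossRate_sub_le hβ hβγ K
  obtain ⟨C₂, hC₂, hgain⟩ := exists_gain_sub_crude hβ hβγ K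
  set A := K * mom (wt γ) with hA
  have hA0 : 0 ≤ A := mul_nonneg hK (mom_wt_nonneg γ)
  have hdec : ∀ s ∈ Icc 0 T, ∀ t ∈ Icc 0 T,
      Dec (γ - 1 / 2) (C * |t - s|) fun e => f t e - f s e := by
    intro s hs t ht
    refine ⟨(hf.reg.dec t).meas.sub (hf.reg.dec s).meas, fun e => ?_⟩
    rw [hf.sub_eq_integral hγ hs ht]
    refine (intervalIntegral.norm_integral_le_of_norm_le_const
      (f := fun r => collision (f r) e) (C := C * wt (γ - 1 / 2) e) fun r _ =>
        hcoll _ (hf.reg.dec r) e).trans (le_of_eq ?_)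
    ring
  set B := c₀ * (2 * (A + A * A)) with hB
  have hB0 : 0 ≤ B := by positivity
  refine ⟨C + (c₀ * (C₂ * C) + (C₁ * C * K + B * C)), by positivity, fun s hs t ht e => ?_⟩
  have hts := abs_nonneg (t - s)
  have hd := hdec s hs t ht
  refine ⟨(hd.le (by linarith) e).trans ?_, ?_⟩
  · refine mul_le_mul_of_nonneg_right (le_add_of_nonneg_right (by positivity)) hts
  rcases le_or_gt e 0 with he | he
  · rw [collision_of_nonpos hγ' (hf.reg.dec t) he, collision_of_nonpos hγ' (hf.reg.dec s) he]
    simp only [sub_self, abs_zero]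
    positivity
  have h1 := hloss _ _ _ (hf.reg.dec t) (hf.reg.dec s) hd e he
  have h2 := hgain _ _ _ (hf.reg.dec t) (hf.reg.dec s) hd e he
  have h3 : |f t e| ≤ K * (1 + e) ^ (-γ) := by
    rw [← wt_of_pos he]; exact (hf.reg.dec t).bound e
  have h4 : |lossRate (f s) e| ≤ B * √(1 + e) := by
    have h5 := (hf.reg.dec s).mom_le hγ'
    have h6 := (hf.reg.dec s).mom_nonneg
    refine (abs_lossRate_le hγ' (hf.reg.dec s) he).trans ?_
    rw [hB, hA]
    gcongr
  have h5 : |f t e - f s e| ≤ C * |t - s| * (1 + e) ^ (-(γ - 1 / 2)) := by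
    rw [← wt_of_pos he]; exact hd.bound e
  have h6 : √(1 + e) * (1 + e) ^ (-γ) ≤ 1 := by
    rw [sqrt_mul_rpow he]; exact wt_le_one (by linarith) e
  have h7 : √(1 + e) * (1 + e) ^ (-(γ - 1 / 2)) ≤ 1 := by
    rw [sqrt_mul_rpow he]; exact wt_le_one (by linarith) e
  have j1 : |c₀ * (gain (f t) e - gain (f s) e)| ≤ c₀ * (C₂ * (C * |t - s|)) := by
    rw [abs_mul, abs_of_pos hc]
    exact mul_le_mul_of_nonneg_left h2 hc.le
  have j2 : |(lossRate (f t) e - lossRate (f s) e) * f t e| ≤ C₁ * (C * |t - s|) * K := by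
    rw [abs_mul]
    calc _ ≤ (C₁ * (C * |t - s|) * √(1 + e)) * (K * (1 + e) ^ (-γ)) := by gcongr
      _ = C₁ * (C * |t - s|) * K * (√(1 + e) * (1 + e) ^ (-γ)) := by ring
      _ ≤ _ := mul_le_of_le_one_right (by positivity) h6
  have j3 : |lossRate (f s) e * (f t e - f s e)| ≤ B * (C * |t - s|) := by
    rw [abs_mul]
    calc _ ≤ (B * √(1 + e)) * (C * |t - s| * (1 + e) ^ (-(γ - 1 / 2))) := by gcongr
      _ = B * (C * |t - s|) * (√(1 + e) * (1 + e) ^ (-(γ - 1 / 2))) := by ring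
      _ ≤ _ := mul_le_of_le_one_right (by positivity) h7
  have hsplit : collision (f t) e - collision (f s) e =
      c₀ * (gain (f t) e - gain (f s) e) - ((lossRate (f t) e - lossRate (f s) e) * f t e +
        lossRate (f s) e * (f t e - f s e)) := by
    rw [collision_eq hγ' (hf.reg.dec t), collision_eq hγ' (hf.reg.dec s)]; ring
  rw [hsplit]
  have hCt : 0 ≤ C * |t - s| := by positivity
  calc _ ≤ c₀ * (C₂ * (C * |t - s|)) + (C₁ * (C * |t - s|) * K + B * (C * |t - s|)) :=
        (abs_sub _ _).trans (add_le_add j1 ((abs_add_le _ _).trans (add_le_add j2 j3)))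
    _ = (c₀ * (C₂ * C) + (C₁ * C * K + B * C)) * |t - s| := by ring
    _ ≤ _ := mul_le_mul_of_nonneg_right (le_add_of_nonneg_left hC) hts

/-- The solution is differentiable in time as a map into `L^∞`, because its derivative is Lipschitz
uniformly in the energy. -/
lemma IsSol.memW1InftyLinfty (hγ : 3 < γ) (hT : 0 < T) (hf : IsSol γ K T f₀ f) :
    MemW1InftyLinfty T f := by
  have hγ' : 5 / 2 < γ := by linarith
  obtain ⟨C, hC, hlip⟩ := hf.exists_lipschitz hγ
  obtain ⟨C', hC', hcoll⟩ := exists_collision_le hγ K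
  have hfL : ∀ t, MemLp (f t) ∞ halfLine := fun t => (hf.reg.dec t).memLp (by linarith)
  have hcL : ∀ t, MemLp (collision (f t)) ∞ halfLine := fun t =>
    Dec.memLp (β := γ - 1 / 2) (by linarith)
      ⟨(hf.reg.dec t).measurable_collision hγ', hcoll _ (hf.reg.dec t)⟩
  set u : ℝ → Lp ℝ ∞ halfLine := fun t => (hfL t).toLp (f t) with hu
  set v : ℝ → Lp ℝ ∞ halfLine := fun t => (hcL t).toLp (collision (f t)) with hv
  have hcont : ∀ {w : ℝ → Lp ℝ ∞ halfLine}, (∀ s ∈ Icc 0 T, ∀ t ∈ Icc 0 T,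
      ‖w t - w s‖ ≤ C * |t - s|) → ContinuousOn w (Icc 0 T) := fun {w} hw =>
    (LipschitzOnWith.of_dist_le_mul (K := ⟨C, hC⟩) fun t ht s hs => by
      rw [dist_eq_norm, Real.dist_eq]; exact hw s hs t ht).continuousOn
  refine ⟨u, fun t _ => (hfL t).coeFn_toLp, memW1Infty_of_hasDerivAt hT (v := v)
    (hcont fun s hs t ht => ?_) (hcont fun s hs t ht => ?_) fun t ht => ?_⟩
  · refine norm_Lp_top_le (by positivity) ?_
    filter_upwards [Lp.coeFn_sub (u t) (u s), (hfL t).coeFn_toLp, (hfL s).coeFn_toLp]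
      with e h1 h2 h3
    rw [h1, Pi.sub_apply, h2, h3]
    exact (hlip s hs t ht e).1
  · refine norm_Lp_top_le (by positivity) ?_
    filter_upwards [Lp.coeFn_sub (v t) (v s), (hcL t).coeFn_toLp, (hcL s).coeFn_toLp]
      with e h1 h2 h3
    rw [h1, Pi.sub_apply, h2, h3]
    exact (hlip s hs t ht e).2
  · have ht' := Ioo_subset_Icc_self ht
    have hquad : ∀ s ∈ Icc 0 T, ‖u s - u t - (s - t) • v t‖ ≤ C * ‖‖s - t‖ ^ 2‖ := by
      intro s hs
      refine norm_Lp_top_le (by positivity) ?_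
      filter_upwards [Lp.coeFn_sub (u s - u t) ((s - t) • v t), Lp.coeFn_sub (u s) (u t),
        Lp.coeFn_smul (s - t) (v t), (hfL t).coeFn_toLp, (hfL s).coeFn_toLp,
        (hcL t).coeFn_toLp] with e h1 h2 h3 h4 h5 h6
      rw [h1, Pi.sub_apply, h2, h3, Pi.sub_apply, Pi.smul_apply, h4, h5, h6,
        hf.sub_eq_integral hγ ht' hs, smul_eq_mul,
        ← smul_eq_mul (s - t) (collision (f t) e), ← intervalIntegral.integral_const,
        ← intervalIntegral.integral_sub
          ((hf.reg.continuous_collision hγ' e).intervalIntegrable _ _)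
          intervalIntegrable_const]
      have : ∀ r ∈ uIoc t s, ‖collision (f r) e - collision (f t) e‖ ≤ C * |s - t| := by
        intro r hr
        have hr1 : r ∈ uIcc t s := uIoc_subset_uIcc hr
        refine ((hlip t ht' r (uIcc_subset_Icc ht' hs hr1) e).2).trans ?_
        exact mul_le_mul_of_nonneg_left (abs_sub_left_of_mem_uIcc hr1) hC
      refine (intervalIntegral.norm_integral_le_of_norm_le_const this).trans (le_of_eq ?_)
      rw [norm_pow, norm_norm, Real.norm_eq_abs]; ring
    rw [hasDerivAt_iff_isLittleO]
    have hO : (fun s => u s - u t - (s - t) • v t) =O[𝓝 t] fun s => ‖s - t‖ ^ 2 :=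
      Asymptotics.IsBigO.of_bound C (by
        filter_upwards [isOpen_Ioo.mem_nhds ht] with s hs
        exact hquad s (Ioo_subset_Icc_self hs))
    exact hO.trans_isLittleO (Asymptotics.isLittleO_pow_sub_sub t one_lt_two)

end time

/-! ### Properties of the maximal solution -/

lemma Dec.wNorm_le {γ K : ℝ} {h : ℝ → ℝ} (hd : Dec γ K h) : wNorm γ h ≤ ENNReal.ofReal K := by
  rw [wNorm, eLpNorm_exponent_top]
  refine eLpNormEssSup_le_of_ae_bound ?_
  filter_upwards [ae_restrict_mem measurableSet_Ioi] with e he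
  have he : 0 < e := he
  have h1 : 0 < (1 + e) ^ γ := Real.rpow_pos_of_pos (by linarith) _
  have h2 := hd.bound e
  rw [wt_of_pos he, Real.rpow_neg (by linarith), ← div_eq_mul_inv, le_div_iff₀ h1] at h2
  rwa [Real.norm_eq_abs, abs_mul, abs_of_pos h1, mul_comm]

lemma exists_dec_representative {γ : ℝ} {B : ℝ≥0} {f₀ : ℝ → ℝ} (hf₀ : MemW γ f₀)
    (h0 : ∀ᵐ e ∂halfLine, 0 ≤ f₀ e) (hB : wNorm γ f₀ ≤ B) :
    ∃ f₀' : ℝ → ℝ, Dec γ B f₀' ∧ (∀ u, 0 ≤ f₀' u) ∧ f₀ =ᵐ[halfLine] f₀' := by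
  obtain ⟨k, hkm, hk⟩ := hf₀.1
  have hkm := hkm.measurable
  have hw := measurable_wt γ
  refine ⟨fun e => max 0 (min (k e) (B * wt γ e)), ⟨by fun_prop, fun e => ?_⟩,
    fun u => le_max_left _ _, ?_⟩
  · rw [abs_of_nonneg (le_max_left _ _)]
    exact max_le (mul_nonneg B.2 (wt_nonneg _ _)) (min_le_right _ _)
  · filter_upwards [hk, h0, ae_abs_le_of_wNorm_le hB] with e h1 h2 h3
    rw [← h1, min_eq_left ((le_abs_self _).trans h3), max_eq_right h2]

section

variable {γ B K S : ℝ} {f₀ f₀' : ℝ → ℝ} {f F g : ℝ → ℝ → ℝ} {Tmax T' : EReal}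

/-- The exhaustion by countably many compact intervals; those with negative endpoint are empty. -/
lemma timeIco_eq_iUnion (T' : EReal) :
    timeIco 0 T' = ⋃ q : {q : ℚ // ((q : ℝ) : EReal) < T'}, Icc 0 ((q : ℚ) : ℝ) := by
  ext t
  simp only [timeIco, mem_iUnion, mem_Icc]
  constructor
  · rintro ⟨h0, h1⟩
    obtain ⟨q, hq, hq'⟩ := EReal.lt_iff_exists_rat_btwn.1 h1
    exact ⟨⟨q, hq'⟩, h0, (EReal.coe_lt_coe_iff.1 hq).le⟩
  · rintro ⟨q, h0, h1⟩
    exact ⟨h0, (EReal.coe_le_coe_iff.2 h1).trans_lt q.2⟩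

lemma IsSol.eq_mildRHS (hγ : 3 < γ) (hf : IsSol γ K S f₀' f) {t e : ℝ} (ht : t ∈ Icc 0 S)
    (h0 : f₀ e = f₀' e) : f t e = mildRHS 0 f₀ f t e := by
  have hγ' : 5 / 2 < γ := by linarith
  have ha := hf.reg.continuous_lossRate hγ' e
  have hb := (hf.reg.continuous_gain hγ' e).const_mul c₀
  rw [mildRHS_eq_duhamel]
  exact ode_unique ha (hf.reg.cont e).continuousOn (continuous_duhamel ha hb _).continuousOn
    (fun t ht => hf.hasDerivAt' hγ ht e) (fun t _ => hasDerivAt_duhamel ha hb _ t)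
    (by simp only [duhamel_zero, hf.init, h0]) t ht

lemma mildRHS_congr (h : ∀ t ∈ Icc 0 S, f t = F t) {t : ℝ} (ht : t ∈ Icc 0 S) (e : ℝ) :
    mildRHS 0 f₀ f t e = mildRHS 0 f₀ F t e := by
  rw [mildRHS_eq_duhamel, mildRHS_eq_duhamel]
  refine duhamel_congr_ae ?_ _ ht
  filter_upwards [ae_restrict_mem measurableSet_Icc] with s hs
  rw [h s hs]
  exact ⟨rfl, rfl⟩

lemma setIntegral_Ioi_eq {β : ℝ} {h φ ψ : ℝ → ℝ} (hd : Dec β K h)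
    (hφ : ∀ e, 0 < e → φ e = ψ e) : ∫ e in Ioi (0 : ℝ), h e * φ e = ∫ e, h e * ψ e := by
  rw [setIntegral_congr_fun (g := fun e => h e * ψ e) measurableSet_Ioi fun e he => by
    simp only [hφ e he]]
  exact setIntegral_eq_integral_of_forall_compl_eq_zero fun e he => by
    rw [hd.zero (not_lt.1 he), zero_mul]

lemma IsSol.integral_rpow_eq (hγ : 3 < γ) (hf : IsSol γ K S f₀' f) {t : ℝ} (ht : t ∈ Icc 0 S)
    (h0 : f₀ =ᵐ[halfLine] f₀') {w : ℝ} (hw : w ∈ ({1 / 2, 3 / 2} : Set ℝ)) :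
    ∫ e in Ioi (0 : ℝ), f₀ e * e ^ w = ∫ e in Ioi (0 : ℝ), f t e * e ^ w := by
  have hd0 : Dec γ K f₀' := by
    rw [show f₀' = f 0 from funext fun e => (hf.init e).symm]; exact hf.reg.dec 0
  have h1 : ∫ e in Ioi (0 : ℝ), f₀ e * e ^ w = ∫ e in Ioi (0 : ℝ), f₀' e * e ^ w :=
    integral_congr_ae (by filter_upwards [h0] with e he; rw [he])
  rw [h1]
  rcases hw with rfl | rfl
  · have h2 : ∀ e : ℝ, 0 < e → e ^ (1 / 2 : ℝ) = √e * (1 + 0 * e) := fun e _ => by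
      rw [Real.sqrt_eq_rpow]; ring
    rw [setIntegral_Ioi_eq hd0 h2, setIntegral_Ioi_eq (hf.reg.dec t) h2]
    exact (hf.conserved hγ zero_le_one le_rfl le_rfl zero_le_one ht).symm
  · have h2 : ∀ e : ℝ, 0 < e → e ^ (3 / 2 : ℝ) = √e * (0 + 1 * e) := fun e he => by
      rw [Real.sqrt_eq_rpow, zero_add, one_mul]
      nth_rewrite 3 [← Real.rpow_one e]
      rw [← Real.rpow_add he]; norm_num
    rw [setIntegral_Ioi_eq hd0 h2, setIntegral_Ioi_eq (hf.reg.dec t) h2]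
    exact (hf.conserved hγ le_rfl zero_le_one zero_le_one le_rfl ht).symm

lemma IsMaximal.nonneg_and_eq (hγ : 3 < γ) (hF : IsMaximal γ f₀' Tmax F)
    (h0 : f₀ =ᵐ[halfLine] f₀') {t : ℝ} (ht : t ∈ timeIco 0 Tmax) :
    ∀ᵐ e ∂halfLine, 0 ≤ F t e ∧ F t e = mildRHS 0 f₀ F t e := by
  obtain ⟨K, f, hf, hfF⟩ := hF.exists_isSol t ht.1 ht.2
  have hmem : t ∈ Icc 0 t := ⟨ht.1, le_rfl⟩
  filter_upwards [h0] with e he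
  rw [← mildRHS_congr hfF hmem, ← hfF t hmem]
  exact ⟨hf.nonneg t e, hf.eq_mildRHS hγ hmem he⟩

lemma IsMaximal.memLocW (hF : IsMaximal γ f₀' Tmax F) : MemLocW γ 0 Tmax F := by
  have hW : ∀ {S : ℝ}, 0 ≤ S → (S : EReal) < Tmax → ∃ K, ∀ t ∈ Icc 0 S, Dec γ K (F t) := by
    intro S h0 h1
    obtain ⟨K, f, hf, hfF⟩ := hF.exists_isSol S h0 h1
    exact ⟨K, fun t ht => hfF t ht ▸ hf.reg.dec t⟩
  refine ⟨?_, fun t ht => ?_, fun Q hQ hsub => ?_⟩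
  · rw [timeIco_eq_iUnion, iUnion_prod_const, aestronglyMeasurable_iUnion_iff]
    rintro ⟨q, hq⟩
    rcases lt_or_ge (q : ℝ) 0 with h | h
    · simp [Icc_eq_empty (not_le.2 h)]
    obtain ⟨K, f, hf, hfF⟩ := hF.exists_isSol q h hq
    refine hf.reg.measurable_uncurry.aestronglyMeasurable.congr ?_
    filter_upwards [ae_restrict_mem (measurableSet_Icc.prod measurableSet_Ioi)] with z hz
    simp only [Function.uncurry_def, hfF z.1 hz.1]
  · obtain ⟨K, hK⟩ := hW ht.1 ht.2
    have := hK t ⟨ht.1, le_rfl⟩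
    exact ⟨this.meas.aestronglyMeasurable, this.wNorm_le.trans_lt ENNReal.ofReal_lt_top⟩
  · rcases Q.eq_empty_or_nonempty with rfl | hne
    · simp
    have hm := hsub (hQ.sSup_mem hne)
    obtain ⟨K, hK⟩ := hW hm.1 hm.2
    refine lt_of_le_of_lt (iSup₂_le fun t ht => ?_) (ENNReal.ofReal_lt_top (r := K))
    exact (hK t ⟨(hsub ht).1, le_csSup hQ.bddAbove ht⟩).wNorm_le

lemma IsMaximal.hasDerivAt (hγ : 3 < γ) (hF : IsMaximal γ f₀' Tmax F) {t : ℝ} (h0 : 0 < t)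
    (ht : (t : EReal) < Tmax) (e : ℝ) :
    HasDerivAt (fun s => F s e) (collision (F t) e) t := by
  obtain ⟨S, htS, hS⟩ := EReal.lt_iff_exists_real_btwn.1 ht
  have htS := EReal.coe_lt_coe_iff.1 htS
  obtain ⟨K, f, hf, hfF⟩ := hF.exists_isSol S (h0.trans htS).le hS
  rw [← hfF t ⟨h0.le, htS.le⟩]
  refine (hf.hasDerivAt hγ ⟨h0, htS⟩ e).congr_of_eventuallyEq ?_
  filter_upwards [isOpen_Ioo.mem_nhds (show t ∈ Ioo 0 S from ⟨h0, htS⟩)] with s hs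
  rw [hfF s (Ioo_subset_Icc_self hs)]

lemma IsMaximal.eq_of_isMildSolution (hγ : 3 < γ) (hF : IsMaximal γ f₀' Tmax F)
    (hd : Dec γ B f₀') (h0 : f₀ =ᵐ[halfLine] f₀') (hg : IsMildSolution γ 0 T' f₀ g)
    (hT : T' ≤ Tmax) :
    ∀ᵐ t ∂volume.restrict (timeIco 0 T'), ∀ᵐ e ∂halfLine, g t e = F t e := by
  rw [timeIco_eq_iUnion, ae_restrict_iUnion_iff]
  rintro ⟨q, hq⟩
  rcases le_or_gt (q : ℝ) 0 with h | h
  · have : (volume : Measure ℝ).restrict (Icc 0 (q : ℝ)) = 0 := by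
      rw [Measure.restrict_eq_zero, Real.volume_Icc, sub_zero, ENNReal.ofReal_eq_zero]
      exact h
    simp only [this, ae_zero, eventually_bot]
  obtain ⟨K, f, hf, hfF⟩ := hF.exists_isSol q h.le (hq.trans_le hT)
  obtain ⟨K', g', hg', hgg', hode⟩ := exists_reg_of_isMildSolution hγ hd h0 hg h hq
  filter_upwards [hgg', ae_restrict_mem measurableSet_Icc] with t h1 ht
  filter_upwards [h1, hf.unique_of_ae hγ hg' hode] with e h1 h2
  rw [h1, h2 t ht, hfF t ht]

/-- A mild solution past `Tmax` would be bounded near `Tmax`, where the maximal solution blows up. -/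
lemma IsMaximal.le_of_isMildSolution (hγ : 3 < γ) (hF : IsMaximal γ f₀' Tmax F)
    (hpos : 0 < Tmax) (hd : Dec γ B f₀') (h0 : f₀ =ᵐ[halfLine] f₀')
    (hg : IsMildSolution γ 0 T' f₀ g) : T' ≤ Tmax := by
  by_contra! hlt
  obtain ⟨S, rfl⟩ : ∃ S : ℝ, Tmax = (S : EReal) :=
    ⟨Tmax.toReal, (EReal.coe_toReal (hlt.trans_le le_top).ne (bot_le.trans_lt hpos).ne').symm⟩
  have hS : 0 < S := EReal.coe_pos.1 hpos
  obtain ⟨K, g', hg', -, hode⟩ := exists_reg_of_isMildSolution hγ hd h0 hg hS hlt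
  have hb : ∀ᶠ t in 𝓝[<] S, eLpNorm (F t) ∞ halfLine ≤ ENNReal.ofReal K := by
    filter_upwards [Ioo_mem_nhdsLT hS] with t ht
    obtain ⟨K', f, hf, hfF⟩ := hF.exists_isSol t ht.1.le (EReal.coe_lt_coe_iff.2 ht.2)
    have hmem : t ∈ Icc 0 t := ⟨ht.1.le, le_rfl⟩
    rw [eLpNorm_exponent_top]
    refine eLpNormEssSup_le_of_ae_bound ?_
    have := hf.unique_of_ae hγ hg' (by
      filter_upwards [hode] with e he
      exact ⟨he.1, fun s hs => he.2 s ⟨hs.1, hs.2.trans ht.2⟩⟩)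
    filter_upwards [this] with e he
    rw [← hfF t hmem, ← he t hmem]
    exact (hg'.dec t).le (by linarith) e
  have h1 := limsup_le_of_le (by isBoundedDefault) hb
  rw [hF.blowup S rfl] at h1
  exact absurd h1 (not_le.2 ENNReal.ofReal_lt_top)

end

end Nordheim

end

theorem theorem3p1 (γ : ℝ) (hγ : 3 < γ) (B : ℝ≥0) :
    ∃ T : ℝ, 0 < T ∧ ∀ f₀ : ℝ → ℝ, Nordheim.MemW γ f₀ → (∀ᵐ ε ∂Nordheim.halfLine, 0 ≤ f₀ ε) →
      Nordheim.wNorm γ f₀ ≤ B →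
      ∃ (Tmax : EReal) (f : ℝ → ℝ → ℝ), (T : EReal) ≤ Tmax ∧
        -- `f` is a nonnegative mild solution on `[0, Tmax)`, in particular on `[0, T)`;
        -- the mild equation holds for every time
        Nordheim.IsMildSolution γ 0 Tmax f₀ f ∧
        (∀ t ∈ Nordheim.timeIco 0 Tmax, ∀ᵐ ε ∂Nordheim.halfLine,
          0 ≤ f t ε ∧ f t ε = Nordheim.mildRHS 0 f₀ f t ε) ∧
        -- uniqueness (on `[0, T)`, and on every other interval), and maximality of `Tmax`
        (∀ (T' : EReal) (g : ℝ → ℝ → ℝ), Nordheim.IsMildSolution γ 0 T' f₀ g →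
          T' ≤ Tmax ∧ ∀ᵐ t ∂(volume.restrict (Nordheim.timeIco 0 T')),
            ∀ᵐ ε ∂Nordheim.halfLine, g t ε = f t ε) ∧
        -- conservation of mass and energy
        (∀ t ∈ Ioo 0 T, ∀ w ∈ ({1 / 2, 3 / 2} : Set ℝ),
          4 * Real.pi * √2 * ∫ ε in Ioi (0 : ℝ), f₀ ε * ε ^ w =
            4 * Real.pi * √2 * ∫ ε in Ioi (0 : ℝ), f t ε * ε ^ w) ∧
        -- regularity in time
        Nordheim.MemW1InftyLinfty T f ∧
        -- the equation holds for every `t` and almost every `ε`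
        (∀ t : ℝ, 0 < t → (t : EReal) < Tmax → ∀ᵐ ε ∂Nordheim.halfLine,
          HasDerivAt (fun s => f s ε) (Nordheim.collision (f t) ε) t) ∧
        -- blow-up at a finite maximal time
        (∀ S : ℝ, Tmax = (S : EReal) →
          limsup (fun t => eLpNorm (f t) ∞ Nordheim.halfLine) (𝓝[<] S) = ∞) := by
  obtain ⟨T, hT, hloc⟩ := Nordheim.exists_local hγ B.2
  refine ⟨T, hT, fun f₀ hf₀ hnn hB => ?_⟩
  obtain ⟨f₀', hd, h0, hae⟩ := Nordheim.exists_dec_representative hf₀ hnn hB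
  obtain ⟨Tmax, F, hF⟩ := Nordheim.exists_isMaximal hγ hd h0
  obtain ⟨f, hf⟩ := hloc f₀' hd h0
  have hTmax : (T : EReal) < Tmax := hF.lt T _ f hT.le hf
  have hpos : 0 < Tmax := (EReal.coe_pos.2 hT).trans hTmax
  obtain ⟨K, f, hf, hfF⟩ := hF.exists_isSol T hT.le hTmax
  have hmild : ∀ t ∈ Nordheim.timeIco 0 Tmax, ∀ᵐ ε ∂Nordheim.halfLine,
      0 ≤ F t ε ∧ F t ε = Nordheim.mildRHS 0 f₀ F t ε := fun t ht => hF.nonneg_and_eq hγ hae ht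
  have hmeas : MeasurableSet (Nordheim.timeIco 0 Tmax) := by
    rw [Nordheim.timeIco_eq_iUnion]
    exact MeasurableSet.iUnion fun _ => measurableSet_Icc
  refine ⟨Tmax, F, hTmax.le, ⟨le_rfl, hpos, hF.memLocW, ?_⟩, hmild, fun T' g hg => ?_,
    fun t ht w hw => ?_, ?_, fun t h0 ht => ae_of_all _ (hF.hasDerivAt hγ h0 ht), hF.blowup⟩
  · filter_upwards [ae_restrict_mem hmeas] with t ht
    exact (hmild t ht).mono fun e he => he.2
  · have hle := hF.le_of_isMildSolution hγ hpos hd hae hg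
    exact ⟨hle, hF.eq_of_isMildSolution hγ hd hae hg hle⟩
  · have ht' := Ioo_subset_Icc_self ht
    rw [hf.integral_rpow_eq hγ ht' hae hw, hfF t ht']
  · obtain ⟨u, hu, hW⟩ := hf.memW1InftyLinfty hγ hT
    exact ⟨u, fun t ht => hfF t (Ioo_subset_Icc_self ht) ▸ hu t ht, hW⟩
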